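/- Let $k$ be a field, $X$ a finite group, $G\le X$ a subgroup and $M\subset X$ a set of representatives with $e\in M$ such that every $x\in X$ factors uniquely as $x=us$ with $u\in G$, $s\in M$. For $s,t\in M$, $u\in G$ define $s\cdot t,\ s\triangleleft u\in M$ and $\tau(s,t),\ s\triangleright u\in G$ by the factorisations $st=\tau(s,t)(s\cdot t)$ and $su=(s\triangleright u)(s\triangleleft u)$ in $X$. Assume left division: for all $s,t\in M$ there is a unique $p\in M$ with $s\cdot p=t$. Write $s^L$, $s^R$ for the elements with $s^L\cdot s=e=s\cdot s^R$. **The category $\mathcal D$.** Its objects are finite-dimensional $k$-vector spaces $V$ with an $M$-grading $\langle\xi\rangle$ and a $G$-grading $|\xi|$ (simultaneously, i.e. $V$ is the direct sum of its bihomogeneous components), a right linear action $\bar\triangleleft$ of $G$, and linear maps $t\,\bar\triangleright:V\to V$ ($t\in M$) with $e\,\bar\triangleright\,\xi=\xi$, such that for homogeneous $\eta$, $\kappa$ the elements $\eta\bar\triangleleft u$, $s\bar\triangleright\eta$ are homogeneous and $$\langle\eta\bar\triangleleft u\rangle=\langle\eta\rangle\triangleleft u,\qquad |\eta\bar\triangleleft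 u|=(\langle\eta\rangle\triangleright u)^{-1}|\eta|u,$$ $$s\cdot\langle\eta\rangle=\langle s\bar\triangleright\eta\rangle\cdot(s\triangleleft|\eta|),\qquad \tau(s,\langle\eta\rangle)^{-1}(s\triangleright|\eta|)=\tau(\langle s\bar\triangleright\eta\rangle,s\triangleleft|\eta|)^{-1}|s\bar\triangleright\eta|,$$ $$p\,\bar\triangleright(t\,\bar\triangleright\kappa)=\big((p'\cdot t)\bar\triangleright\kappa\big)\bar\triangleleft\,\tau\big(p'\triangleleft(t\triangleright|\kappa|),\,t\triangleleft|\kappa|\big)^{-1},\qquad p'=p\triangleleft\tau(\langle t\bar\triangleright\kappa\rangle,t\triangleleft|\kappa|)\,\tau(t,\langle\kappa\rangle)^{-1},$$ $$(s\bar\triangleright\eta)\bar\triangleleft\big((s\triangleleft|\eta|)\triangleright u\big)=\big(s\triangleleft(\langle\eta\rangle\triangleright u)\big)\bar\triangleright(\eta\bar\triangleleft u).$$ Morphisms are the linear maps preserving both gradings and both actions. Put $\|\xi\|=|\xi|^{-1}\langle\xi\rangle\in X$. The group $X$ acts on the right of every object by $\xi\hat\triangleleft us=(\xi\bar\triangleleft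 u)\hat\triangleleft s$, $\xi\hat\triangleleft s=\big((s^L\triangleleft|\xi|^{-1})\bar\triangleright\xi\big)\bar\triangleleft\tau(s^L,s)$, and $\|\xi\hat\triangleleft x\|=x^{-1}\|\xi\|x$. On the set $Y=X$ put, for $y=us$ and $z=vt$ ($u,v\in G$, $s,t\in M$), $y\circ z=vust$, $\tilde\tau(y,z)=\tau(s,t)$, $y\,\tilde\triangleleft\,x=x^{-1}yx$, and $y\,\tilde\triangleright\,x=s\,x\,s'^{-1}$, where $s'$ is the $M$-part of $x^{-1}yx$. Then $\mathcal D$ is a braided tensor category, with $\|\xi\otimes\eta\|=\|\xi\|\circ\|\eta\|$, $(\xi\otimes\eta)\hat\triangleleft x=\xi\hat\triangleleft(\|\eta\|\tilde\triangleright x)\otimes\eta\hat\triangleleft x$, unit object $k$ (trivial gradings and actions), associator $(\xi\otimes\eta)\otimes\zeta\mapsto\xi\bar\triangleleft\tau(\langle\eta\rangle,\langle\zeta\rangle)\otimes(\eta\otimes\zeta)$, the usual unit isomorphisms, and braiding $\Psi(\xi\otimes\eta)=\langle\xi\rangle\bar\triangleright\eta\otimes\xi\bar\triangleleft|\eta|$.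 In $(Y,\circ)$ let $y^L\circ y=e=y\circ y^R$. The dual $V'$ of an object $V$ has $\|\alpha\|=y^L$ if $\alpha$ vanishes on every homogeneous component of $V$ except that with $\|\xi\|=y$, and, for $z=\|\eta\|$, $$(\alpha\hat\triangleleft v)(\eta)=\alpha\big(\eta\hat\triangleleft\tilde\tau(z^L,z)^{-1}\,(z^L\tilde\triangleright v^{-1})\,\tilde\tau(z^L\tilde\triangleleft v^{-1},(z^L\tilde\triangleleft v^{-1})^R)\big);$$ $\mathrm{ev}_V:V'\otimes V\to k$ is $\alpha\otimes\xi\mapsto\alpha(\xi)$ and $\mathrm{coev}_V:k\to V\otimes V'$ is $1\mapsto\sum_\xi\xi\bar\triangleleft\tau(\langle\xi\rangle^L,\langle\xi\rangle)^{-1}\otimes\hat\xi$, over a homogeneous basis $\{\xi\}$ with dual basis $\{\hat\xi\}$. **The object $D$.** Let $D$ have basis $\delta_y\otimes x$ ($y\in Y$, $x\in X$), with $\|h\|$ for $h=\delta_y\otimes x$ the unique solution of $y\circ\|h\|=x^{-1}yx$ and $h\hat\triangleleft z=\delta_{y\tilde\triangleleft q}\otimes q^{-1}xz$, $q=\|h\|\tilde\triangleright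 z$. It is an object of $\mathcal D$, and for every object $V$ the canonical action $\xi\hat\triangleleft(\delta_y\otimes x)=\delta_{y,\|\xi\|}\,\xi\hat\triangleleft x$ is a morphism $V\otimes D\to V$. **Theorem.** $D$ is a braided Hopf algebra (a Hopf monoid) in $\mathcal D$ with the following structure morphisms. 1. *Explicit formulas.* With $h=\delta_y\otimes x$, $a=\|\delta_y\otimes x\|$ and $b=\|\delta_w\otimes z\|$: $$\mu\big((\delta_y\otimes x)\otimes(\delta_w\otimes z)\big)=\delta_{w,\,x^{-1}yx}\ \delta_{y\tilde\triangleleft\tilde\tau(a,b)}\otimes\tilde\tau(a,b)^{-1}xz,\qquad 1=\sum_y\delta_y\otimes e,\qquad \epsilon(\delta_y\otimes x)=\delta_{y,e},$$ $$\Delta(h)=\sum_{z,w:\,zw=y}\big(\delta_{w\tilde\triangleleft|h||h_{(2)}|^{-1}|h_{(1)}|^{-1}}\otimes|h_{(1)}||h_{(2)}||h|^{-1}x\langle h_{(2)}\rangle^{-1}\big)\otimes\big(\delta_{z\tilde\triangleleft|h||h_{(2)}|^{-1}}\otimes|h_{(2)}||h|^{-1}x\big),$$ where $\|h_{(2)}\|=|h|^{-1}z^{-1}|h|x^{-1}zx$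 and $\|h_{(1)}\|=|h_{(2)}|\,\|h\|\,\langle h_{(2)}\rangle^{-1}$, and $$S(\delta_y\otimes x)=\delta_{y^{-1}|h|\langle h\rangle^{-1}}\otimes\langle h\rangle x^{-1}|h|.$$ 2. *Diagrams.* $\mu$, $1$, $\epsilon$, $\Delta$, $S$ are respectively the unique morphisms such that, for all objects $V,W$ of $\mathcal D$: acting on $V$ by $D$ twice equals (after the associator) acting by the product $\mu$; $1$ acts trivially on $V$; the canonical action on the unit object is multiplication by $\epsilon$; the canonical action on $V\otimes W$ is $(V\otimes W)\otimes D\xrightarrow{I\otimes\Delta}(V\otimes W)\otimes(D\otimes D)\to(V\otimes D)\otimes(W\otimes D)\to V\otimes W$, where the second map is the braiding $\Psi_{W,D}$ with associators and the last is the two canonical actions; and $\xi\otimes h\mapsto\xi\hat\triangleleft S(h)$ is the composite $$V\otimes D\xrightarrow{\ \mathrm{coev}_V\otimes\Psi^{-1}\ }(V\otimes V')\otimes(D\otimes V)\to V\otimes((V'\otimes D)\otimes V)\xrightarrow{\ I\otimes(\hat\triangleleft\otimes I)\ }V\otimes(V'\otimes V)\xrightarrow{\ I\otimes\mathrm{ev}_V\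 }V$$ (unit isomorphisms and associators understood). 3. *Antipode axioms.* $\mu(I\otimes S)\Delta=1.\epsilon=\mu(S\otimes I)\Delta$. 4. *The representations of $D$ comprise $\mathcal D$.* For a finite-dimensional vector space $V$, a bilinear map $V\times D\to V$, $(\xi,h)\mapsto\xi\triangleleft h$, is the canonical action of an object structure of $\mathcal D$ on $V$, which is then unique, if and only if it is a representation of $D$, that is: $\xi\triangleleft1=\xi$; with $\xi\triangleleft x:=\xi\triangleleft\sum_y\delta_y\otimes x$ for $x\in X$ one has $\xi\triangleleft xz=(\xi\triangleleft x)\triangleleft z$; and $(\xi\triangleleft h)\triangleleft h'=(\xi\triangleleft\tilde\tau(\|h\|,\|h'\|))\triangleleft(hh')$ for all $\xi\in V$ and homogeneous $h,h'\in D$. A linear map between objects of $\mathcal D$ is a morphism of $\mathcal D$ if and only if it commutes with the canonical actions of $D$. -/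

import Mathlib

open CategoryTheory MonoidalCategory TensorProduct

universe u

/-- A subgroup `G` of a group `X` with a set `M` of left coset representatives, i.e. every `x : X`
is uniquely `x = u s` with `u ∈ G`, `s ∈ M`; it is assumed that `M` contains the identity and that
`(M, ·)` has left division, where `s · t` is the `M`-component of the product `s t` in `X`. -/
structure CosetReps (X : Type u) [Group X] where
  G : Subgroup X
  M : Set X
  compl : Subgroup.IsComplement (G : Set X) M
  one_mem : (1 : X) ∈ M
  leftDiv : ∀ s t : M, ∃! p : M, (compl.equiv ((s : X) * (p : X))).2 = t

namespace CosetReps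

variable {X : Type u} [Group X] (R : CosetReps X)

/-- The `G`-part `u` of the unique factorisation `x = u s`. -/
noncomputable def gp (x : X) : R.G := ⟨(R.compl.equiv x).1.1, (R.compl.equiv x).1.2⟩

/-- The `M`-part `s` of the unique factorisation `x = u s`. -/
noncomputable def mp (x : X) : R.M := (R.compl.equiv x).2

/-- `s · t`, where `s t = τ(s,t) (s · t)`. -/
noncomputable def dot (s t : R.M) : R.M := R.mp ((s : X) * (t : X))

/-- `τ(s,t)`, where `s t = τ(s,t) (s · t)`. -/
noncomputable def tau (s t : R.M) : R.G := R.gp ((s : X) * (t : X))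

/-- `s ▷ u`, where `s u = (s ▷ u) (s ◁ u)`. -/
noncomputable def lact (s : R.M) (v : R.G) : R.G := R.gp ((s : X) * (v : X))

/-- `s ◁ u`, where `s u = (s ▷ u) (s ◁ u)`. -/
noncomputable def ract (s : R.M) (v : R.G) : R.M := R.mp ((s : X) * (v : X))

/-- The identity element of `M`. -/
def e : R.M := ⟨1, R.one_mem⟩

/-- The left inverse: `sᴸ · s = e` (see `dot_lInv`). -/
noncomputable def lInv (s : R.M) : R.M := R.mp ((s : X)⁻¹)

/-- The left division: `s · (ldiv s t) = t`. -/
noncomputable def ldiv (s t : R.M) : R.M := (R.leftDiv s t).choose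

/-- The right inverse: `s · sᴿ = e`. -/
noncomputable def rInv (s : R.M) : R.M := R.ldiv s R.e

lemma gp_mul_mp (x : X) : (R.gp x : X) * (R.mp x : X) = x :=
  R.compl.equiv_fst_mul_equiv_snd x

lemma mp_eq (x : X) : (R.mp x : X) = (R.gp x : X)⁻¹ * x := by
  rw [eq_inv_mul_iff_mul_eq, gp_mul_mp]

lemma gp_eq (x : X) : (R.gp x : X) = x * (R.mp x : X)⁻¹ := by
  rw [eq_mul_inv_iff_mul_eq, gp_mul_mp]

lemma factor_unique (v : R.G) (s : R.M) (x : X) (h : (v : X) * (s : X) = x) :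
    R.gp x = v ∧ R.mp x = s := by
  have : R.compl.equiv x = (⟨v.1, v.2⟩, s) := by
    rw [← R.compl.equiv.apply_symm_apply (⟨v.1, v.2⟩, s)]
    congr 1
    exact h.symm
  simp [gp, mp, this]

lemma mp_mul (v : R.G) (x : X) : R.mp ((v : X) * x) = R.mp x :=
  (R.factor_unique (v * R.gp x) (R.mp x) _ (by
    rw [Subgroup.coe_mul, mul_assoc, gp_mul_mp])).2

lemma gp_mul (v : R.G) (x : X) : R.gp ((v : X) * x) = v * R.gp x :=
  (R.factor_unique (v * R.gp x) (R.mp x) _ (by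
    rw [Subgroup.coe_mul, mul_assoc, gp_mul_mp])).1

lemma mp_congr {x y : X} (v : R.G) (h : x = v * y) : R.mp x = R.mp y := by
  rw [h, mp_mul]

@[simp] lemma mp_mp_mul (x y : X) : R.mp ((R.mp x : X) * y) = R.mp (x * y) :=
  R.mp_congr (R.gp x)⁻¹ (by rw [mp_eq]; simp [mul_assoc])

@[simp] lemma mp_coe (s : R.M) : R.mp (s : X) = s := (R.factor_unique 1 s _ (by simp)).2

@[simp] lemma gp_coe (v : R.G) : R.gp (v : X) = v := (R.factor_unique v R.e _ (by simp [e])).1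

@[simp] lemma mp_coeG (v : R.G) : R.mp (v : X) = R.e := (R.factor_unique v R.e _ (by simp [e])).2

@[simp] lemma coe_e : ((R.e : R.M) : X) = 1 := rfl

@[simp] lemma mp_one : R.mp 1 = R.e := (R.factor_unique 1 R.e _ (by simp [e])).2

@[simp] lemma gp_one : R.gp 1 = 1 := (R.factor_unique 1 R.e _ (by simp [e])).1

lemma mp_eq_e_iff (x : X) : R.mp x = R.e ↔ x ∈ R.G := by
  constructor
  · intro h
    have := R.gp_mul_mp x
    rw [h, coe_e, mul_one] at this
    rw [← this]; exact (R.gp x).2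
  · intro h
    exact R.mp_coeG ⟨x, h⟩

lemma dot_lInv (s : R.M) : R.dot (R.lInv s) s = R.e := by
  simp [dot, lInv]

lemma dot_ldiv (s t : R.M) : R.dot s (R.ldiv s t) = t := (R.leftDiv s t).choose_spec.1

lemma ldiv_unique (s t p : R.M) (h : R.dot s p = t) : p = R.ldiv s t :=
  (R.leftDiv s t).choose_spec.2 p h

lemma dot_rInv (s : R.M) : R.dot s (R.rInv s) = R.e := R.dot_ldiv s R.e

lemma rInv_lInv (s : R.M) : R.rInv (R.lInv s) = s :=
  (R.ldiv_unique _ _ _ (R.dot_lInv s)).symm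

/-! ### Degrees

A pair of gradings `⟨ξ⟩ ∈ M`, `|ξ| ∈ G` is recorded by the single element
`‖ξ‖ = |ξ|⁻¹ ⟨ξ⟩` of `X`; by unique factorisation `⟨ξ⟩` and `|ξ|` are recovered from `‖ξ‖`. -/

/-- The `M`-grade `⟨y⟩` encoded by `y = |y|⁻¹ ⟨y⟩`. -/
noncomputable def ang (y : X) : R.M := R.mp y

/-- The `G`-grade `|y|` encoded by `y = |y|⁻¹ ⟨y⟩`. -/
noncomputable def abv (y : X) : R.G := (R.gp y)⁻¹

/-- `z` is the degree of `η ◁ v` for `η` of degree `y`: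
`⟨η ◁ v⟩ = ⟨η⟩ ◁ v` and `|η ◁ v| = (⟨η⟩ ▷ v)⁻¹ |η| v`. -/
def GConn (y : X) (v : R.G) (z : X) : Prop :=
  R.ang z = R.ract (R.ang y) v ∧ R.abv z = (R.lact (R.ang y) v)⁻¹ * R.abv y * v

/-- `z` is the degree of `s ⊳ η` for `η` of degree `y`:
`s · ⟨η⟩ = ⟨s ⊳ η⟩ · (s ◁ |η|)` and
`τ(s,⟨η⟩)⁻¹ (s ▷ |η|) = τ(⟨s ⊳ η⟩, s ◁ |η|)⁻¹ |s ⊳ η|`. -/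
def MConn (s : R.M) (y z : X) : Prop :=
  R.dot s (R.ang y) = R.dot (R.ang z) (R.ract s (R.abv y)) ∧
    (R.tau s (R.ang y))⁻¹ * R.lact s (R.abv y) =
      (R.tau (R.ang z) (R.ract s (R.abv y)))⁻¹ * R.abv z

/-- The degree of `s ⊳ η` for `η` of degree `y`, solved explicitly (see `mConn_iff`). -/
noncomputable def mdeg (s : R.M) (y : X) : X :=
  (R.ract s (R.abv y) : X) * y * (R.ract s (R.abv y) : X)⁻¹

/-- The degree of `ξ ⊗ η` for `ξ`, `η` of degrees `a`, `b`: `⟨ξ ⊗ η⟩ = ⟨ξ⟩ · ⟨η⟩` and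
`|ξ ⊗ η| = τ(⟨ξ⟩,⟨η⟩)⁻¹ |ξ| |η|`. -/
noncomputable def tdeg (a b : X) : X :=
  (((R.tau (R.ang a) (R.ang b))⁻¹ * R.abv a * R.abv b : R.G) : X)⁻¹ *
    (R.dot (R.ang a) (R.ang b) : X)

lemma abv_ang (y : X) : (R.abv y : X)⁻¹ * (R.ang y : X) = y := by
  simp [abv, ang, gp_mul_mp]

lemma coe_abv (y : X) : (R.abv y : X) = (R.ang y : X) * y⁻¹ := by
  simp [abv, ang, gp_eq]

lemma tau_mul_dot (s t : R.M) : (R.tau s t : X) * (R.dot s t : X) = s * t := R.gp_mul_mp _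

lemma lact_mul_ract (s : R.M) (v : R.G) : (R.lact s v : X) * (R.ract s v : X) = s * v :=
  R.gp_mul_mp _

lemma coe_tau (s t : R.M) : (R.tau s t : X) = s * t * (R.dot s t : X)⁻¹ := R.gp_eq _

lemma coe_lact (s : R.M) (v : R.G) : (R.lact s v : X) = s * v * (R.ract s v : X)⁻¹ := R.gp_eq _

@[simp] lemma ract_mul (s : R.M) (v w : R.G) : R.ract (R.ract s v) w = R.ract s (v * w) := by
  simp [ract, mul_assoc]

@[simp] lemma ract_one (s : R.M) : R.ract s 1 = s := by simp [ract]

lemma gConn_iff (y : X) (v : R.G) (z : X) : R.GConn y v z ↔ z = (v : X)⁻¹ * y * v := by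
  constructor
  · rintro ⟨h1, h2⟩
    rw [← R.abv_ang z, h1, h2]
    simp only [Subgroup.coe_mul, Subgroup.coe_inv, mul_inv_rev, inv_inv, coe_lact, coe_abv]
    group
  · intro h
    have := R.factor_unique ((R.lact (R.ang y) v)⁻¹ * R.abv y * v)⁻¹ (R.ract (R.ang y) v) z (by
      rw [h]
      simp only [Subgroup.coe_mul, Subgroup.coe_inv, mul_inv_rev, inv_inv, coe_lact, coe_abv]
      group)
    exact ⟨this.2, by rw [abv, this.1, inv_inv]⟩

lemma mConn_iff (s : R.M) (y z : X) : R.MConn s y z ↔ z = R.mdeg s y := by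
  constructor
  · rintro ⟨h1, h2⟩
    have h3 := congrArg (fun g : R.G => (g : X)) h2
    simp only [Subgroup.coe_mul, Subgroup.coe_inv, mul_inv_rev, inv_inv, coe_lact, coe_abv,
      coe_tau, h1] at h3
    rw [mdeg]
    simp only [mul_assoc, inv_mul_cancel_left, mul_right_inj] at h3
    rw [← mul_inv_rev, ← mul_inv_rev, inv_inj] at h3
    rw [h3]
    group
  · intro h
    have h1 : R.dot s (R.ang y) = R.dot (R.ang z) (R.ract s (R.abv y)) := by
      rw [h, dot, dot, mdeg, ang, ang, mp_mp_mul]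
      refine R.mp_congr (R.lact s (R.abv y)) ?_
      simp only [coe_lact, coe_abv, ang]
      group
    refine ⟨h1, Subtype.ext ?_⟩
    simp only [Subgroup.coe_mul, Subgroup.coe_inv, mul_inv_rev, inv_inv, coe_lact, coe_abv,
      coe_tau, h1]
    rw [h, mdeg]
    group

lemma tdeg_eq (a b : X) : R.tdeg a b = (R.gp b : X) * a * (R.mp b : X) := by
  simp only [tdeg, Subgroup.coe_mul, Subgroup.coe_inv, mul_inv_rev, inv_inv, coe_abv, coe_tau]
  simp only [ang, gp_eq]
  group

section Double

variable {X : Type u} [Group X] (R : CosetReps X)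

/-- The operation `(u s) ∘ (v t) = v u s t` on the set `Y = X`. -/
noncomputable def circ (y z : X) : X := (R.gp z : X) * y * (R.mp z : X)

/-- `y ▷ x = t x t'⁻¹` on `Y × X`, where `y = v t` and `x⁻¹ y x = v' t'`. -/
noncomputable def tri (y x : X) : X := (R.mp y : X) * x * (R.mp (x⁻¹ * y * x) : X)⁻¹

/-- `τ(v t, w p) = τ(t, p)` on `Y × Y`. -/
noncomputable def ttau (y z : X) : R.G := R.tau (R.mp y) (R.mp z)

/-- The left inverse in `(Y, ∘)`: `(v t)ᴸ = v⁻¹ t⁻¹` (see `circ_yL`). -/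
noncomputable def yL (y : X) : X := (R.gp y : X)⁻¹ * (R.mp y : X)⁻¹

/-- The right inverse in `(Y, ∘)` (see `circ_yR`). -/
noncomputable def yR (y : X) : X := (y * (R.rInv (R.mp y) : X))⁻¹ * (R.rInv (R.mp y) : X)

lemma tdeg_eq_circ (a b : X) : R.tdeg a b = R.circ a b := R.tdeg_eq a b

lemma circ_yL (y : X) : R.circ (R.yL y) y = 1 := by simp [circ, yL]

lemma mul_rInv_mem (y : X) : y * (R.rInv (R.mp y) : X) ∈ R.G := by
  rw [← mp_eq_e_iff, ← mp_mp_mul]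
  exact R.dot_rInv _

lemma gp_yR (y : X) : R.gp (R.yR y) = ⟨y * (R.rInv (R.mp y) : X), R.mul_rInv_mem y⟩⁻¹ :=
  (R.factor_unique (⟨y * (R.rInv (R.mp y) : X), R.mul_rInv_mem y⟩⁻¹ : R.G) (R.rInv (R.mp y)) _
    rfl).1

lemma mp_yR (y : X) : R.mp (R.yR y) = R.rInv (R.mp y) :=
  (R.factor_unique (⟨y * (R.rInv (R.mp y) : X), R.mul_rInv_mem y⟩⁻¹ : R.G) (R.rInv (R.mp y)) _
    rfl).2

lemma circ_yR (y : X) : R.circ y (R.yR y) = 1 := by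
  rw [circ, gp_yR, mp_yR]; simp [mul_assoc]

lemma tri_mul (y x z : X) : R.tri y (x * z) = R.tri y x * R.tri (x⁻¹ * y * x) z := by
  simp only [tri]
  rw [show (x * z)⁻¹ * y * (x * z) = z⁻¹ * (x⁻¹ * y * x) * z by group]
  group

lemma tri_one (y : X) : R.tri y 1 = 1 := by simp [tri]

lemma circ_conj (a b x : X) :
    x⁻¹ * R.circ a b * x = R.circ ((R.tri b x)⁻¹ * a * R.tri b x) (x⁻¹ * b * x) := by
  simp only [circ, tri, R.gp_eq]
  group

end Double

/-- The structure of an object of the category `𝒟` on a vector space `V`: an `M`-grading `⟨ξ⟩` and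
a `G`-grading `|ξ|`, a right action `◁` of `G` and an action `⊳` of `M`.

The two gradings are given by the projections `pr y` of `V` onto the simultaneous homogeneous
component `{ξ : ⟨ξ⟩ = ⟨y⟩, |ξ| = |y|}`, with `y = |y|⁻¹ ⟨y⟩` running through `X`; thus `pr y ξ = ξ`
says that `ξ` is homogeneous with `|ξ|⁻¹ ⟨ξ⟩ = y`. -/
@[ext]
structure Str {X : Type u} [Group X] [Fintype X] (R : CosetReps X) (k : Type u) [Field k]
    (V : Type u) [AddCommGroup V] [Module k V] where
  pr : X → V →ₗ[k] V
  pr_self : ∀ y ξ, pr y (pr y ξ) = pr y ξ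
  pr_ne : ∀ y z ξ, y ≠ z → pr y (pr z ξ) = 0
  sum_pr : ∀ ξ, ∑ y, pr y ξ = ξ
  gact : R.G → V →ₗ[k] V
  gact_one : ∀ ξ, gact 1 ξ = ξ
  gact_mul : ∀ v w ξ, gact (v * w) ξ = gact w (gact v ξ)
  mact : R.M → V →ₗ[k] V
  mact_e : ∀ ξ, mact R.e ξ = ξ
  gact_deg : ∀ v y z ξ, pr y ξ = ξ → R.GConn y v z → pr z (gact v ξ) = gact v ξ
  mact_deg : ∀ s y z ξ, pr y ξ = ξ → R.MConn s y z → pr z (mact s ξ) = mact s ξ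
  mact_mact : ∀ p t y z p' κ, pr y κ = κ → R.MConn t y z →
    p' = R.ract p (R.tau (R.ang z) (R.ract t (R.abv y)) * (R.tau t (R.ang y))⁻¹) →
    mact p (mact t κ) =
      gact (R.tau (R.ract p' (R.lact t (R.abv y))) (R.ract t (R.abv y)))⁻¹ (mact (R.dot p' t) κ)
  cross : ∀ s v y η, pr y η = η →
    gact (R.lact (R.ract s (R.abv y)) v) (mact s η) =
      mact (R.ract s (R.lact (R.ang y) v)) (gact v η)

namespace Str

variable {X : Type u} [Group X] [Fintype X] {R : CosetReps X} {k : Type u} [Field k]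
  {V : Type u} [AddCommGroup V] [Module k V] (σ : Str R k V)

/-- The operation `ξ ◁ s = ((sᴸ ◁ |ξ|⁻¹) ⊳ ξ) ◁ τ(sᴸ,s)` for `s ∈ M`. -/
noncomputable def hatM (s : R.M) : V →ₗ[k] V :=
  ∑ y, σ.gact (R.tau (R.lInv s) s) ∘ₗ σ.mact (R.ract (R.lInv s) (R.abv y)⁻¹) ∘ₗ σ.pr y

/-- The right action `ξ ◁ u s = (ξ ◁ u) ◁ s` of `X` on an object of `𝒟`. -/
noncomputable def act (x : X) : V →ₗ[k] V := σ.hatM (R.mp x) ∘ₗ σ.gact (R.gp x)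

lemma sum_homog {W : Type u} [AddCommGroup W] [Module k W] (F : X → V →ₗ[k] W) {y : X} {ξ : V}
    (h : σ.pr y ξ = ξ) : ∑ z, F z (σ.pr z ξ) = F y ξ := by
  classical
  rw [Finset.sum_eq_single y]
  · rw [h]
  · intro z _ hz
    rw [← h, σ.pr_ne _ _ _ hz, map_zero]
  · simp

lemma ext_homog {W : Type u} [AddCommGroup W] [Module k W] {f g : V →ₗ[k] W}
    (h : ∀ y ξ, σ.pr y ξ = ξ → f ξ = g ξ) : f = g := by
  ext ξ
  rw [← σ.sum_pr ξ, map_sum, map_sum]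
  exact Finset.sum_congr rfl fun y _ => h y _ (σ.pr_self y ξ)

lemma pr_of_ne {y z : X} {ξ : V} (h : σ.pr y ξ = ξ) (hz : z ≠ y) : σ.pr z ξ = 0 := by
  rw [← h, σ.pr_ne _ _ _ hz]

lemma hatM_homog (s : R.M) {y : X} {ξ : V} (h : σ.pr y ξ = ξ) :
    σ.hatM s ξ = σ.gact (R.tau (R.lInv s) s) (σ.mact (R.ract (R.lInv s) (R.abv y)⁻¹) ξ) := by
  rw [hatM, LinearMap.sum_apply]
  exact σ.sum_homog (fun y => σ.gact (R.tau (R.lInv s) s) ∘ₗ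
    σ.mact (R.ract (R.lInv s) (R.abv y)⁻¹)) h

lemma gact_homog (v : R.G) {y : X} {ξ : V} (h : σ.pr y ξ = ξ) :
    σ.pr ((v : X)⁻¹ * y * v) (σ.gact v ξ) = σ.gact v ξ :=
  σ.gact_deg v y _ ξ h ((R.gConn_iff _ _ _).2 rfl)

lemma mact_homog (s : R.M) {y : X} {ξ : V} (h : σ.pr y ξ = ξ) :
    σ.pr (R.mdeg s y) (σ.mact s ξ) = σ.mact s ξ :=
  σ.mact_deg s y _ ξ h ((R.mConn_iff _ _ _).2 rfl)

lemma act_homog' (x : X) {y : X} {ξ : V} (h : σ.pr y ξ = ξ) :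
    σ.act x ξ = σ.gact (R.gp x⁻¹)⁻¹ (σ.mact (R.ract (R.mp x⁻¹) (R.abv y)⁻¹) ξ) := by
  rw [act, LinearMap.comp_apply, σ.hatM_homog _ (σ.gact_homog (R.gp x) h)]
  have hc := σ.cross (R.ract (R.mp x⁻¹) (R.abv y)⁻¹) (R.gp x) y ξ h
  obtain ⟨_, h2⟩ := (R.gConn_iff y (R.gp x) _).2 rfl
  have e1 : R.ract (R.lInv (R.mp x)) (R.abv ((R.gp x : X)⁻¹ * y * (R.gp x : X)))⁻¹ =
      R.ract (R.ract (R.mp x⁻¹) (R.abv y)⁻¹) (R.lact (R.ang y) (R.gp x)) := by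
    rw [h2, ract_mul, lInv, ract, ract, mp_mp_mul, mp_mp_mul]
    congr 1
    simp only [Subgroup.coe_mul, Subgroup.coe_inv, mp_eq]
    group
  rw [e1, ← hc, ← σ.gact_mul]
  congr 1
  congr 1
  apply Subtype.ext
  rw [ract_mul, inv_mul_cancel, ract_one, Subgroup.coe_mul, coe_lact, coe_tau, dot_lInv]
  have e2 : R.ract (R.mp x⁻¹) (R.gp x) = R.lInv (R.mp x) := by
    rw [lInv, ract, mp_mp_mul]
    congr 1
    rw [mp_eq]; group
  rw [e2, Subgroup.coe_inv, R.gp_eq x⁻¹, R.mp_eq x, coe_e]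
  group

lemma act_coe (v : R.G) : σ.act v = σ.gact v := by
  refine σ.ext_homog fun y ξ h => ?_
  rw [act_homog' _ _ h, ← Subgroup.coe_inv, mp_coeG, gp_coe, inv_inv]
  simp only [ract, coe_e, one_mul, mp_coeG, σ.mact_e]

lemma act_one (ξ : V) : σ.act 1 ξ = ξ := by
  have := σ.act_coe 1
  rw [Subgroup.coe_one] at this
  rw [this, σ.gact_one]

lemma mact_eq_act (t : R.M) {y : X} {ξ : V} (h : σ.pr y ξ = ξ) :
    σ.mact t ξ = σ.act (R.ract t (R.abv y) : X)⁻¹ ξ := by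
  rw [act_homog' _ _ h, inv_inv, mp_coe, ract_mul, mul_inv_cancel, ract_one]
  have : R.gp (R.ract t (R.abv y) : X) = 1 := (R.factor_unique 1 (R.ract t (R.abv y)) _ (by simp)).1
  rw [this, inv_one, σ.gact_one]

lemma act_deg (x : X) {y : X} {ξ : V} (h : σ.pr y ξ = ξ) :
    σ.pr (x⁻¹ * y * x) (σ.act x ξ) = σ.act x ξ := by
  rw [act_homog' _ _ h]
  have := σ.gact_homog (R.gp x⁻¹)⁻¹ (σ.mact_homog (R.ract (R.mp x⁻¹) (R.abv y)⁻¹) h)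
  convert this using 2
  rw [mdeg, ract_mul, inv_mul_cancel, ract_one, Subgroup.coe_inv, gp_eq]
  group

lemma act_mul (x z : X) (ξ : V) : σ.act (x * z) ξ = σ.act z (σ.act x ξ) := by
  suffices σ.act (x * z) = σ.act z ∘ₗ σ.act x from congrArg (fun f => f ξ) this
  refine σ.ext_homog fun y ξ h => ?_
  rw [LinearMap.comp_apply, σ.act_homog' z (σ.act_deg x h), σ.act_homog' x h]
  set m := R.mp x⁻¹ with hm
  set n := R.mp z⁻¹ with hn
  set g := (R.gp x⁻¹)⁻¹ with hg
  set t := R.ract m (R.abv y)⁻¹ with ht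
  have ht' : R.ract t (R.abv y) = m := by simp [ht]
  set y1 := R.mdeg t y with hy1
  have hy1' : y1 = m * y * (m : X)⁻¹ := by rw [hy1, mdeg, ht']
  have hx : x = (m : X)⁻¹ * g := by rw [hg, hm, Subgroup.coe_inv, gp_eq]; group
  have h1 := σ.mact_homog t h
  set n1 := R.ract n g⁻¹ with hn1
  set s1 := R.ract n (g⁻¹ * (R.abv y1)⁻¹) with hs1
  have hs1' : R.ract s1 (R.abv y1) = n1 := by simp [hs1, hn1, mul_assoc]
  obtain ⟨_, h2⟩ := (R.gConn_iff y1 g _).2 rfl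
  have e1 : R.ract n (R.abv (x⁻¹ * y * x))⁻¹ = R.ract s1 (R.lact (R.ang y1) g) := by
    have : x⁻¹ * y * x = (g : X)⁻¹ * y1 * g := by rw [hx, hy1']; group
    rw [this, h2, hs1, ract_mul]
    congr 1
    group
  rw [e1, ← σ.cross s1 g y1 _ h1, hs1']
  have hM := (R.mConn_iff t y _).2 hy1
  rw [σ.mact_mact s1 t y y1 _ ξ h hM rfl, ht']
  set p' := R.ract s1 (R.tau (R.ang y1) m * (R.tau t (R.ang y))⁻¹) with hp'
  have e2 : R.ract p' (R.lact t (R.abv y)) = n1 := by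
    obtain ⟨_, h4⟩ := hM
    rw [ht'] at h4
    rw [hp', ract_mul, mul_assoc, h4, mul_inv_cancel_left, hs1']
  rw [e2, ← σ.gact_mul, ← σ.gact_mul, σ.act_homog' _ h]
  have hf := R.factor_unique ((R.gp z⁻¹) * R.lact n g⁻¹ * R.tau n1 m) (R.dot n1 m) (x * z)⁻¹ (by
    simp only [Subgroup.coe_mul, coe_tau, coe_lact, gp_eq, ← hn, ← hn1]
    rw [hx, Subgroup.coe_inv]
    group)
  rw [hf.1, hf.2]
  have e3 : R.ract (R.dot n1 m) (R.abv y)⁻¹ = R.dot p' t := by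
    have : R.dot n1 m = R.ract (R.dot p' t) (R.abv y) := by
      rw [← e2, dot, ract, ract, dot, mp_mp_mul, mp_mp_mul]
      congr 1
      rw [coe_lact, ht']
      group
    rw [this]; simp
  rw [e3]
  congr 1
  congr 1
  apply Subtype.ext
  simp only [Subgroup.coe_mul, Subgroup.coe_inv, mul_inv_rev, coe_lact, ← hn1]
  have e4 : R.ract n1 g = n := by simp [hn1]
  rw [e4]
  group

end Str

namespace Str

variable {X : Type u} [Group X] [Fintype X] {R : CosetReps X} {k : Type u} [Field k]
  {V W : Type u} [AddCommGroup V] [Module k V] [AddCommGroup W] [Module k W]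

/-- A grading by `X` (encoding the two gradings) and a right `X`-action with
`‖ξ ◁ x‖ = x⁻¹ ‖ξ‖ x` give an object of `𝒟`, with `t ⊳ ξ = ξ ◁ (t ◁ |ξ|)⁻¹`. -/
noncomputable def ofAct (R : CosetReps X) (pr : X → V →ₗ[k] V)
    (pr_self : ∀ y ξ, pr y (pr y ξ) = pr y ξ)
    (pr_ne : ∀ y z ξ, y ≠ z → pr y (pr z ξ) = 0) (sum_pr : ∀ ξ, ∑ y, pr y ξ = ξ)
    (act : X → V →ₗ[k] V) (act_one : ∀ ξ, act 1 ξ = ξ)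
    (act_mul : ∀ x z ξ, act (x * z) ξ = act z (act x ξ))
    (act_deg : ∀ x y ξ, pr y ξ = ξ → pr (x⁻¹ * y * x) (act x ξ) = act x ξ) : Str R k V :=
  have key : ∀ (t : R.M) (y : X) (ξ : V), pr y ξ = ξ →
      (∑ z, act (R.ract t (R.abv z) : X)⁻¹ ∘ₗ pr z) ξ = act (R.ract t (R.abv y) : X)⁻¹ ξ := by
    intro t y ξ h
    classical
    rw [LinearMap.sum_apply, Finset.sum_eq_single y]
    · simp [h]
    · intro z _ hz
      rw [LinearMap.comp_apply, ← h, pr_ne _ _ _ hz, map_zero]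
    · simp
  { pr := pr
    pr_self := pr_self
    pr_ne := pr_ne
    sum_pr := sum_pr
    gact := fun v => act v
    gact_one := fun ξ => act_one ξ
    gact_mul := fun v w ξ => by rw [Subgroup.coe_mul, act_mul]
    mact := fun t => ∑ y, act (R.ract t (R.abv y) : X)⁻¹ ∘ₗ pr y
    mact_e := fun ξ => by
      rw [LinearMap.sum_apply]
      conv_rhs => rw [← sum_pr ξ]
      refine Finset.sum_congr rfl fun y _ => ?_
      have : R.ract R.e (R.abv y) = R.e := by simp [ract]
      rw [this, coe_e, inv_one, LinearMap.comp_apply, act_one]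
    gact_deg := fun v y z ξ h hz => by
      rw [(R.gConn_iff _ _ _).1 hz]; exact act_deg _ _ _ h
    mact_deg := fun s y z ξ h hz => by
      rw [key _ _ _ h, (R.mConn_iff _ _ _).1 hz, mdeg]
      simpa using act_deg (R.ract s (R.abv y) : X)⁻¹ y ξ h
    mact_mact := fun p t y z p' κ h hz hp => by
      have hz' := (R.mConn_iff _ _ _).1 hz
      have hd : pr z (act (R.ract t (R.abv y) : X)⁻¹ κ) = act (R.ract t (R.abv y) : X)⁻¹ κ := by
        have := act_deg (R.ract t (R.abv y) : X)⁻¹ y κ h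
        rwa [inv_inv, ← mdeg, ← hz'] at this
      rw [key t _ _ h, key p _ _ hd, key _ _ _ h, ← act_mul, ← act_mul]
      have e2 : R.ract p' (R.lact t (R.abv y)) = R.ract p (R.abv z) := by
        rw [hp, ract_mul, mul_assoc, hz.2, mul_inv_cancel_left]
      have e3 : R.ract (R.dot p' t) (R.abv y) =
          R.dot (R.ract p' (R.lact t (R.abv y))) (R.ract t (R.abv y)) := by
        rw [dot, ract, ract, dot, mp_mp_mul, mp_mp_mul]
        congr 1
        rw [coe_lact]
        group
      rw [e3, e2]
      congr 1
      congr 1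
      rw [Subgroup.coe_inv, coe_tau]
      group
    cross := fun s v y η h => by
      have hd : pr ((v : X)⁻¹ * y * v) (act v η) = act v η := act_deg v y η h
      obtain ⟨_, h2⟩ := (R.gConn_iff y v _).2 rfl
      rw [key _ _ _ h, key _ _ _ hd, ← act_mul, ← act_mul, h2, ract_mul, mul_assoc,
        mul_inv_cancel_left]
      congr 1
      congr 1
      rw [coe_lact, ract_mul]
      group }

lemma mact_ofAct (pr : X → V →ₗ[k] V) (h1 h2 h3) (act : X → V →ₗ[k] V) (h4 h5 h6) (t : R.M) :
    (ofAct R pr h1 h2 h3 act h4 h5 h6).mact t = ∑ y, act (R.ract t (R.abv y) : X)⁻¹ ∘ₗ pr y := rfl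

lemma act_ofAct (pr : X → V →ₗ[k] V) (h1 h2 h3) (act : X → V →ₗ[k] V) (h4 h5 h6) :
    (ofAct R pr h1 h2 h3 act h4 h5 h6).act = act := by
  set σ := ofAct R pr h1 h2 h3 act h4 h5 h6 with hσ
  funext x
  refine σ.ext_homog fun y ξ h => ?_
  have hg : ∀ v : R.G, σ.gact v = act v := fun v => rfl
  rw [act_homog' _ _ h, hg, hσ, mact_ofAct]
  rw [LinearMap.sum_apply]
  have := σ.sum_homog (fun z => act (R.ract (R.ract (R.mp x⁻¹) (R.abv y)⁻¹) (R.abv z) : X)⁻¹) h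
  erw [this]
  rw [ract_mul, inv_mul_cancel, ract_one, ← h5]
  congr 1
  rw [Subgroup.coe_inv, R.gp_eq]
  group

lemma ext_act {σ τ : Str R k V} (hpr : ∀ y ξ, σ.pr y ξ = τ.pr y ξ)
    (hact : ∀ x ξ, σ.act x ξ = τ.act x ξ) : σ = τ := by
  have h1 : σ.pr = τ.pr := by funext y; ext ξ; exact hpr y ξ
  have h2 : σ.gact = τ.gact := by
    funext v; rw [← σ.act_coe, ← τ.act_coe]; ext ξ; exact hact _ ξ
  have h3 : σ.mact = τ.mact := by
    funext t
    refine σ.ext_homog fun y ξ h => ?_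
    rw [σ.mact_eq_act t h, τ.mact_eq_act t (by rw [← hpr, h]), hact]
  exact Str.ext h1 h2 h3

/-! ### Tensor products -/

variable (σ : Str R k V) (τ : Str R k W)

/-- The grading of `V ⊗ W`: `⟨ξ ⊗ η⟩ = ⟨ξ⟩ · ⟨η⟩` and `|ξ ⊗ η| = τ(⟨ξ⟩,⟨η⟩)⁻¹ |ξ| |η|`. -/
noncomputable def tensorPr (z : X) : V ⊗[k] W →ₗ[k] V ⊗[k] W :=
  open scoped Classical in
  ∑ a, ∑ b, if R.tdeg a b = z then TensorProduct.map (σ.pr a) (τ.pr b) else 0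

/-- The `G`-action on `V ⊗ W`: `(ξ ⊗ η) ◁ v = ξ ◁ (⟨η⟩ ▷ v) ⊗ η ◁ v`. -/
noncomputable def tensorGact (v : R.G) : V ⊗[k] W →ₗ[k] V ⊗[k] W :=
  ∑ b, TensorProduct.map (σ.gact (R.lact (R.ang b) v)) (τ.gact v ∘ₗ τ.pr b)

/-- The `M`-action on `V ⊗ W`:
`(s ◁ τ(⟨η⟩,⟨κ⟩)) ⊳ (η ⊗ κ)`
`= (s ⊳ η) ◁ τ(s ◁ |η|, ⟨κ⟩) τ(⟨(s ◁ |η|) ⊳ κ⟩, s ◁ |η| |κ|)⁻¹ ⊗ (s ◁ |η|) ⊳ κ`. -/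
noncomputable def tensorMact (t : R.M) : V ⊗[k] W →ₗ[k] V ⊗[k] W :=
  ∑ a, ∑ b,
    let s := R.ract t (R.tau (R.ang a) (R.ang b))⁻¹
    TensorProduct.map
      (σ.gact (R.tau (R.ract s (R.abv a)) (R.ang b) *
        (R.tau (R.ang (R.mdeg (R.ract s (R.abv a)) b)) (R.ract s (R.abv a * R.abv b)))⁻¹) ∘ₗ
          σ.mact s ∘ₗ σ.pr a)
      (τ.mact (R.ract s (R.abv a)) ∘ₗ τ.pr b)

/-- The `X`-action on `V ⊗ W`: `(ξ ⊗ η) ◁ x = ξ ◁ (‖η‖ ▷ x) ⊗ η ◁ x`. -/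
noncomputable def tensorAct (x : X) : V ⊗[k] W →ₗ[k] V ⊗[k] W :=
  ∑ b, TensorProduct.map (σ.act (R.tri b x)) (τ.act x ∘ₗ τ.pr b)

variable {σ τ}

lemma sum_tmul {U : Type u} [AddCommGroup U] [Module k U]
    (F : X → V ⊗[k] W →ₗ[k] U) (ξ : V) {b : X} {η : W} (hb : τ.pr b η = η) :
    ∑ z, F z (ξ ⊗ₜ τ.pr z η) = F b (ξ ⊗ₜ η) := by
  classical
  rw [Finset.sum_eq_single b]
  · rw [hb]
  · intro z _ hz
    rw [τ.pr_of_ne hb hz, tmul_zero, map_zero]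
  · simp

lemma sum_tmul₂ {U : Type u} [AddCommGroup U] [Module k U]
    (F : X → X → V ⊗[k] W →ₗ[k] U) {a b : X} {ξ : V} {η : W}
    (ha : σ.pr a ξ = ξ) (hb : τ.pr b η = η) :
    ∑ c, ∑ d, F c d (σ.pr c ξ ⊗ₜ τ.pr d η) = F a b (ξ ⊗ₜ η) := by
  classical
  rw [Finset.sum_eq_single a]
  · rw [ha]; exact sum_tmul (F a) ξ hb
  · intro z _ hz
    simp [σ.pr_of_ne ha hz]
  · simp

open scoped Classical in
lemma tensorPr_tmul {a b : X} {ξ : V} {η : W} (ha : σ.pr a ξ = ξ) (hb : τ.pr b η = η) (z : X) :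
    tensorPr σ τ z (ξ ⊗ₜ η) = if R.tdeg a b = z then ξ ⊗ₜ η else 0 := by
  have := sum_tmul₂ (U := V ⊗[k] W) (fun c d => if R.tdeg c d = z then LinearMap.id else 0) ha hb
  simp only [tensorPr, LinearMap.sum_apply]
  rw [show (if R.tdeg a b = z then ξ ⊗ₜ η else 0 : V ⊗[k] W) =
    (if R.tdeg a b = z then LinearMap.id else 0 : V ⊗[k] W →ₗ[k] V ⊗[k] W) (ξ ⊗ₜ η) by
      split_ifs <;> rfl, ← this]
  refine Finset.sum_congr rfl fun c _ => Finset.sum_congr rfl fun d _ => ?_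
  split_ifs <;> simp

lemma tensorPr_homog {a b : X} {ξ : V} {η : W} (ha : σ.pr a ξ = ξ) (hb : τ.pr b η = η) :
    tensorPr σ τ (R.tdeg a b) (ξ ⊗ₜ η) = ξ ⊗ₜ η := by
  classical
  rw [tensorPr_tmul ha hb, if_pos rfl]

lemma tensorAct_tmul (x : X) {b : X} (ξ : V) {η : W} (hb : τ.pr b η = η) :
    tensorAct σ τ x (ξ ⊗ₜ η) = σ.act (R.tri b x) ξ ⊗ₜ τ.act x η := by
  have := sum_tmul (fun c => TensorProduct.map (σ.act (R.tri c x)) (τ.act x)) ξ hb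
  rw [TensorProduct.map_tmul] at this
  simp only [tensorAct, LinearMap.sum_apply]
  rw [← this]
  rfl

lemma tensorGact_tmul (v : R.G) {b : X} (ξ : V) {η : W} (hb : τ.pr b η = η) :
    tensorGact σ τ v (ξ ⊗ₜ η) = σ.gact (R.lact (R.ang b) v) ξ ⊗ₜ τ.gact v η := by
  have := sum_tmul (fun c => TensorProduct.map (σ.gact (R.lact (R.ang c) v)) (τ.gact v)) ξ hb
  rw [TensorProduct.map_tmul] at this
  simp only [tensorGact, LinearMap.sum_apply]
  rw [← this]
  rfl

lemma tensorMact_tmul (t : R.M) {a b : X} {ξ : V} {η : W} (ha : σ.pr a ξ = ξ)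
    (hb : τ.pr b η = η) (s : R.M) (hs : s = R.ract t (R.tau (R.ang a) (R.ang b))⁻¹) :
    tensorMact σ τ t (ξ ⊗ₜ η) =
      σ.gact (R.tau (R.ract s (R.abv a)) (R.ang b) *
        (R.tau (R.ang (R.mdeg (R.ract s (R.abv a)) b)) (R.ract s (R.abv a * R.abv b)))⁻¹)
          (σ.mact s ξ) ⊗ₜ τ.mact (R.ract s (R.abv a)) η := by
  subst hs
  have := sum_tmul₂ (σ := σ) (τ := τ) (fun a b =>
    let s := R.ract t (R.tau (R.ang a) (R.ang b))⁻¹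
    TensorProduct.map
      (σ.gact (R.tau (R.ract s (R.abv a)) (R.ang b) *
        (R.tau (R.ang (R.mdeg (R.ract s (R.abv a)) b)) (R.ract s (R.abv a * R.abv b)))⁻¹) ∘ₗ
          σ.mact s)
      (τ.mact (R.ract s (R.abv a)))) ha hb
  simp only [TensorProduct.map_tmul] at this
  simp only [tensorMact, LinearMap.sum_apply]
  exact this

lemma ext_tmul {U : Type u} [AddCommGroup U] [Module k U] (σ : Str R k V) (τ : Str R k W)
    {f g : V ⊗[k] W →ₗ[k] U}
    (h : ∀ a b ξ η, σ.pr a ξ = ξ → τ.pr b η = η → f (ξ ⊗ₜ η) = g (ξ ⊗ₜ η)) : f = g := by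
  refine TensorProduct.ext ?_
  refine σ.ext_homog fun a ξ ha => ?_
  refine τ.ext_homog fun b η hb => ?_
  exact h a b ξ η ha hb

lemma pr_ne_of_homog {y z : X} {ξ : V} (h : σ.pr y ξ = ξ) (hz : σ.pr z ξ = ξ) (hne : y ≠ z) :
    ξ = 0 := by
  rw [← hz, σ.pr_of_ne h hne.symm]

/-- The tensor product of two objects, with its `X`-action. -/
noncomputable def tensor₀ (σ : Str R k V) (τ : Str R k W) : Str R k (V ⊗[k] W) :=
  ofAct R (tensorPr σ τ)
    (fun y t => by
      suffices tensorPr σ τ y ∘ₗ tensorPr σ τ y = tensorPr σ τ y from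
        congrArg (fun f => f t) this
      refine ext_tmul σ τ fun a b ξ η ha hb => ?_
      classical
      rw [LinearMap.comp_apply, tensorPr_tmul ha hb]
      split_ifs with h
      · rw [tensorPr_tmul ha hb, if_pos h]
      · simp)
    (fun y z t hyz => by
      suffices tensorPr σ τ y ∘ₗ tensorPr σ τ z = 0 from congrArg (fun f => f t) this
      refine ext_tmul σ τ fun a b ξ η ha hb => ?_
      classical
      rw [LinearMap.comp_apply, tensorPr_tmul ha hb]
      split_ifs with h
      · rw [tensorPr_tmul ha hb, if_neg (by rw [h]; exact hyz.symm)]; rfl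
      · simp)
    (fun t => by
      suffices ∑ y, tensorPr σ τ y = LinearMap.id by
        simpa using congrArg (fun f => f t) this
      refine ext_tmul σ τ fun a b ξ η ha hb => ?_
      classical
      rw [LinearMap.sum_apply]
      simp_rw [tensorPr_tmul ha hb]
      simp)
    (tensorAct σ τ)
    (fun t => by
      suffices tensorAct σ τ 1 = LinearMap.id from congrArg (fun f => f t) this
      refine ext_tmul σ τ fun a b ξ η ha hb => ?_
      rw [tensorAct_tmul _ _ hb, tri_one, act_one, act_one]; rfl)
    (fun x z t => by
      suffices tensorAct σ τ (x * z) = tensorAct σ τ z ∘ₗ tensorAct σ τ x from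
        congrArg (fun f => f t) this
      refine ext_tmul σ τ fun a b ξ η ha hb => ?_
      rw [LinearMap.comp_apply, tensorAct_tmul _ _ hb, tensorAct_tmul _ _ hb,
        tensorAct_tmul _ _ (τ.act_deg x hb), tri_mul, act_mul, act_mul])
    (fun x y t ht => by
      suffices tensorPr σ τ (x⁻¹ * y * x) ∘ₗ tensorAct σ τ x ∘ₗ tensorPr σ τ y =
          tensorAct σ τ x ∘ₗ tensorPr σ τ y by
        have := congrArg (fun f => f t) this
        simpa [ht] using this
      refine ext_tmul σ τ fun a b ξ η ha hb => ?_
      classical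
      rw [LinearMap.comp_apply, LinearMap.comp_apply, tensorPr_tmul ha hb]
      split_ifs with h
      · rw [tensorAct_tmul _ _ hb, ← h, tdeg_eq_circ, circ_conj, ← tdeg_eq_circ,
          tensorPr_homog (σ.act_deg _ ha) (τ.act_deg _ hb)]
      · simp)

lemma tensor₀_mact (t : R.M) : (tensor₀ σ τ).mact t = tensorMact σ τ t := by
  refine ext_tmul σ τ fun a b ξ η ha hb => ?_
  have h0 : (tensor₀ σ τ).pr (R.tdeg a b) (ξ ⊗ₜ η) = ξ ⊗ₜ η := tensorPr_homog ha hb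
  have h1 : (tensor₀ σ τ).act = tensorAct σ τ := act_ofAct _ _ _ _ _ _ _ _
  obtain ⟨s, hs⟩ : ∃ s, s = R.ract t (R.tau (R.ang a) (R.ang b))⁻¹ := ⟨_, rfl⟩
  rw [mact_eq_act _ _ h0, h1, tensorAct_tmul _ _ hb, tensorMact_tmul t ha hb s hs]
  have ht : t = R.ract s (R.tau (R.ang a) (R.ang b)) := by simp [hs]
  obtain ⟨hM1, hM2⟩ := (R.mConn_iff (R.ract s (R.abv a)) b _).2 rfl
  set c := R.ang (R.mdeg (R.ract s (R.abv a)) b) with hc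
  set r := R.ract s (R.abv a * R.abv b) with hr
  have habv : R.abv (R.tdeg a b) = (R.tau (R.ang a) (R.ang b))⁻¹ * R.abv a * R.abv b := by
    have := R.factor_unique ((R.tau (R.ang a) (R.ang b))⁻¹ * R.abv a * R.abv b)⁻¹
      (R.dot (R.ang a) (R.ang b)) (R.tdeg a b) (by rw [tdeg, Subgroup.coe_inv])
    rw [abv, this.1, inv_inv]
  have e1 : R.ract t (R.abv (R.tdeg a b)) = r := by
    rw [habv, hr, hs, ract_mul]; congr 1; group
  rw [e1, ← act_coe, mact_eq_act _ _ ha, mact_eq_act _ _ hb, ract_mul, ← hr, ← act_mul]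
  congr 2
  rw [Subgroup.coe_mul, Subgroup.coe_inv, coe_tau, coe_tau]
  have e2 : R.ract (R.ract s (R.abv a)) (R.abv b) = r := by simp [hr]
  rw [e2] at hM1
  rw [hM1, tri]
  have e3 : R.mp ((r : X)⁻¹⁻¹ * b * (r : X)⁻¹) = c := by
    rw [hc, ang, mdeg, e2, inv_inv]
  rw [e3]
  simp only [ang]
  group

lemma tensor₀_gact (v : R.G) : (tensor₀ σ τ).gact v = tensorGact σ τ v := by
  refine ext_tmul σ τ fun a b ξ η ha hb => ?_
  have h1 : (tensor₀ σ τ).gact v = tensorAct σ τ v := rfl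
  rw [h1, tensorAct_tmul _ _ hb, tensorGact_tmul _ _ hb, ← act_coe, ← act_coe]
  congr 2
  rw [coe_lact, tri]
  congr 3
  rw [ract, ang, mp_mp_mul, mul_assoc, ← Subgroup.coe_inv, mp_mul]

/-- The tensor product of two objects of `𝒟`. -/
noncomputable def tensor (σ : Str R k V) (τ : Str R k W) : Str R k (V ⊗[k] W) where
  pr := tensorPr σ τ
  gact := tensorGact σ τ
  mact := tensorMact σ τ
  pr_self := (tensor₀ σ τ).pr_self
  pr_ne := (tensor₀ σ τ).pr_ne
  sum_pr := (tensor₀ σ τ).sum_pr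
  gact_one := by simpa only [tensor₀_gact] using (tensor₀ σ τ).gact_one
  gact_mul := by simpa only [tensor₀_gact] using (tensor₀ σ τ).gact_mul
  mact_e := by simpa only [tensor₀_mact] using (tensor₀ σ τ).mact_e
  gact_deg := by
    intro v y z ξ; rw [← tensor₀_gact]; exact (tensor₀ σ τ).gact_deg v y z ξ
  mact_deg := by
    intro v y z ξ; rw [← tensor₀_mact]; exact (tensor₀ σ τ).mact_deg v y z ξ
  mact_mact := by
    intro p t y z p' ξ; simp only [← tensor₀_mact, ← tensor₀_gact]
    exact (tensor₀ σ τ).mact_mact p t y z p' ξ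
  cross := by
    intro s v y η; simp only [← tensor₀_mact, ← tensor₀_gact]
    exact (tensor₀ σ τ).cross s v y η

lemma tensor_eq : tensor σ τ = tensor₀ σ τ := by
  refine Str.ext rfl ?_ ?_
  · funext v; exact (tensor₀_gact v).symm
  · funext v; exact (tensor₀_mact v).symm

lemma act_tensor_tmul (x : X) {b : X} (ξ : V) {η : W} (hb : τ.pr b η = η) :
    (tensor σ τ).act x (ξ ⊗ₜ η) = σ.act (R.tri b x) ξ ⊗ₜ τ.act x η := by
  rw [tensor_eq, tensor₀, act_ofAct, tensorAct_tmul _ _ hb]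

lemma pr_tensor_tmul {a b : X} {ξ : V} {η : W} (ha : σ.pr a ξ = ξ) (hb : τ.pr b η = η) :
    (tensor σ τ).pr (R.circ a b) (ξ ⊗ₜ η) = ξ ⊗ₜ η := by
  rw [← tdeg_eq_circ]; exact tensorPr_homog ha hb

/-- The unit object `k`, with trivial gradings and actions. -/
noncomputable def unit (R : CosetReps X) (k : Type u) [Field k] : Str R k k :=
  open scoped Classical in
  { pr := fun y => if y = 1 then LinearMap.id else 0
    pr_self := fun y ξ => by split_ifs <;> rfl
    pr_ne := fun y z ξ h => by
      split_ifs with h1 h2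
      · exact absurd (h1.trans h2.symm) h
      all_goals rfl
    sum_pr := fun ξ => by
      rw [Finset.sum_eq_single 1]
      · simp
      · intro b _ hb; simp [hb]
      · simp
    gact := fun _ => LinearMap.id
    gact_one := fun _ => rfl
    gact_mul := fun _ _ _ => rfl
    mact := fun _ => LinearMap.id
    mact_e := fun _ => rfl
    gact_deg := fun v y z ξ h hz => by
      rw [(R.gConn_iff _ _ _).1 hz]
      by_cases hy : y = 1
      · subst hy; simp
      · simp only [hy, if_false, LinearMap.zero_apply] at h; simp [← h]
    mact_deg := fun v y z ξ h hz => by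
      rw [(R.mConn_iff _ _ _).1 hz]
      by_cases hy : y = 1
      · subst hy; simp [mdeg]
      · simp only [hy, if_false, LinearMap.zero_apply] at h; simp [← h]
    mact_mact := fun _ _ _ _ _ _ _ _ _ => rfl
    cross := fun _ _ _ _ _ => rfl }

lemma unit_act (x : X) : (unit R k).act x = LinearMap.id := by
  refine (unit R k).ext_homog fun y ξ h => ?_
  rw [act_homog' _ _ h]; rfl

lemma unit_pr_one (r : k) : (unit R k).pr 1 r = r := by simp [unit]

end Str

/-- The category `𝒟`: finite-dimensional `k`-vector spaces with the structure `Str`. -/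
structure DCat {X : Type u} [Group X] [Fintype X] (R : CosetReps X) (k : Type u) [Field k] where
  carrier : Type u
  [addCommGroup : AddCommGroup carrier]
  [module : Module k carrier]
  [finite : Module.Finite k carrier]
  str : Str R k carrier

namespace DCat

variable {X : Type u} [Group X] [Fintype X] {R : CosetReps X} {k : Type u} [Field k]

attribute [instance] DCat.addCommGroup DCat.module DCat.finite

/-- The morphisms of `𝒟`: linear maps preserving both gradings and both actions. -/
@[ext]
structure Hom (V W : DCat R k) where
  toLin : V.carrier →ₗ[k] W.carrier
  pr_comm : ∀ y, W.str.pr y ∘ₗ toLin = toLin ∘ₗ V.str.pr y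
  gact_comm : ∀ v, W.str.gact v ∘ₗ toLin = toLin ∘ₗ V.str.gact v
  mact_comm : ∀ t, W.str.mact t ∘ₗ toLin = toLin ∘ₗ V.str.mact t

noncomputable instance : Category (DCat R k) where
  Hom := Hom
  id V := ⟨LinearMap.id, fun _ => rfl, fun _ => rfl, fun _ => rfl⟩
  comp f g := ⟨g.toLin ∘ₗ f.toLin,
    fun y => by rw [← LinearMap.comp_assoc, g.pr_comm, LinearMap.comp_assoc, f.pr_comm]; rfl,
    fun y => by rw [← LinearMap.comp_assoc, g.gact_comm, LinearMap.comp_assoc, f.gact_comm]; rfl,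
    fun y => by rw [← LinearMap.comp_assoc, g.mact_comm, LinearMap.comp_assoc, f.mact_comm]; rfl⟩

/-- The underlying linear map of a morphism of `𝒟`. -/
def lin {V W : DCat R k} (f : V ⟶ W) : V.carrier →ₗ[k] W.carrier := Hom.toLin f

@[simp] lemma lin_id (V : DCat R k) : lin (𝟙 V) = LinearMap.id := rfl

@[simp] lemma lin_comp {U V W : DCat R k} (f : U ⟶ V) (g : V ⟶ W) :
    lin (f ≫ g) = lin g ∘ₗ lin f := rfl

lemma lin_injective {V W : DCat R k} {f g : V ⟶ W} (h : lin f = lin g) : f = g := Hom.ext h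

lemma lin_pr {V W : DCat R k} (f : V ⟶ W) (y : X) (ξ : V.carrier) :
    W.str.pr y (lin f ξ) = lin f (V.str.pr y ξ) := congrArg (fun g => g ξ) (f.pr_comm y)

lemma lin_homog {V W : DCat R k} (f : V ⟶ W) {y : X} {ξ : V.carrier} (h : V.str.pr y ξ = ξ) :
    W.str.pr y (lin f ξ) = lin f ξ := by rw [lin_pr, h]

lemma lin_act {V W : DCat R k} (f : V ⟶ W) (x : X) (ξ : V.carrier) :
    lin f (V.str.act x ξ) = W.str.act x (lin f ξ) := by
  suffices lin f ∘ₗ V.str.act x = W.str.act x ∘ₗ lin f from congrArg (fun g => g ξ) this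
  refine V.str.ext_homog fun y ξ h => ?_
  rw [LinearMap.comp_apply, LinearMap.comp_apply, Str.act_homog' _ _ h,
    Str.act_homog' _ _ (lin_homog f h)]
  have h1 := fun v ζ => LinearMap.congr_fun (f.gact_comm v) ζ
  have h2 := fun t ζ => LinearMap.congr_fun (f.mact_comm t) ζ
  exact (h1 _ _).symm.trans (congrArg _ (h2 _ _).symm)

/-- A linear map preserving the gradings and the `X`-actions is a morphism of `𝒟`. -/
def homOfAct {V W : DCat R k} (f : V.carrier →ₗ[k] W.carrier)
    (hpr : ∀ y, W.str.pr y ∘ₗ f = f ∘ₗ V.str.pr y)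
    (hact : ∀ x, W.str.act x ∘ₗ f = f ∘ₗ V.str.act x) : V ⟶ W where
  toLin := f
  pr_comm := hpr
  gact_comm v := by rw [← Str.act_coe, ← Str.act_coe, hact]
  mact_comm t := by
    refine V.str.ext_homog fun y ξ h => ?_
    have h' : W.str.pr y (f ξ) = f ξ := by
      have := congrArg (fun g => g ξ) (hpr y)
      simpa [h] using this
    rw [LinearMap.comp_apply, LinearMap.comp_apply, V.str.mact_eq_act t h,
      W.str.mact_eq_act t h']
    exact congrArg (fun g => g ξ) (hact _)

@[simp] lemma lin_homOfAct {V W : DCat R k} (f : V.carrier →ₗ[k] W.carrier) (hpr hact) :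
    lin (homOfAct f hpr hact : V ⟶ W) = f := rfl

lemma pr_eq_of_homog {V W : DCat R k} (f : V.carrier →ₗ[k] W.carrier) {d : X} {ξ : V.carrier}
    (h : V.str.pr d ξ = ξ) (h' : W.str.pr d (f ξ) = f ξ) (y : X) :
    W.str.pr y (f ξ) = f (V.str.pr y ξ) := by
  by_cases hy : y = d
  · rw [hy, h, h']
  · rw [V.str.pr_of_ne h hy, W.str.pr_of_ne h' hy, map_zero]

/-- An isomorphism of `𝒟` from a morphism with a linear inverse. -/
def isoOfLin {V W : DCat R k} (f : V ⟶ W) (g : W.carrier →ₗ[k] V.carrier)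
    (h1 : g ∘ₗ lin f = LinearMap.id) (h2 : lin f ∘ₗ g = LinearMap.id) : V ≅ W where
  hom := f
  inv := homOfAct g
    (fun y => by
      ext ξ
      have := lin_pr f y (g ξ)
      rw [show lin f (g ξ) = ξ from LinearMap.congr_fun h2 ξ] at this
      rw [LinearMap.comp_apply, LinearMap.comp_apply, this]
      exact (LinearMap.congr_fun h1 _).symm)
    (fun x => by
      ext ξ
      have := lin_act f x (g ξ)
      rw [show lin f (g ξ) = ξ from LinearMap.congr_fun h2 ξ] at this
      rw [LinearMap.comp_apply, LinearMap.comp_apply, ← this]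
      exact (LinearMap.congr_fun h1 _).symm)
  hom_inv_id := lin_injective h1
  inv_hom_id := lin_injective h2

end DCat

namespace Str

variable {X : Type u} [Group X] [Fintype X] {R : CosetReps X} {k : Type u} [Field k]
  {V W Z U T : Type u} [AddCommGroup V] [Module k V] [AddCommGroup W] [Module k W]
  [AddCommGroup Z] [Module k Z] [AddCommGroup U] [Module k U] [AddCommGroup T] [Module k T]

lemma ext_tmul3 (σ : Str R k V) (τ : Str R k W) (ρ : Str R k Z)
    {f g : (V ⊗[k] W) ⊗[k] Z →ₗ[k] U}
    (h : ∀ a b c ξ η ζ, σ.pr a ξ = ξ → τ.pr b η = η → ρ.pr c ζ = ζ →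
      f ((ξ ⊗ₜ η) ⊗ₜ ζ) = g ((ξ ⊗ₜ η) ⊗ₜ ζ)) : f = g := by
  refine TensorProduct.ext (ext_tmul σ τ fun a b ξ η ha hb => ?_)
  exact ρ.ext_homog fun c ζ hc => h a b c ξ η ζ ha hb hc

lemma ext_tmul3' (σ : Str R k V) (τ : Str R k W) (ρ : Str R k Z)
    {f g : V ⊗[k] (W ⊗[k] Z) →ₗ[k] U}
    (h : ∀ a b c ξ η ζ, σ.pr a ξ = ξ → τ.pr b η = η → ρ.pr c ζ = ζ →
      f (ξ ⊗ₜ (η ⊗ₜ ζ)) = g (ξ ⊗ₜ (η ⊗ₜ ζ))) : f = g := by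
  refine TensorProduct.ext (σ.ext_homog fun a ξ ha => ?_)
  exact ext_tmul τ ρ fun b c η ζ hb hc => h a b c ξ η ζ ha hb hc

lemma ext_tmul4 (σ : Str R k V) (τ : Str R k W) (ρ : Str R k Z) (ω : Str R k T)
    {f g : ((V ⊗[k] W) ⊗[k] Z) ⊗[k] T →ₗ[k] U}
    (h : ∀ a b c d ξ η ζ θ, σ.pr a ξ = ξ → τ.pr b η = η → ρ.pr c ζ = ζ → ω.pr d θ = θ →
      f (((ξ ⊗ₜ η) ⊗ₜ ζ) ⊗ₜ θ) = g (((ξ ⊗ₜ η) ⊗ₜ ζ) ⊗ₜ θ)) : f = g := by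
  refine TensorProduct.ext (ext_tmul3 σ τ ρ fun a b c ξ η ζ ha hb hc => ?_)
  exact ω.ext_homog fun d θ hd => h a b c d ξ η ζ θ ha hb hc hd

variable (σ : Str R k V) (τ : Str R k W) (ρ : Str R k Z)

/-- The associator `(ξ ⊗ η) ⊗ ζ ↦ ξ ◁ τ(⟨η⟩,⟨ζ⟩) ⊗ (η ⊗ ζ)`. -/
noncomputable def assocLin : (V ⊗[k] W) ⊗[k] Z →ₗ[k] V ⊗[k] (W ⊗[k] Z) :=
  (∑ b, ∑ c, TensorProduct.map (σ.gact (R.tau (R.ang b) (R.ang c)))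
    (TensorProduct.map (τ.pr b) (ρ.pr c))) ∘ₗ (TensorProduct.assoc k V W Z).toLinearMap

/-- The inverse of the associator. -/
noncomputable def assocInvLin : V ⊗[k] (W ⊗[k] Z) →ₗ[k] (V ⊗[k] W) ⊗[k] Z :=
  (TensorProduct.assoc k V W Z).symm.toLinearMap ∘ₗ
    ∑ b, ∑ c, TensorProduct.map (σ.gact (R.tau (R.ang b) (R.ang c))⁻¹)
      (TensorProduct.map (τ.pr b) (ρ.pr c))

variable {σ τ ρ}

lemma sum_homog₂ (F : X → X → (V →ₗ[k] V)) (ξ : V) {b c : X} {η : W} {ζ : Z}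
    (hb : τ.pr b η = η) (hc : ρ.pr c ζ = ζ) :
    (∑ b, ∑ c, TensorProduct.map (F b c) (TensorProduct.map (τ.pr b) (ρ.pr c)))
      (ξ ⊗ₜ (η ⊗ₜ ζ)) = F b c ξ ⊗ₜ (η ⊗ₜ ζ) := by
  classical
  simp only [LinearMap.sum_apply, TensorProduct.map_tmul]
  rw [Finset.sum_eq_single b, Finset.sum_eq_single c, hb, hc]
  · intro z _ hz; rw [ρ.pr_of_ne hc hz, tmul_zero, tmul_zero]
  · simp
  · intro z _ hz; simp [τ.pr_of_ne hb hz]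
  · simp

lemma assocLin_tmul {b c : X} (ξ : V) {η : W} {ζ : Z} (hb : τ.pr b η = η) (hc : ρ.pr c ζ = ζ) :
    assocLin σ τ ρ ((ξ ⊗ₜ η) ⊗ₜ ζ) = σ.act (R.ttau b c) ξ ⊗ₜ (η ⊗ₜ ζ) := by
  rw [assocLin, LinearMap.comp_apply, LinearEquiv.coe_coe, TensorProduct.assoc_tmul,
    sum_homog₂ (fun b c => σ.gact (R.tau (R.ang b) (R.ang c))) ξ hb hc, act_coe]
  rfl

lemma assocInvLin_tmul {b c : X} (ξ : V) {η : W} {ζ : Z} (hb : τ.pr b η = η)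
    (hc : ρ.pr c ζ = ζ) :
    assocInvLin σ τ ρ (ξ ⊗ₜ (η ⊗ₜ ζ)) = (σ.act (R.ttau b c : X)⁻¹ ξ ⊗ₜ η) ⊗ₜ ζ := by
  rw [assocInvLin, LinearMap.comp_apply,
    sum_homog₂ (fun b c => σ.gact (R.tau (R.ang b) (R.ang c))⁻¹) ξ hb hc, ← Subgroup.coe_inv,
    act_coe]
  rfl

end Str

section Identities

variable {X : Type u} [Group X] (R : CosetReps X)

lemma mp_circ (a b : X) : R.mp (R.circ a b) = R.dot (R.mp a) (R.mp b) := by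
  rw [circ, dot, mul_assoc, mp_mul, mp_mp_mul]

lemma gp_circ (a b : X) :
    (R.gp (R.circ a b) : X) = R.gp b * R.gp a * R.ttau a b := by
  rw [gp_eq, mp_circ, circ, ttau, coe_tau, R.gp_eq a]
  group

lemma ttau_conj_coe (a : X) (v : R.G) (x : X) (h : x = v) :
    R.mp (x⁻¹ * a * x) = R.ract (R.mp a) v := by
  rw [h, ract, mp_mp_mul, mul_assoc, ← Subgroup.coe_inv, mp_mul]

lemma tri_coe (b : X) (v : R.G) : R.tri b v = R.lact (R.mp b) v := by
  rw [tri, R.ttau_conj_coe b v _ rfl, coe_lact]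

/-- `(a ∘ b) ∘ c = (a ◁ τ(b,c)) ∘ (b ∘ c)`. -/
lemma circ_assoc (a b c : X) :
    R.circ (R.circ a b) c = R.circ ((R.ttau b c : X)⁻¹ * a * R.ttau b c) (R.circ b c) := by
  conv_rhs => rw [circ, gp_circ, mp_circ]
  rw [circ, circ, ttau, coe_tau]
  group

lemma tri_circ (a b x : X) : R.tri (R.circ a b) x =
    (R.ttau a b : X)⁻¹ * R.tri a (R.tri b x) *
      R.ttau ((R.tri b x)⁻¹ * a * R.tri b x) (x⁻¹ * b * x) := by
  rw [tri, circ_conj, mp_circ, mp_circ, ttau, ttau, coe_tau, coe_tau]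
  simp only [tri]
  group

lemma ttau_cocycle (a b c : X) : (R.ttau a b : X) * R.ttau (R.circ a b) c =
    R.tri a (R.ttau b c) * R.ttau ((R.ttau b c : X)⁻¹ * a * R.ttau b c) (R.circ b c) := by
  have h := congrArg (fun t => (R.mp t : X)) (R.circ_assoc a b c)
  simp only [mp_circ] at h
  simp only [ttau, coe_tau, mp_circ, tri] at *
  rw [h]
  group

lemma circ_one_left (a : X) : R.circ 1 a = a := by simp [circ, gp_mul_mp]

lemma circ_one_right (a : X) : R.circ a 1 = a := by simp [circ]

lemma ttau_one_left (a : X) : R.ttau 1 a = 1 := by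
  apply Subtype.ext; simp [ttau, coe_tau, dot]

lemma ttau_one_right (a : X) : R.ttau a 1 = 1 := by
  apply Subtype.ext; simp [ttau, coe_tau, dot]

lemma tri_one_left (x : X) : R.tri 1 x = x := by simp [tri]

end Identities

namespace DCat

variable {X : Type u} [Group X] [Fintype X] {R : CosetReps X} {k : Type u} [Field k]

/-- The tensor product of morphisms. -/
noncomputable def tensorHom' {V V' W W' : DCat R k} (f : V ⟶ V') (g : W ⟶ W') :
    (⟨V.carrier ⊗[k] W.carrier, Str.tensor V.str W.str⟩ : DCat R k) ⟶
      ⟨V'.carrier ⊗[k] W'.carrier, Str.tensor V'.str W'.str⟩ :=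
  homOfAct (TensorProduct.map (lin f) (lin g))
    (fun y => by
      refine Str.ext_tmul V.str W.str fun a b ξ η ha hb => ?_
      exact pr_eq_of_homog (V := ⟨_, Str.tensor V.str W.str⟩)
        (W := ⟨_, Str.tensor V'.str W'.str⟩) _ (Str.pr_tensor_tmul ha hb)
        (Str.pr_tensor_tmul (lin_homog f ha) (lin_homog g hb)) y)
    (fun x => by
      refine Str.ext_tmul V.str W.str fun a b ξ η ha hb => ?_
      simp only [LinearMap.comp_apply, TensorProduct.map_tmul]
      rw [Str.act_tensor_tmul _ _ hb, Str.act_tensor_tmul _ _ (lin_homog g hb),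
        TensorProduct.map_tmul, lin_act, lin_act])

/-- The associator of `𝒟`. -/
noncomputable def associator' (V W Z : DCat R k) :
    (⟨(V.carrier ⊗[k] W.carrier) ⊗[k] Z.carrier,
        Str.tensor (Str.tensor V.str W.str) Z.str⟩ : DCat R k) ≅
      ⟨V.carrier ⊗[k] (W.carrier ⊗[k] Z.carrier),
        Str.tensor V.str (Str.tensor W.str Z.str)⟩ :=
  isoOfLin
    (homOfAct (Str.assocLin V.str W.str Z.str)
      (fun y => by
        refine Str.ext_tmul3 V.str W.str Z.str fun a b c ξ η ζ ha hb hc => ?_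
        refine pr_eq_of_homog (V := ⟨_, Str.tensor (Str.tensor V.str W.str) Z.str⟩)
          (W := ⟨_, Str.tensor V.str (Str.tensor W.str Z.str)⟩) _
          (Str.pr_tensor_tmul (Str.pr_tensor_tmul ha hb) hc) ?_ y
        rw [Str.assocLin_tmul ξ hb hc, circ_assoc]
        exact Str.pr_tensor_tmul (V.str.act_deg _ ha) (Str.pr_tensor_tmul hb hc))
      (fun x => by
        refine Str.ext_tmul3 V.str W.str Z.str fun a b c ξ η ζ ha hb hc => ?_
        simp only [LinearMap.comp_apply]
        rw [Str.assocLin_tmul ξ hb hc, Str.act_tensor_tmul _ _ (Str.pr_tensor_tmul hb hc),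
          Str.act_tensor_tmul _ _ hc, Str.act_tensor_tmul _ _ hc, Str.act_tensor_tmul _ _ hb,
          Str.assocLin_tmul _ (W.str.act_deg _ hb) (Z.str.act_deg _ hc), ← Str.act_mul,
          ← Str.act_mul, tri_circ]
        congr 3
        group))
    (Str.assocInvLin V.str W.str Z.str)
    (by
      refine Str.ext_tmul3 V.str W.str Z.str fun a b c ξ η ζ ha hb hc => ?_
      rw [LinearMap.comp_apply, lin_homOfAct, Str.assocLin_tmul ξ hb hc,
        Str.assocInvLin_tmul _ hb hc, ← Str.act_mul, mul_inv_cancel, Str.act_one]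
      rfl)
    (by
      refine Str.ext_tmul3' V.str W.str Z.str fun a b c ξ η ζ ha hb hc => ?_
      rw [LinearMap.comp_apply, lin_homOfAct, Str.assocInvLin_tmul _ hb hc,
        Str.assocLin_tmul _ hb hc, ← Str.act_mul, inv_mul_cancel, Str.act_one]
      rfl)

/-- The unitor `k ⊗ V ≅ V`, inverse to `ξ ↦ 1 ⊗ ξ`. -/
noncomputable def leftUnitor' (V : DCat R k) :
    (⟨k ⊗[k] V.carrier, Str.tensor (Str.unit R k) V.str⟩ : DCat R k) ≅ V :=
  isoOfLin
    (homOfAct (TensorProduct.lid k V.carrier).toLinearMap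
      (fun y => by
        refine Str.ext_tmul (Str.unit R k) V.str fun a b r η ha hb => ?_
        refine pr_eq_of_homog (V := ⟨_, Str.tensor (Str.unit R k) V.str⟩) _
          (Str.pr_tensor_tmul (Str.unit_pr_one r) hb) ?_ y
        simp [circ_one_left, hb])
      (fun x => by
        refine Str.ext_tmul (Str.unit R k) V.str fun a b r η ha hb => ?_
        simp only [LinearMap.comp_apply]
        rw [Str.act_tensor_tmul _ _ hb, Str.unit_act]
        simp))
    (TensorProduct.lid k V.carrier).symm.toLinearMap
    (by ext; simp) (by ext; simp)

/-- The unitor `V ⊗ k ≅ V`, inverse to `ξ ↦ ξ ⊗ 1`. -/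
noncomputable def rightUnitor' (V : DCat R k) :
    (⟨V.carrier ⊗[k] k, Str.tensor V.str (Str.unit R k)⟩ : DCat R k) ≅ V :=
  isoOfLin
    (homOfAct (TensorProduct.rid k V.carrier).toLinearMap
      (fun y => by
        refine Str.ext_tmul V.str (Str.unit R k) fun a b η r ha hb => ?_
        refine pr_eq_of_homog (V := ⟨_, Str.tensor V.str (Str.unit R k)⟩) _
          (Str.pr_tensor_tmul ha (Str.unit_pr_one r)) ?_ y
        simp [circ_one_right, ha])
      (fun x => by
        refine Str.ext_tmul V.str (Str.unit R k) fun a b η r ha hb => ?_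
        simp only [LinearMap.comp_apply]
        rw [Str.act_tensor_tmul _ _ (Str.unit_pr_one r), Str.unit_act, tri_one_left]
        simp))
    (TensorProduct.rid k V.carrier).symm.toLinearMap
    (by ext; simp) (by ext; simp)

noncomputable instance : MonoidalCategoryStruct (DCat R k) where
  tensorObj V W := ⟨V.carrier ⊗[k] W.carrier, Str.tensor V.str W.str⟩
  whiskerLeft V _ _ g := tensorHom' (𝟙 V) g
  whiskerRight f W := tensorHom' f (𝟙 W)
  tensorHom f g := tensorHom' f g
  tensorUnit := ⟨k, Str.unit R k⟩
  associator V W Z := associator' V W Z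
  leftUnitor V := leftUnitor' V
  rightUnitor V := rightUnitor' V

@[simp] lemma lin_tensorHom {V V' W W' : DCat R k} (f : V ⟶ V') (g : W ⟶ W') :
    lin (f ⊗ₘ g) = TensorProduct.map (lin f) (lin g) := rfl

@[simp] lemma lin_whiskerLeft (V : DCat R k) {W W' : DCat R k} (g : W ⟶ W') :
    lin (V ◁ g) = TensorProduct.map LinearMap.id (lin g) := rfl

@[simp] lemma lin_whiskerRight {V V' : DCat R k} (f : V ⟶ V') (W : DCat R k) :
    lin (f ▷ W) = TensorProduct.map (lin f) LinearMap.id := rfl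

@[simp] lemma lin_associator (V W Z : DCat R k) :
    lin (α_ V W Z).hom = Str.assocLin V.str W.str Z.str := rfl

@[simp] lemma lin_associator_inv (V W Z : DCat R k) :
    lin (α_ V W Z).inv = Str.assocInvLin V.str W.str Z.str := rfl

@[simp] lemma lin_leftUnitor (V : DCat R k) :
    lin (λ_ V).hom = (TensorProduct.lid k V.carrier).toLinearMap := rfl

@[simp] lemma lin_rightUnitor (V : DCat R k) :
    lin (ρ_ V).hom = (TensorProduct.rid k V.carrier).toLinearMap := rfl

@[simp] lemma lin_leftUnitor_inv (V : DCat R k) :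
    lin (λ_ V).inv = (TensorProduct.lid k V.carrier).symm.toLinearMap := rfl

@[simp] lemma lin_rightUnitor_inv (V : DCat R k) :
    lin (ρ_ V).inv = (TensorProduct.rid k V.carrier).symm.toLinearMap := rfl

lemma tensorObj_str (V W : DCat R k) : (V ⊗ W).str = Str.tensor V.str W.str := rfl

lemma tensorUnit_str : (𝟙_ (DCat R k)).str = Str.unit R k := rfl

lemma assocLin_naturality {V W Z V' W' Z' : DCat R k} (f : V ⟶ V') (g : W ⟶ W') (h : Z ⟶ Z') :
    Str.assocLin V'.str W'.str Z'.str ∘ₗ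
        TensorProduct.map (TensorProduct.map (lin f) (lin g)) (lin h) =
      TensorProduct.map (lin f) (TensorProduct.map (lin g) (lin h)) ∘ₗ
        Str.assocLin V.str W.str Z.str := by
  refine Str.ext_tmul3 V.str W.str Z.str fun a b c ξ η ζ ha hb hc => ?_
  simp only [LinearMap.comp_apply, TensorProduct.map_tmul]
  rw [Str.assocLin_tmul _ hb hc, Str.assocLin_tmul _ (lin_homog g hb) (lin_homog h hc)]
  simp only [TensorProduct.map_tmul, lin_act]

lemma assocLin_pentagon (V W Z U : DCat R k) :
    TensorProduct.map LinearMap.id (Str.assocLin W.str Z.str U.str) ∘ₗ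
      Str.assocLin V.str (Str.tensor W.str Z.str) U.str ∘ₗ
        TensorProduct.map (Str.assocLin V.str W.str Z.str) LinearMap.id =
    Str.assocLin V.str W.str (Str.tensor Z.str U.str) ∘ₗ
      Str.assocLin (Str.tensor V.str W.str) Z.str U.str := by
  refine Str.ext_tmul4 V.str W.str Z.str U.str fun a b c d ξ η ζ θ ha hb hc hd => ?_
  simp only [LinearMap.comp_apply, TensorProduct.map_tmul, LinearMap.id_apply]
  rw [Str.assocLin_tmul _ hb hc,
    Str.assocLin_tmul _ (Str.pr_tensor_tmul hb hc) hd, TensorProduct.map_tmul,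
    Str.assocLin_tmul _ hc hd, Str.assocLin_tmul _ hc hd, Str.act_tensor_tmul _ _ hb,
    Str.assocLin_tmul _ (W.str.act_deg _ hb) (Str.pr_tensor_tmul hc hd), ← Str.act_mul,
    ← Str.act_mul, ttau_cocycle]
  rfl

lemma assocLin_triangle (V W : DCat R k) :
    TensorProduct.map LinearMap.id (TensorProduct.lid k W.carrier).toLinearMap ∘ₗ
      Str.assocLin V.str (Str.unit R k) W.str =
    TensorProduct.map (TensorProduct.rid k V.carrier).toLinearMap LinearMap.id := by
  refine Str.ext_tmul3 V.str (Str.unit R k) W.str fun a b c ξ r ζ ha hb hc => ?_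
  rw [LinearMap.comp_apply, Str.assocLin_tmul _ (Str.unit_pr_one r) hc, ttau_one_left,
    Subgroup.coe_one, Str.act_one]
  simp [TensorProduct.smul_tmul]

lemma lid_naturality {V W : DCat R k} (f : V ⟶ W) :
    (TensorProduct.lid k W.carrier).toLinearMap ∘ₗ TensorProduct.map LinearMap.id (lin f) =
      lin f ∘ₗ (TensorProduct.lid k V.carrier).toLinearMap := by
  refine TensorProduct.ext' fun r ξ => ?_
  simp

lemma rid_naturality {V W : DCat R k} (f : V ⟶ W) :
    (TensorProduct.rid k W.carrier).toLinearMap ∘ₗ TensorProduct.map (lin f) LinearMap.id =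
      lin f ∘ₗ (TensorProduct.rid k V.carrier).toLinearMap := by
  refine TensorProduct.ext' fun ξ r => ?_
  simp

noncomputable instance : MonoidalCategory (DCat R k) :=
  MonoidalCategory.ofTensorHom
    (id_tensorHom_id := fun V W => lin_injective (TensorProduct.map_id))
    (id_tensorHom := fun _ _ _ _ => rfl)
    (tensorHom_id := fun _ _ => rfl)
    (tensorHom_comp_tensorHom := fun f₁ f₂ g₁ g₂ => lin_injective
      (TensorProduct.map_comp _ _ _ _).symm)
    (associator_naturality := fun f g h => lin_injective (assocLin_naturality f g h))
    (leftUnitor_naturality := fun f => lin_injective (lid_naturality f))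
    (rightUnitor_naturality := fun f => lin_injective (rid_naturality f))
    (pentagon := fun V W Z U => lin_injective (assocLin_pentagon V W Z U))
    (triangle := fun V W => lin_injective (assocLin_triangle V W))

end DCat

namespace Str

variable {X : Type u} [Group X] [Fintype X] {R : CosetReps X} {k : Type u} [Field k]
  {V W : Type u} [AddCommGroup V] [Module k V] [AddCommGroup W] [Module k W]

/-- The braiding `Ψ(ξ ⊗ η) = ⟨ξ⟩ ⊳ η ⊗ ξ ◁ |η|`. -/
noncomputable def braidLin (σ : Str R k V) (τ : Str R k W) : V ⊗[k] W →ₗ[k] W ⊗[k] V :=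
  (TensorProduct.comm k V W).toLinearMap ∘ₗ
    ∑ a, ∑ b, TensorProduct.map (σ.gact (R.abv b) ∘ₗ σ.pr a) (τ.mact (R.ang a) ∘ₗ τ.pr b)

/-- The inverse of the braiding. -/
noncomputable def braidInvLin (σ : Str R k V) (τ : Str R k W) : W ⊗[k] V →ₗ[k] V ⊗[k] W :=
  (TensorProduct.comm k W V).toLinearMap ∘ₗ
    ∑ b, ∑ a, TensorProduct.map (τ.act (R.mp a) ∘ₗ τ.pr b)
      (σ.act (R.abv ((R.mp a : X)⁻¹ * b * R.mp a) : X)⁻¹ ∘ₗ σ.pr a)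

variable {σ : Str R k V} {τ : Str R k W}

lemma braidLin_tmul {a b : X} {ξ : V} {η : W} (ha : σ.pr a ξ = ξ) (hb : τ.pr b η = η) :
    braidLin σ τ (ξ ⊗ₜ η) =
      τ.act (R.mp ((R.abv b : X)⁻¹ * a * R.abv b) : X)⁻¹ η ⊗ₜ σ.act (R.abv b) ξ := by
  have := sum_tmul₂ (σ := σ) (τ := τ) (fun a b =>
    TensorProduct.map (σ.gact (R.abv b)) (τ.mact (R.ang a))) ha hb
  simp only [TensorProduct.map_tmul] at this
  simp only [braidLin, LinearMap.comp_apply, LinearMap.sum_apply, TensorProduct.map_tmul]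
  rw [this, LinearEquiv.coe_coe, TensorProduct.comm_tmul, mact_eq_act _ _ hb, act_coe,
    R.ttau_conj_coe a (R.abv b) _ rfl]
  rfl

lemma braidInvLin_tmul {a b : X} {ξ : V} {η : W} (ha : σ.pr a ξ = ξ) (hb : τ.pr b η = η) :
    braidInvLin σ τ (η ⊗ₜ ξ) =
      σ.act (R.abv ((R.mp a : X)⁻¹ * b * R.mp a) : X)⁻¹ ξ ⊗ₜ τ.act (R.mp a) η := by
  have := sum_tmul₂ (σ := τ) (τ := σ) (fun b a =>
    TensorProduct.map (τ.act (R.mp a))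
      (σ.act (R.abv ((R.mp a : X)⁻¹ * b * R.mp a) : X)⁻¹)) hb ha
  simp only [TensorProduct.map_tmul] at this
  simp only [braidInvLin, LinearMap.comp_apply, LinearMap.sum_apply, TensorProduct.map_tmul]
  rw [this, LinearEquiv.coe_coe, TensorProduct.comm_tmul]

end Str

section Identities

variable {X : Type u} [Group X] (R : CosetReps X)

lemma abs_eq (b : X) : (R.abv b : X) = R.mp b * b⁻¹ := R.coe_abv b

lemma mp_absconj (a b : X) : R.mp ((R.abv b : X)⁻¹ * a * R.abv b) = R.mp (a * R.abv b) := by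
  rw [mul_assoc, ← Subgroup.coe_inv, mp_mul]

lemma mp_coe_mul_mp (a b : X) : R.mp (R.mp a * b) = R.mp (a * b) := R.mp_mp_mul a b

lemma gp_inv_eq_abv (b : X) : (R.gp b : X) = (R.abv b : X)⁻¹ := by simp [abv]

lemma circ_eq_abv (a b : X) : R.circ a b = (R.abv b : X)⁻¹ * a * R.abv b * b := by
  rw [circ, gp_inv_eq_abv, abs_eq]; group

lemma circ_braid (a b : X) :
    R.circ ((R.mp ((R.abv b : X)⁻¹ * a * R.abv b) : X)⁻¹⁻¹ * b *
      (R.mp ((R.abv b : X)⁻¹ * a * R.abv b) : X)⁻¹) ((R.abv b : X)⁻¹ * a * R.abv b) =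
      R.circ a b := by
  rw [R.circ_eq_abv a b, circ, gp_eq]
  group

lemma tri_mul_abv (b x : X) : R.tri b x * R.abv (x⁻¹ * b * x) = R.abv b * x := by
  rw [tri, abs_eq, abs_eq]; group

lemma inv_mul_tri (z x : X) :
    (R.mp z : X)⁻¹ * R.tri z x = x * (R.mp (x⁻¹ * z * x) : X)⁻¹ := by
  rw [tri]; group

lemma ttau_mul_abv (b c : X) : (R.ttau b c : X) * R.abv (R.circ b c) = R.abv b * R.abv c := by
  rw [abs_eq, mp_circ, ttau, coe_tau, circ, abs_eq, abs_eq, gp_eq]; group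

lemma hex1 (b c z q : X) (h : R.mp ((R.abv c : X)⁻¹ * z * R.abv c) = q) :
    R.tri c q⁻¹ * R.ttau (q⁻¹⁻¹ * c * q⁻¹) ((R.abv c : X)⁻¹ * z * R.abv c) =
      (R.mp c : X) * (R.dot (R.mp z) (R.mp c) : X)⁻¹ := by
  rw [ttau, coe_tau, tri, h, ← mp_circ, ← mp_circ, ← h, circ_braid]
  group

lemma hex2 (b c q : X) (h : R.mp ((R.abv c : X)⁻¹ * b * R.abv c) = q) :
    (R.ttau b c : X)⁻¹ * R.tri b (R.abv c) =
      (R.ttau (q⁻¹⁻¹ * c * q⁻¹) ((R.abv c : X)⁻¹ * b * R.abv c) : X)⁻¹ *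
        R.abv (q⁻¹⁻¹ * c * q⁻¹) := by
  rw [ttau, ttau, coe_tau, coe_tau, ← mp_circ, ← mp_circ, ← h, circ_braid, h, tri, h, abs_eq,
    abs_eq]
  group

lemma dot_ttau (a b : X) : (R.dot (R.mp a) (R.mp b) : X)⁻¹ * (R.ttau a b : X)⁻¹ =
    (R.mp b : X)⁻¹ * (R.mp a : X)⁻¹ := by
  rw [ttau, coe_tau]; group

end Identities

namespace DCat

variable {X : Type u} [Group X] [Fintype X] {R : CosetReps X} {k : Type u} [Field k]

lemma braid_pr (V W : DCat R k) (y : X) :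
    (Str.tensor W.str V.str).pr y ∘ₗ Str.braidLin V.str W.str =
      Str.braidLin V.str W.str ∘ₗ (Str.tensor V.str W.str).pr y := by
  refine Str.ext_tmul V.str W.str fun a b ξ η ha hb => ?_
  refine pr_eq_of_homog (V := ⟨_, Str.tensor V.str W.str⟩)
    (W := ⟨_, Str.tensor W.str V.str⟩) _ (Str.pr_tensor_tmul ha hb) ?_ y
  rw [Str.braidLin_tmul ha hb, ← circ_braid]
  exact Str.pr_tensor_tmul (W.str.act_deg _ hb) (V.str.act_deg _ ha)

lemma braid_act (V W : DCat R k) (x : X) :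
    (Str.tensor W.str V.str).act x ∘ₗ Str.braidLin V.str W.str =
      Str.braidLin V.str W.str ∘ₗ (Str.tensor V.str W.str).act x := by
  refine Str.ext_tmul V.str W.str fun a b ξ η ha hb => ?_
  rw [LinearMap.comp_apply, LinearMap.comp_apply, Str.braidLin_tmul ha hb,
    Str.act_tensor_tmul _ _ hb, Str.act_tensor_tmul _ _ (V.str.act_deg _ ha),
    Str.braidLin_tmul (V.str.act_deg _ ha) (W.str.act_deg _ hb),
    ← Str.act_mul, ← Str.act_mul, ← Str.act_mul, ← Str.act_mul, tri_mul_abv, inv_mul_tri]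
  congr 6
  have := R.tri_mul_abv b x
  rw [← eq_mul_inv_iff_mul_eq] at this
  rw [this]; group

lemma braid_inv_hom (V W : DCat R k) :
    Str.braidInvLin V.str W.str ∘ₗ Str.braidLin V.str W.str = LinearMap.id := by
  refine Str.ext_tmul V.str W.str fun a b ξ η ha hb => ?_
  rw [LinearMap.comp_apply, Str.braidLin_tmul ha hb,
    Str.braidInvLin_tmul (V.str.act_deg _ ha) (W.str.act_deg _ hb), ← Str.act_mul, ← Str.act_mul,
    inv_mul_cancel, Str.act_one]
  have : ∀ q : X, q⁻¹ * (q⁻¹⁻¹ * b * q⁻¹) * q = b := fun q => by group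
  rw [this, mul_inv_cancel, Str.act_one]
  rfl

lemma braid_hom_inv (V W : DCat R k) :
    Str.braidLin V.str W.str ∘ₗ Str.braidInvLin V.str W.str = LinearMap.id := by
  refine Str.ext_tmul W.str V.str fun b a η ξ hb ha => ?_
  rw [LinearMap.comp_apply, Str.braidInvLin_tmul ha hb,
    Str.braidLin_tmul (V.str.act_deg _ ha) (W.str.act_deg _ hb), ← Str.act_mul, ← Str.act_mul,
    inv_mul_cancel, Str.act_one]
  have : ∀ q : X, q⁻¹ * (q⁻¹⁻¹ * a * q⁻¹) * q = a := fun q => by group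
  rw [this, mul_inv_cancel, Str.act_one]
  rfl

/-- The braiding of `𝒟`. -/
noncomputable def braiding' (V W : DCat R k) : V ⊗ W ≅ W ⊗ V :=
  isoOfLin (homOfAct (V := V ⊗ W) (W := W ⊗ V) (Str.braidLin V.str W.str) (braid_pr V W)
    (braid_act V W)) (Str.braidInvLin V.str W.str) (braid_inv_hom V W) (braid_hom_inv V W)

lemma braid_naturality {V W V' W' : DCat R k} (f : V ⟶ V') (g : W ⟶ W') :
    Str.braidLin V'.str W'.str ∘ₗ TensorProduct.map (lin f) (lin g) =
      TensorProduct.map (lin g) (lin f) ∘ₗ Str.braidLin V.str W.str := by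
  refine Str.ext_tmul V.str W.str fun a b ξ η ha hb => ?_
  rw [LinearMap.comp_apply, LinearMap.comp_apply, Str.braidLin_tmul ha hb,
    TensorProduct.map_tmul, TensorProduct.map_tmul,
    Str.braidLin_tmul (lin_homog f ha) (lin_homog g hb), lin_act, lin_act]

lemma braid_hexagon (V W Z : DCat R k) :
    Str.assocLin W.str Z.str V.str ∘ₗ Str.braidLin V.str (Str.tensor W.str Z.str) ∘ₗ
      Str.assocLin V.str W.str Z.str =
    TensorProduct.map LinearMap.id (Str.braidLin V.str Z.str) ∘ₗ
      Str.assocLin W.str V.str Z.str ∘ₗ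
        TensorProduct.map (Str.braidLin V.str W.str) LinearMap.id := by
  refine Str.ext_tmul3 V.str W.str Z.str fun a b c ξ η ζ ha hb hc => ?_
  simp only [LinearMap.comp_apply, TensorProduct.map_tmul, LinearMap.id_apply]
  have e : (R.abv (R.circ b c) : X)⁻¹ * ((R.ttau b c : X)⁻¹ * a * (R.ttau b c : X)) *
      R.abv (R.circ b c) = (R.abv c : X)⁻¹ * ((R.abv b : X)⁻¹ * a * R.abv b) * R.abv c := by
    have h := R.ttau_mul_abv b c
    rw [← eq_mul_inv_iff_mul_eq] at h
    rw [h]; group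
  rw [Str.assocLin_tmul _ hb hc,
    Str.braidLin_tmul (V.str.act_deg _ ha) (Str.pr_tensor_tmul hb hc),
    Str.act_tensor_tmul _ _ hc, ← Str.act_mul, ttau_mul_abv, e]
  have hξ : V.str.pr ((R.abv c : X)⁻¹ * ((R.abv b : X)⁻¹ * a * R.abv b) * R.abv c)
      (V.str.act (R.abv b * R.abv c) ξ) = V.str.act (R.abv b * R.abv c) ξ := by
    rw [Str.act_mul]; exact V.str.act_deg _ (V.str.act_deg _ ha)
  rw [Str.assocLin_tmul _ (Z.str.act_deg _ hc) hξ, ← Str.act_mul, R.hex1 b c _ _ rfl,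
    Str.braidLin_tmul ha hb, Str.assocLin_tmul _ (V.str.act_deg _ ha) hc, TensorProduct.map_tmul,
    Str.braidLin_tmul (V.str.act_deg _ ha) hc, ← Str.act_mul, ← Str.act_mul, ttau, coe_tau, LinearMap.id_apply]
  congr 2
  congr 1
  group

lemma braid_hexagon' (V W Z : DCat R k) :
    Str.assocInvLin Z.str V.str W.str ∘ₗ Str.braidLin (Str.tensor V.str W.str) Z.str ∘ₗ
      Str.assocInvLin V.str W.str Z.str =
    TensorProduct.map (Str.braidLin V.str Z.str) LinearMap.id ∘ₗ
      Str.assocInvLin V.str Z.str W.str ∘ₗ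
        TensorProduct.map LinearMap.id (Str.braidLin W.str Z.str) := by
  refine Str.ext_tmul3' V.str W.str Z.str fun a b c ξ η ζ ha hb hc => ?_
  simp only [LinearMap.comp_apply, TensorProduct.map_tmul, LinearMap.id_apply]
  have ha' : V.str.pr ((R.ttau b c : X) * a * (R.ttau b c : X)⁻¹)
      (V.str.act (R.ttau b c : X)⁻¹ ξ) = V.str.act (R.ttau b c : X)⁻¹ ξ := by
    have := V.str.act_deg (R.ttau b c : X)⁻¹ ha
    rwa [inv_inv] at this
  obtain ⟨q, hq⟩ : ∃ q, (R.mp ((R.abv c : X)⁻¹ * b * R.abv c) : X) = q := ⟨_, rfl⟩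
  have h2 := R.hex2 b c q hq
  rw [Str.assocInvLin_tmul _ hb hc, Str.braidLin_tmul (Str.pr_tensor_tmul ha' hb) hc,
    Str.act_tensor_tmul _ _ hb, ← Str.act_mul, circ_conj,
    Str.braidLin_tmul hb hc, hq, Str.assocInvLin_tmul _ (Z.str.act_deg _ hc)
      (W.str.act_deg _ hb), TensorProduct.map_tmul,
    Str.braidLin_tmul (V.str.act_deg _ ha) (Z.str.act_deg _ hc), ← Str.act_mul, ← Str.act_mul,
    ← h2]
  have hξ : V.str.pr ((R.tri b (R.abv c))⁻¹ * ((R.ttau b c : X) * a * (R.ttau b c : X)⁻¹) *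
      R.tri b (R.abv c)) (V.str.act ((R.ttau b c : X)⁻¹ * R.tri b (R.abv c)) ξ) =
      V.str.act ((R.ttau b c : X)⁻¹ * R.tri b (R.abv c)) ξ := by
    rw [Str.act_mul]; exact V.str.act_deg _ ha'
  rw [Str.assocInvLin_tmul _ hξ (W.str.act_deg _ hb), ← Str.act_mul]
  have e : (R.abv (q⁻¹⁻¹ * c * q⁻¹) : X)⁻¹ *
      ((R.ttau (q⁻¹⁻¹ * c * q⁻¹) ((R.abv c : X)⁻¹ * b * R.abv c) : X)⁻¹⁻¹ * a *
        (R.ttau (q⁻¹⁻¹ * c * q⁻¹) ((R.abv c : X)⁻¹ * b * R.abv c) : X)⁻¹) *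
      R.abv (q⁻¹⁻¹ * c * q⁻¹) =
      (R.tri b (R.abv c))⁻¹ * ((R.ttau b c : X) * a * (R.ttau b c : X)⁻¹) *
        R.tri b (R.abv c) := by
    have h3 := h2
    rw [inv_mul_eq_iff_eq_mul] at h3
    rw [h3]; group
  rw [e, mp_circ, dot_ttau, hq, LinearMap.id_apply]

noncomputable instance : BraidedCategory (DCat R k) where
  braiding V W := braiding' V W
  braiding_naturality_right _ _ _ g := lin_injective (braid_naturality (𝟙 _) g)
  braiding_naturality_left f _ := lin_injective (braid_naturality f (𝟙 _))
  hexagon_forward V W Z := lin_injective (braid_hexagon V W Z)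
  hexagon_reverse V W Z := lin_injective (braid_hexagon' V W Z)

@[simp] lemma lin_braiding (V W : DCat R k) :
    lin (β_ V W).hom = Str.braidLin V.str W.str := rfl

end DCat

section Dual

variable {X : Type u} [Group X] (R : CosetReps X)

lemma yL_eq (z : X) : R.yL z = (R.mp z : X) * z⁻¹ * (R.mp z : X)⁻¹ := by
  rw [yL, gp_eq]; group

lemma mp_yL (z : X) : R.mp (R.yL z) = R.lInv (R.mp z) := by
  rw [yL, lInv, ← Subgroup.coe_inv, mp_mul]

lemma yL_yR (w : X) : R.yL (R.yR w) = w := by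
  rw [yL_eq, mp_yR, yR]; group

lemma yR_yL (z : X) : R.yR (R.yL z) = z := by
  rw [yR, mp_yL, rInv_lInv, yL_eq]; group

/-- The element of `X` acting on `η` in the formula for `(α ◁ v)(η)`, with `z = ‖η‖`:
`τ(zᴸ, z)⁻¹ (zᴸ ▷ v⁻¹) τ(zᴸ ◁ v⁻¹, (zᴸ ◁ v⁻¹)ᴿ)` in terms of the operations on `Y = X`. -/
noncomputable def dualArg (z v : X) : X :=
  (R.ttau (R.yL z) z : X)⁻¹ * R.tri (R.yL z) v⁻¹ *
    R.ttau (v * R.yL z * v⁻¹) (R.yR (v * R.yL z * v⁻¹))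

lemma dualArg_eq (z v : X) : R.dualArg z v =
    (R.mp z : X)⁻¹ * v⁻¹ * (R.rInv (R.mp (v * R.yL z * v⁻¹)) : X) := by
  rw [dualArg, ttau, ttau, coe_tau, coe_tau, mp_yR, dot_rInv, mp_yL, dot_lInv, ← mp_yL, tri,
    inv_inv, coe_e]
  group

lemma dualArg_conj (z v : X) :
    (R.dualArg z v)⁻¹ * z * R.dualArg z v = R.yR (v * R.yL z * v⁻¹) := by
  rw [dualArg_eq, yR]
  generalize R.rInv (R.mp (v * R.yL z * v⁻¹)) = r
  rw [yL_eq]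
  group

lemma dualArg_one (z : X) : R.dualArg z 1 = 1 := by
  rw [dualArg_eq]
  simp [mp_yL, rInv_lInv]

lemma dualArg_mul (z x y : X) : R.dualArg z (x * y) =
    R.dualArg z y * R.dualArg (R.yR (y * R.yL z * y⁻¹)) x := by
  rw [dualArg_eq, dualArg_eq, dualArg_eq, yL_yR, mp_yR]
  rw [show x * y * R.yL z * (x * y)⁻¹ = x * (y * R.yL z * y⁻¹) * x⁻¹ by group]
  group

lemma mul_dualArg_tri (z x : X) : x * R.dualArg (x⁻¹ * z * x) (R.tri z x) = 1 := by
  have h : R.tri z x * R.yL (x⁻¹ * z * x) * (R.tri z x)⁻¹ = R.yL z := by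
    rw [yL_eq, yL_eq, tri]; group
  rw [dualArg_eq, h, mp_yL, rInv_lInv, tri]
  group

/-- `τ(yᴸ, y)⁻¹`, the element of `G` used in the coevaluation. -/
noncomputable def coevArg (y : X) : X := (R.ttau (R.yL y) y : X)⁻¹

lemma coevArg_eq (y : X) : R.coevArg y = (R.mp y : X)⁻¹ * (R.mp (R.yL y) : X)⁻¹ := by
  rw [coevArg, ttau, coe_tau, mp_yL, dot_lInv, coe_e]; group

lemma circ_coevArg (y : X) :
    R.circ ((R.coevArg y)⁻¹ * y * R.coevArg y) (R.yL y) = 1 := by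
  rw [circ, coevArg_eq, gp_eq]
  generalize R.mp (R.yL y) = s
  rw [yL_eq]; group

lemma dualArg_coevArg (z x y : X) (hy : y = R.yR (x * R.yL z * x⁻¹)) :
    R.dualArg z x * (R.coevArg y * R.tri (R.yL y) x) = R.coevArg z := by
  have h1 : R.yL y = x * R.yL z * x⁻¹ := by rw [hy, yL_yR]
  have h2 : R.mp y = R.rInv (R.mp (x * R.yL z * x⁻¹)) := by rw [hy, mp_yR]
  rw [coevArg_eq, coevArg_eq, dualArg_eq, tri, h1, h2,
    show x⁻¹ * (x * R.yL z * x⁻¹) * x = R.yL z by group]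
  group

end Dual

namespace Str

variable {X : Type u} [Group X] [Fintype X] {R : CosetReps X} {k : Type u} [Field k]
  {V : Type u} [AddCommGroup V] [Module k V] (σ : Str R k V)

/-- The transpose of the action of `v` on the dual. -/
noncomputable def dualActT (v : X) : V →ₗ[k] V := ∑ z, σ.act (R.dualArg z v) ∘ₗ σ.pr z

lemma dualActT_homog (v : X) {z : X} {η : V} (h : σ.pr z η = η) :
    σ.dualActT v η = σ.act (R.dualArg z v) η := by
  rw [dualActT, LinearMap.sum_apply]
  exact σ.sum_homog (fun z => σ.act (R.dualArg z v)) h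

lemma dualActT_deg (v : X) {z : X} {η : V} (h : σ.pr z η = η) :
    σ.pr (R.yR (v * R.yL z * v⁻¹)) (σ.dualActT v η) = σ.dualActT v η := by
  rw [dualActT_homog _ _ h, ← dualArg_conj]
  exact σ.act_deg _ h

/-- The dual `V'` of an object of `𝒟`: a functional `α` has degree `yᴸ` if it vanishes on all
homogeneous components other than that of degree `y`, and
`(α ◁ v)(η) = α(η ◁ τ(zᴸ, z)⁻¹ (zᴸ ▷ v⁻¹) τ(zᴸ ◁ v⁻¹, (zᴸ ◁ v⁻¹)ᴿ))` for `z = ‖η‖`. -/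
noncomputable def dual : Str R k (Module.Dual k V) :=
  ofAct R (fun w => (σ.pr (R.yR w)).dualMap)
    (fun y α => by ext ξ; simp [σ.pr_self])
    (fun y z α h => by
      ext ξ
      have : R.yR z ≠ R.yR y := fun h' => h (by rw [← R.yL_yR y, ← h', R.yL_yR])
      simp [σ.pr_ne _ _ _ this])
    (fun α => by
      ext ξ
      rw [LinearMap.sum_apply]
      simp only [LinearMap.dualMap_apply]
      rw [← map_sum]
      congr 1
      rw [← σ.sum_pr ξ]
      conv_lhs => simp only [σ.sum_pr]
      exact Function.Bijective.sum_comp (e := R.yR)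
        (Function.bijective_iff_has_inverse.2 ⟨R.yL, R.yL_yR, R.yR_yL⟩) (fun y => σ.pr y ξ))
    (fun v => (σ.dualActT v).dualMap)
    (fun α => by
      suffices α ∘ₗ σ.dualActT 1 = α from this
      refine σ.ext_homog fun z η h => ?_
      rw [LinearMap.comp_apply, dualActT_homog _ _ h, dualArg_one, act_one])
    (fun x y α => by
      suffices α ∘ₗ σ.dualActT (x * y) = (α ∘ₗ σ.dualActT x) ∘ₗ σ.dualActT y from this
      refine σ.ext_homog fun z η h => ?_
      rw [LinearMap.comp_apply, LinearMap.comp_apply, LinearMap.comp_apply,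
        dualActT_homog _ _ (dualActT_deg σ y h), dualActT_homog _ _ h, dualActT_homog _ _ h,
        dualArg_mul, act_mul])
    (fun x w α hα => by
      suffices (α ∘ₗ σ.dualActT x) ∘ₗ σ.pr (R.yR (x⁻¹ * w * x)) = α ∘ₗ σ.dualActT x from this
      refine σ.ext_homog fun z η h => ?_
      have hα' : ∀ ξ, α (σ.pr (R.yR w) ξ) = α ξ := fun ξ => LinearMap.congr_fun hα ξ
      simp only [LinearMap.comp_apply]
      by_cases hz : R.yR (x⁻¹ * w * x) = z
      · rw [hz, h]
      · rw [σ.pr_of_ne h hz, map_zero, map_zero, ← hα', σ.pr_of_ne (dualActT_deg σ x h), map_zero]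
        intro h'
        apply hz
        have := congrArg R.yL h'
        rw [yL_yR, yL_yR] at this
        rw [this, ← R.yR_yL z, yL_yR]
        congr 1
        group)

lemma dual_act (v : X) : σ.dual.act v = (σ.dualActT v).dualMap := by
  exact congrFun (act_ofAct (R := R) (fun w => (σ.pr (R.yR w)).dualMap) _ _ _
    (fun v => (σ.dualActT v).dualMap) _ _ _) v

lemma dual_pr (w : X) : σ.dual.pr w = (σ.pr (R.yR w)).dualMap := rfl

end Str

namespace DCat

variable {X : Type u} [Group X] [Fintype X] {R : CosetReps X} {k : Type u} [Field k]

/-- The dual object. -/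
noncomputable def dual (V : DCat R k) : DCat R k := ⟨Module.Dual k V.carrier, V.str.dual⟩

lemma pr_unit (y : X) (hy : y ≠ 1) : (Str.unit R k).pr y = 0 := by simp [Str.unit, hy]

/-- The evaluation `ev(α ⊗ ξ) = α(ξ)`. -/
noncomputable def ev (V : DCat R k) : V.dual ⊗ V ⟶ 𝟙_ (DCat R k) :=
  homOfAct (V := V.dual ⊗ V) (W := 𝟙_ (DCat R k)) (contractLeft k V.carrier)
    (fun y => by
      refine Str.ext_tmul V.str.dual V.str fun w z α η hα hη => ?_
      have hα' : ∀ ξ, α (V.str.pr (R.yR w) ξ) = α ξ := fun ξ => LinearMap.congr_fun hα ξ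
      have key : (Str.unit R k).pr (R.circ w z) (contractLeft k V.carrier (α ⊗ₜ η)) =
          contractLeft k V.carrier (α ⊗ₜ η) := by
        rw [contractLeft_apply]
        by_cases hz : z = R.yR w
        · rw [hz, circ_yR, Str.unit_pr_one]
        · rw [← hα', V.str.pr_of_ne hη (Ne.symm hz), map_zero, map_zero]
      exact pr_eq_of_homog (V := ⟨_, Str.tensor V.str.dual V.str⟩)
        (W := ⟨_, Str.unit R k⟩) _ (Str.pr_tensor_tmul hα hη) key y)
    (fun x => by
      refine Str.ext_tmul V.str.dual V.str fun w z α η hα hη => ?_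
      have key : (Str.unit R k).act x (contractLeft k V.carrier (α ⊗ₜ η)) =
          contractLeft k V.carrier ((Str.tensor V.str.dual V.str).act x (α ⊗ₜ η)) := by
        rw [Str.act_tensor_tmul _ _ hη, Str.unit_act, Str.dual_act, contractLeft_apply,
          contractLeft_apply, LinearMap.dualMap_apply,
          Str.dualActT_homog _ _ (V.str.act_deg x hη), ← Str.act_mul, mul_dualArg_tri,
          Str.act_one]
        rfl
      exact key)

/-- `ξ ↦ ξ ◁ τ(⟨ξ⟩ᴸ, ⟨ξ⟩)⁻¹`. -/
noncomputable def coevTwist (V : DCat R k) : V.carrier →ₗ[k] V.carrier :=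
  ∑ y, V.str.act (R.coevArg y) ∘ₗ V.str.pr y

lemma coevTwist_homog (V : DCat R k) {y : X} {ξ : V.carrier} (h : V.str.pr y ξ = ξ) :
    V.coevTwist ξ = V.str.act (R.coevArg y) ξ := by
  rw [coevTwist, LinearMap.sum_apply]
  exact V.str.sum_homog (fun y => V.str.act (R.coevArg y)) h

/-- The linear map `1 ↦ ∑ ξ ◁ τ(⟨ξ⟩ᴸ, ⟨ξ⟩)⁻¹ ⊗ ξ̂`, where `∑ ξ ⊗ ξ̂` is the canonical element. -/
noncomputable def coevLin (V : DCat R k) : k →ₗ[k] V.carrier ⊗[k] Module.Dual k V.carrier :=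
  TensorProduct.map V.coevTwist LinearMap.id ∘ₗ coevaluation k V.carrier

lemma map_dualMap_coevaluation (V : DCat R k) (f : V.carrier →ₗ[k] V.carrier) :
    TensorProduct.map LinearMap.id f.dualMap ∘ₗ coevaluation k V.carrier =
      TensorProduct.map f LinearMap.id ∘ₗ coevaluation k V.carrier := by
  classical
  let b := Module.Basis.ofVectorSpace k V.carrier
  ext
  apply (TensorProduct.comm k V.carrier (Module.Dual k V.carrier)).injective
  apply (dualTensorHomEquivOfBasis b).injective
  rw [dualTensorHomEquivOfBasis_apply, dualTensorHomEquivOfBasis_apply]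
  ext ξ
  rw [LinearMap.comp_apply, LinearMap.comp_apply, coevaluation_apply_one]
  simp only [map_sum, TensorProduct.map_tmul, LinearMap.id_apply, TensorProduct.comm_tmul,
    LinearMap.sum_apply, dualTensorHom_apply, LinearMap.dualMap_apply]
  simp only [Module.Basis.coord_apply]
  rw [Module.Basis.sum_repr]
  conv_lhs => rw [← (Module.Basis.ofVectorSpace k V.carrier).sum_repr ξ]
  simp only [map_sum, map_smul]

lemma map_map_coevaluation (V : DCat R k) (f g : V.carrier →ₗ[k] V.carrier) :
    TensorProduct.map f g.dualMap (coevaluation k V.carrier 1) =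
      TensorProduct.map (f ∘ₗ g) LinearMap.id (coevaluation k V.carrier 1) := by
  have h := LinearMap.congr_fun (map_dualMap_coevaluation V g) 1
  simp only [LinearMap.comp_apply] at h
  have h1 := congrArg (TensorProduct.map f LinearMap.id) h
  rw [TensorProduct.map_map, TensorProduct.map_map] at h1
  simpa using h1

lemma map_sum_left (V : DCat R k) (F : X → V.carrier →ₗ[k] V.carrier)
    (t : V.carrier ⊗[k] Module.Dual k V.carrier) :
    TensorProduct.map (∑ y, F y) LinearMap.id t =
      ∑ y, TensorProduct.map (F y) LinearMap.id t := by
  induction t with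
  | zero => simp
  | tmul a b => simp [TensorProduct.sum_tmul]
  | add a b ha hb => simp only [map_add, ha, hb, Finset.sum_add_distrib]

lemma coevLin_one (V : DCat R k) : V.coevLin 1 =
    ∑ y, TensorProduct.map (V.str.act (R.coevArg y)) LinearMap.id
      (TensorProduct.map (V.str.pr y) (V.str.pr y).dualMap (coevaluation k V.carrier 1)) := by
  rw [coevLin, LinearMap.comp_apply, coevTwist, map_sum_left]
  refine Finset.sum_congr rfl fun y _ => ?_
  rw [map_map_coevaluation, TensorProduct.map_map]
  congr 2
  ext ξ
  simp [V.str.pr_self]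

/-- The coevaluation `coev(1) = ∑ ξ ◁ τ(⟨ξ⟩ᴸ, ⟨ξ⟩)⁻¹ ⊗ ξ̂`. -/
noncomputable def coev (V : DCat R k) : 𝟙_ (DCat R k) ⟶ V ⊗ V.dual :=
  homOfAct (V := 𝟙_ (DCat R k)) (W := V ⊗ V.dual) V.coevLin
    (fun y => by
      have h1 : (Str.tensor V.str V.str.dual).pr 1 (V.coevLin 1) = V.coevLin 1 := by
        rw [coevLin_one, map_sum]
        refine Finset.sum_congr rfl fun y _ => ?_
        generalize coevaluation k V.carrier 1 = t
        suffices (Str.tensor V.str V.str.dual).pr 1 ∘ₗ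
            TensorProduct.map (V.str.act (R.coevArg y)) LinearMap.id ∘ₗ
              TensorProduct.map (V.str.pr y) (V.str.pr y).dualMap =
            TensorProduct.map (V.str.act (R.coevArg y)) LinearMap.id ∘ₗ
              TensorProduct.map (V.str.pr y) (V.str.pr y).dualMap from LinearMap.congr_fun this t
        refine TensorProduct.ext' fun ξ α => ?_
        simp only [LinearMap.comp_apply, TensorProduct.map_tmul]
        rw [← R.circ_coevArg y]
        refine Str.pr_tensor_tmul (V.str.act_deg _ (V.str.pr_self y ξ)) ?_
        rw [Str.dual_pr, yR_yL]
        ext ζ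
        simp [V.str.pr_self]
      refine LinearMap.ext_ring ?_
      exact pr_eq_of_homog (V := ⟨_, Str.unit R k⟩) (W := ⟨_, Str.tensor V.str V.str.dual⟩)
        V.coevLin (Str.unit_pr_one 1) h1 y)
    (fun x => by
      refine LinearMap.ext_ring ?_
      have key : (Str.tensor V.str V.str.dual).act x (V.coevLin 1) = V.coevLin 1 := by
        conv_lhs => rw [coevLin_one, map_sum]
        rw [coevLin, LinearMap.comp_apply]
        have : V.coevTwist = ∑ y, (V.str.act (R.tri (R.yL y) x) ∘ₗ V.str.act (R.coevArg y) ∘ₗ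
            V.str.pr y) ∘ₗ (V.str.pr y ∘ₗ V.str.dualActT x) := by
          refine V.str.ext_homog fun z η h => ?_
          have hd := V.str.dualActT_deg x h
          rw [coevTwist_homog _ h, LinearMap.sum_apply]
          simp only [LinearMap.comp_apply, V.str.pr_self]
          have := V.str.sum_homog (fun y => V.str.act (R.tri (R.yL y) x) ∘ₗ
            V.str.act (R.coevArg y)) hd
          simp only [LinearMap.comp_apply] at this
          rw [this, Str.dualActT_homog _ _ h, ← Str.act_mul, ← Str.act_mul,
            R.dualArg_coevArg z x _ rfl]
        rw [this, map_sum_left]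
        refine Finset.sum_congr rfl fun y _ => ?_
        rw [← map_map_coevaluation]
        generalize coevaluation k V.carrier 1 = t
        suffices (Str.tensor V.str V.str.dual).act x ∘ₗ
            TensorProduct.map (V.str.act (R.coevArg y)) LinearMap.id ∘ₗ
              TensorProduct.map (V.str.pr y) (V.str.pr y).dualMap =
            TensorProduct.map (V.str.act (R.tri (R.yL y) x) ∘ₗ V.str.act (R.coevArg y) ∘ₗ
              V.str.pr y) (V.str.pr y ∘ₗ V.str.dualActT x).dualMap from
          LinearMap.congr_fun this t
        refine TensorProduct.ext' fun ξ α => ?_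
        simp only [LinearMap.comp_apply, TensorProduct.map_tmul]
        have hα : V.str.dual.pr (R.yL y) ((V.str.pr y).dualMap α) = (V.str.pr y).dualMap α := by
          rw [Str.dual_pr, yR_yL]
          ext ζ
          simp [V.str.pr_self]
        rw [LinearMap.id_apply, Str.act_tensor_tmul _ _ hα, Str.dual_act]
        rfl
      have h2 : (Str.unit R k).act x 1 = 1 := by rw [Str.unit_act]; rfl
      exact key.trans (congrArg V.coevLin h2).symm)

end DCat

section DoubleAlgebra

variable {X : Type u} [Group X] (R : CosetReps X)

/-- The unique solution `a` of `y ∘ a = w` (see `circ_ydiv`, `ydiv_unique`). -/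
noncomputable def ydiv (y w : X) : X :=
  w * (R.ldiv (R.mp y) (R.mp w) : X)⁻¹ * y⁻¹ * (R.ldiv (R.mp y) (R.mp w) : X)

lemma mem_G_of_mp_eq (a b : X) (h : R.mp a = R.mp b) : a * b⁻¹ ∈ R.G := by
  have : a * b⁻¹ = (R.gp a * (R.gp b)⁻¹ : R.G) := by
    rw [Subgroup.coe_mul, Subgroup.coe_inv, gp_eq, gp_eq, h]; group
  rw [this]
  exact Subtype.property _

lemma ydiv_aux (y w : X) : w * (R.ldiv (R.mp y) (R.mp w) : X)⁻¹ * y⁻¹ ∈ R.G := by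
  have h := R.dot_ldiv (R.mp y) (R.mp w)
  rw [dot, mp_mp_mul] at h
  have := R.mem_G_of_mp_eq _ _ h.symm
  rwa [mul_inv_rev, ← mul_assoc] at this

lemma gp_mp_ydiv (y w : X) : R.gp (R.ydiv y w) = ⟨_, R.ydiv_aux y w⟩ ∧
    R.mp (R.ydiv y w) = R.ldiv (R.mp y) (R.mp w) := R.factor_unique _ _ _ rfl

lemma circ_ydiv (y w : X) : R.circ y (R.ydiv y w) = w := by
  rw [circ, (R.gp_mp_ydiv y w).1, (R.gp_mp_ydiv y w).2]
  group

lemma ydiv_unique (y w a : X) (h : R.circ y a = w) : a = R.ydiv y w := by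
  have h1 : R.mp a = R.ldiv (R.mp y) (R.mp w) := R.ldiv_unique _ _ _ (by rw [← h, mp_circ])
  rw [ydiv, ← h1, ← h, circ, gp_eq]
  group

/-- The degree of `h = δ_y ⊗ x`, the solution of `y ∘ ‖h‖ = x⁻¹ y x`; here `h` is given as the
pair `(y, x)`. -/
noncomputable def dDeg (h : X × X) : X := R.ydiv h.1 (h.2⁻¹ * h.1 * h.2)

/-- `(δ_y ⊗ x) ◁ z = δ_{q⁻¹ y q} ⊗ q⁻¹ x z` with `q = ‖δ_y ⊗ x‖ ▷ z`, on basis elements. -/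
noncomputable def dAct (z : X) (h : X × X) : X × X :=
  ((R.tri (R.dDeg h) z)⁻¹ * h.1 * R.tri (R.dDeg h) z, (R.tri (R.dDeg h) z)⁻¹ * h.2 * z)

lemma circ_dDeg (h : X × X) : R.circ h.1 (R.dDeg h) = h.2⁻¹ * h.1 * h.2 := R.circ_ydiv _ _

lemma dDeg_dAct (z : X) (h : X × X) : R.dDeg (R.dAct z h) = z⁻¹ * R.dDeg h * z := by
  refine (R.ydiv_unique _ _ _ ?_).symm
  simp only [dAct]
  rw [← circ_conj, circ_dDeg]
  group

lemma dAct_one (h : X × X) : R.dAct 1 h = h := by simp [dAct, tri_one]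

lemma dAct_mul (x z : X) (h : X × X) : R.dAct (x * z) h = R.dAct z (R.dAct x h) := by
  rw [dAct, dAct, dDeg_dAct, tri_mul]
  simp only [dAct]
  ext <;> simp only <;> group

variable [Fintype X] (k : Type u) [Field k]

/-- The projections of the span of the `δ_y ⊗ x` onto its homogeneous components. -/
noncomputable def dPr (w : X) : (X × X →₀ k) →ₗ[k] (X × X →₀ k) :=
  open scoped Classical in
  Finsupp.linearCombination k fun h => if R.dDeg h = w then Finsupp.single h 1 else 0

open scoped Classical in
lemma dPr_single (w : X) (h : X × X) (r : k) :
    R.dPr k w (Finsupp.single h r) = if R.dDeg h = w then Finsupp.single h r else 0 := by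
  rw [dPr, Finsupp.linearCombination_single]
  split_ifs <;> simp

/-- The action of `X` on the span of the `δ_y ⊗ x`. -/
noncomputable def dActLin (z : X) : (X × X →₀ k) →ₗ[k] (X × X →₀ k) :=
  Finsupp.linearCombination k fun h => Finsupp.single (R.dAct z h) 1

lemma dActLin_single (z : X) (h : X × X) (r : k) :
    R.dActLin k z (Finsupp.single h r) = Finsupp.single (R.dAct z h) r := by
  rw [dActLin, Finsupp.linearCombination_single]
  simp

/-- The structure of the object `D` on the vector space with basis `δ_y ⊗ x`. -/
noncomputable def dStr : Str R k (X × X →₀ k) :=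
  Str.ofAct R (R.dPr k)
    (fun y ξ => by
      induction ξ using Finsupp.induction_linear with
      | zero => simp
      | add f g hf hg => rw [map_add, map_add, hf, hg]
      | single h r => rw [dPr_single]; split_ifs with h1 <;> simp [dPr_single, h1])
    (fun y z ξ hyz => by
      induction ξ using Finsupp.induction_linear with
      | zero => simp
      | add f g hf hg => rw [map_add, map_add, hf, hg, add_zero]
      | single h r =>
        rw [dPr_single]
        split_ifs with h1
        · rw [dPr_single, if_neg (by rw [h1]; exact hyz.symm)]
        · simp)
    (fun ξ => by
      induction ξ using Finsupp.induction_linear with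
      | zero => simp
      | add f g hf hg => simp only [map_add, Finset.sum_add_distrib, hf, hg]
      | single h r => classical simp [dPr_single])
    (R.dActLin k)
    (fun ξ => by
      induction ξ using Finsupp.induction_linear with
      | zero => simp
      | add f g hf hg => rw [map_add, hf, hg]
      | single h r => rw [dActLin_single, dAct_one])
    (fun x z ξ => by
      induction ξ using Finsupp.induction_linear with
      | zero => simp
      | add f g hf hg => simp only [map_add, hf, hg]
      | single h r => rw [dActLin_single, dActLin_single, dActLin_single, dAct_mul])
    (fun x y ξ hξ => by
      rw [← hξ]
      generalize ξ = ζ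
      induction ζ using Finsupp.induction_linear with
      | zero => simp
      | add f g hf hg => simp only [map_add, hf, hg]
      | single h r =>
        rw [dPr_single]
        split_ifs with h1
        · rw [dActLin_single, dPr_single, dDeg_dAct, h1, if_pos rfl]
        · simp)

/-- The object `D` of `𝒟`, with basis `δ_y ⊗ x` for `y ∈ Y = X` and `x ∈ X`, degrees
`y ∘ ‖δ_y ⊗ x‖ = x⁻¹ y x` and `X`-action
`(δ_y ⊗ x) ◁ z = δ_{y ◁ (a ▷ z)} ⊗ (a ▷ z)⁻¹ x z`, `a = ‖δ_y ⊗ x‖`. -/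
noncomputable def D : DCat R k := ⟨X × X →₀ k, R.dStr k⟩

/-- The basis of `D`. -/
noncomputable def basisD : Module.Basis (X × X) k (D R k).carrier :=
  Module.Basis.ofRepr (LinearEquiv.refl k (X × X →₀ k))

/-- The basis element `δ_y ⊗ x` of `D`. -/
noncomputable def δ (y x : X) : (D R k).carrier := basisD R k (y, x)

/-- `‖h₍₂₎‖ = |h|⁻¹ z⁻¹ |h| x⁻¹ z x` for `h = δ_y ⊗ x`, in the summand `z` of `Δ(h)`. -/
noncomputable def comulDeg₂ (h : X × X) (z : X) : X :=
  (R.abv (R.dDeg h) : X)⁻¹ * z⁻¹ * R.abv (R.dDeg h) * h.2⁻¹ * z * h.2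

/-- `‖h₍₁₎‖ = |h₍₂₎| ‖h‖ ⟨h₍₂₎⟩⁻¹`, in the summand `z` of `Δ(h)`. -/
noncomputable def comulDeg₁ (h : X × X) (z : X) : X :=
  R.abv (comulDeg₂ R h z) * R.dDeg h * (R.ang (comulDeg₂ R h z) : X)⁻¹

/-- `δ_{w ◁ c⁻¹} ⊗ c x ⟨h₍₂₎⟩⁻¹` with `c = |h₍₁₎| |h₍₂₎| |h|⁻¹` and `z w = y`, for `h = δ_y ⊗ x`. -/
noncomputable def comulLeft (h : X × X) (z : X) : (D R k).carrier :=
  let c : X := R.abv (comulDeg₁ R h z) * R.abv (comulDeg₂ R h z) * (R.abv (R.dDeg h) : X)⁻¹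
  δ R k (c * (z⁻¹ * h.1) * c⁻¹) (c * h.2 * (R.ang (comulDeg₂ R h z) : X)⁻¹)

/-- `δ_{z ◁ c⁻¹} ⊗ c x` with `c = |h₍₂₎| |h|⁻¹`, for `h = δ_y ⊗ x`. -/
noncomputable def comulRight (h : X × X) (z : X) : (D R k).carrier :=
  let c : X := R.abv (comulDeg₂ R h z) * (R.abv (R.dDeg h) : X)⁻¹
  δ R k (c * z * c⁻¹) (c * h.2)

variable {R k}

lemma basisD_eq (h : X × X) : (basisD R k h : X × X →₀ k) = Finsupp.single h 1 := rfl

lemma pr_δ (y x : X) : (D R k).str.pr (R.dDeg (y, x)) (δ R k y x) = δ R k y x := by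
  classical
  exact (R.dPr_single k _ (y, x) 1).trans (if_pos rfl)

lemma act_δ (y x z : X) : (D R k).str.act z (δ R k y x) =
    δ R k (R.dAct z (y, x)).1 (R.dAct z (y, x)).2 := by
  have h : (R.dStr k).act = R.dActLin k := Str.act_ofAct _ _ _ _ _ _ _ _
  exact (LinearMap.congr_fun (congrFun h z) _).trans (R.dActLin_single k z (y, x) 1)

end DoubleAlgebra

namespace Str

variable {X : Type u} [Group X] [Fintype X] {R : CosetReps X} {k : Type u} [Field k]
  {V : Type u} [AddCommGroup V] [Module k V]

/-- The canonical action `ξ ◁ (δ_y ⊗ x) = δ_{y,‖ξ‖} ξ ◁ x` of `D`, as a bilinear map. -/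
noncomputable def canAct (σ : Str R k V) : V →ₗ[k] (D R k).carrier →ₗ[k] V :=
  LinearMap.flip ((basisD R k).constr k fun h => σ.act h.2 ∘ₗ σ.pr h.1)

lemma canAct_δ (σ : Str R k V) (ξ : V) (y x : X) :
    σ.canAct ξ (δ R k y x) = σ.act x (σ.pr y ξ) := by
  rw [canAct, LinearMap.flip_apply, δ, Module.Basis.constr_basis]
  rfl

end Str

namespace DCat

variable {X : Type u} [Group X] [Fintype X] {R : CosetReps X} {k : Type u} [Field k]

lemma ext_D {V : DCat R k} {U : Type u} [AddCommGroup U] [Module k U]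
    {f g : V.carrier ⊗[k] (D R k).carrier →ₗ[k] U}
    (H : ∀ a ξ (y x : X), V.str.pr a ξ = ξ → f (ξ ⊗ₜ δ R k y x) = g (ξ ⊗ₜ δ R k y x)) :
    f = g := by
  refine TensorProduct.ext (V.str.ext_homog fun a ξ ha => ?_)
  exact (basisD R k).ext fun h => H a ξ h.1 h.2 ha

/-- The canonical action `V ⊗ D ⟶ V` of `D` on an object of `𝒟`. -/
noncomputable def canAct (V : DCat R k) : V ⊗ D R k ⟶ V :=
  homOfAct (V := V ⊗ D R k) (W := V) (TensorProduct.lift V.str.canAct)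
    (fun w => by
      refine ext_D fun a ξ y x ha => ?_
      have key : V.str.pr (R.circ a (R.dDeg (y, x)))
          (TensorProduct.lift V.str.canAct (ξ ⊗ₜ δ R k y x)) =
          TensorProduct.lift V.str.canAct (ξ ⊗ₜ δ R k y x) := by
        rw [TensorProduct.lift.tmul, Str.canAct_δ]
        by_cases hy : y = a
        · rw [hy, ha, R.circ_dDeg (a, x), V.str.act_deg _ ha]
        · rw [V.str.pr_of_ne ha hy, map_zero, map_zero]
      exact pr_eq_of_homog (V := ⟨_, Str.tensor V.str (D R k).str⟩) (W := V) _
        (Str.pr_tensor_tmul ha (pr_δ y x)) key w)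
    (fun z => by
      refine ext_D fun a ξ y x ha => ?_
      have key : V.str.act z (TensorProduct.lift V.str.canAct (ξ ⊗ₜ δ R k y x)) =
          TensorProduct.lift V.str.canAct ((Str.tensor V.str (D R k).str).act z
            (ξ ⊗ₜ δ R k y x)) := by
        rw [Str.act_tensor_tmul _ _ (pr_δ y x), act_δ, TensorProduct.lift.tmul,
          TensorProduct.lift.tmul, Str.canAct_δ, Str.canAct_δ]
        simp only [dAct]
        by_cases hy : y = a
        · rw [hy, ha, V.str.act_deg _ ha, ← Str.act_mul, ← Str.act_mul]
          congr 2
          group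
        · rw [V.str.pr_of_ne ha hy, V.str.pr_of_ne (V.str.act_deg _ ha), map_zero, map_zero,
            map_zero]
          intro h'
          exact hy (mul_left_cancel (mul_right_cancel h'))
      exact key)

@[simp] lemma lin_canAct (V : DCat R k) : lin (canAct V) = TensorProduct.lift V.str.canAct := rfl

variable (R k)

/-- `m` is the product on `D` consistent with the action: for all objects `V`, acting by `D` twice
is, after the associator, acting by the product. -/
def IsProduct (m : D R k ⊗ D R k ⟶ D R k) : Prop :=
  ∀ V : DCat R k, canAct V ▷ D R k ≫ canAct V = (α_ V (D R k) (D R k)).hom ≫ V ◁ m ≫ canAct V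

/-- `i` is the identity of `D`: it acts trivially on all objects. -/
def IsIdentity (i : 𝟙_ (DCat R k) ⟶ D R k) : Prop :=
  ∀ V : DCat R k, V ◁ i ≫ canAct V = (ρ_ V).hom

/-- `d` is the coproduct on `D` consistent with the tensor products of `𝒟`: the action of `D` on
`V ⊗ W` is obtained by applying `d`, braiding (with the associators understood) and acting on `V`
and `W`. -/
def IsCoproduct (d : D R k ⟶ D R k ⊗ D R k) : Prop :=
  ∀ V W : DCat R k, canAct (V ⊗ W) =
    (V ⊗ W) ◁ d ≫ (α_ V W (D R k ⊗ D R k)).hom ≫ V ◁ (α_ W (D R k) (D R k)).inv ≫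
      V ◁ ((β_ W (D R k)).hom ▷ D R k) ≫ V ◁ (α_ (D R k) W (D R k)).hom ≫
        (α_ V (D R k) (W ⊗ D R k)).inv ≫ (canAct V ⊗ₘ canAct W)

/-- `c` is the counit of `D`: the action of `D` on the unit object is multiplication by `c`. -/
def IsCounit (c : D R k ⟶ 𝟙_ (DCat R k)) : Prop :=
  canAct (𝟙_ (DCat R k)) = (λ_ (D R k)).hom ≫ c

/-- `s` is the antipode of `D` in the diagrammatic sense: for all objects `V` the map
`ξ ⊗ h ↦ ξ ◁ s(h)` is the composite of `coev_V ⊗ Ψ⁻¹`, the associators, the action of `D` on `V'`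
and `ev_V`. -/
def IsAntipode (s : D R k ⟶ D R k) : Prop :=
  ∀ V : DCat R k, V ◁ s ≫ canAct V =
    (λ_ (V ⊗ D R k)).inv ≫ (coev V ⊗ₘ (β_ (D R k) V).inv) ≫
      (α_ V V.dual (D R k ⊗ V)).hom ≫ V ◁ (α_ V.dual (D R k) V).inv ≫
        V ◁ (canAct V.dual ▷ V) ≫ V ◁ ev V ≫ (ρ_ V).hom

variable {R k}

/-- A representation of `D`, with product `m` and identity `i`, on a vector space `V`: `i` acts as
the identity, `ξ ◁ x := ξ ◁ ∑ δ_y ⊗ x` is an action of `X`, and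
`(ξ ◁ h) ◁ h' = (ξ ◁ τ(‖h‖,‖h'‖)) ◁ (h h')` for homogeneous `h`, `h'`. -/
structure IsRep (m : D R k ⊗ D R k ⟶ D R k) (i : 𝟙_ (DCat R k) ⟶ D R k)
    {V : Type u} [AddCommGroup V] [Module k V] (r : V →ₗ[k] (D R k).carrier →ₗ[k] V) : Prop where
  one : ∀ ξ, r ξ (lin i (1 : k)) = ξ
  act_mul : ∀ x z ξ, r ξ (∑ y, δ R k y (x * z)) = r (r ξ (∑ y, δ R k y x)) (∑ y, δ R k y z)
  mul : ∀ a b h h' ξ, (D R k).str.pr a h = h → (D R k).str.pr b h' = h' →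
    r (r ξ h) h' = r (r ξ (∑ y, δ R k y (R.ttau a b))) (lin m (h ⊗ₜ[k] h'))

end DCat

end CosetReps

/-! The two gradings and two actions of an object amount to one `X`-grading and one right `X`-action
with `‖ξ ◁ x‖ = x⁻¹ ‖ξ‖ x`, and `δ_y ⊗ x` acts as the projection to degree `y` followed by `x`. The
structure maps of `D` are forced by this: each is found by computing how composition, the unit
object, tensor products and duals act on homogeneous elements. The factors `τ` in the formulas
compensate for the associator of `𝒟`.

Uniqueness rests on faithfulness. In the object `reg`, with basis `(a, g)`, the coordinate `g`
records which group element has acted, so an element of `D` can be read off from its action on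
`reg`. The same holds for `D ⊗ D` acting on `reg ⊗ reg`, because a pair of basis elements is
recovered from the degrees of its arguments and the two elements of `X` by which it acts
(`PairMatched.unique`). Hence a morphism into `D` or `D ⊗ D` is determined by the action it induces
(`hom_eq_of_canAct`, `hom_eq_of_pairAct`). This characterises product, identity, coproduct and
antipode by their diagrams; the counit is determined by cancelling a unitor.

Faithfulness also yields the compatibility of product and coproduct (`mulHom_comulHom`) without any
calculation on basis elements: both sides induce the same action on `reg ⊗ reg`. The other Hopf
axioms are checked on indices. `Δ` runs over the factorisations `z w = y` of the label,
coassociativity compares two ways to reach a triple factorisation, and `ttau_cocycle` absorbs the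
associators. In the antipode axioms every term vanishes unless `y = e`, and in that case the terms
add up to the identity of `D`.

For representations, the elements `δ_y ⊗ e` are orthogonal idempotents of degree `e` and act as
projections to homogeneous components, while `∑ δ_y ⊗ x` acts as `x`. Grading and `X`-action, hence
the whole object structure, can therefore be recovered from the action of `D` (`DCat.IsRep.str`,
`canAct_injective`). -/

namespace CosetReps

/-! ### Degrees of basis elements of `D`, and of their products and antipodes. -/

section DegreeIdentities

variable {X : Type u} [Group X] (R : CosetReps X)

lemma dDeg_eq_of_circ {y x a : X} (h : R.circ y a = x⁻¹ * y * x) : R.dDeg (y, x) = a :=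
  (R.ydiv_unique _ _ _ h).symm

lemma circ_dDeg_mk (y x : X) : R.circ y (R.dDeg (y, x)) = x⁻¹ * y * x := R.circ_dDeg (y, x)

lemma dDeg_one_right (y : X) : R.dDeg (y, 1) = 1 :=
  R.dDeg_eq_of_circ (by rw [circ_one_right]; group)

lemma dDeg_one_left (x : X) : R.dDeg (1, x) = 1 :=
  R.dDeg_eq_of_circ (by rw [circ_one_right]; group)

lemma dAct_mk (z y x : X) : R.dAct z (y, x) = ((R.tri (R.dDeg (y, x)) z)⁻¹ * y *
    R.tri (R.dDeg (y, x)) z, (R.tri (R.dDeg (y, x)) z)⁻¹ * x * z) := rfl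

/-- Two defining equations compose to `(y ∘ a) ∘ b = (x z)⁻¹ y (x z)`. Reassociating `∘` costs a
conjugation of `y` by `τ(a, b)`, which is the twist in the product of `D`. -/
lemma dDeg_mul (y x z : X) {a b : X} (ha : R.dDeg (y, x) = a)
    (hb : R.dDeg (x⁻¹ * y * x, z) = b) :
    R.dDeg ((R.ttau a b : X)⁻¹ * y * R.ttau a b, (R.ttau a b : X)⁻¹ * x * z) = R.circ a b := by
  refine R.dDeg_eq_of_circ ?_
  have h1 := R.circ_dDeg_mk y x
  have h2 := R.circ_dDeg_mk (x⁻¹ * y * x) z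
  rw [ha] at h1
  rw [hb] at h2
  rw [← circ_assoc, h1, h2]
  group

lemma eq_circ_abv {y x a : X} (h : R.dDeg (y, x) = a) :
    (R.abv a : X)⁻¹ * y * R.mp a = x⁻¹ * y * x := by
  rw [← gp_inv_eq_abv, ← h, ← circ_dDeg_mk, circ]

/-- The label of `S(δ_y ⊗ x)` in terms of `x⁻¹ y x`. -/
lemma inv_mul_abv_mul (y x : X) {a : X} (h : R.dDeg (y, x) = a) :
    y⁻¹ * R.abv a * (R.mp a : X)⁻¹ = R.mp a * (x⁻¹ * y⁻¹ * x) * (R.mp a : X)⁻¹ := by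
  have h1 := congrArg (fun t => t⁻¹) (R.eq_circ_abv h)
  simp only [mul_inv_rev, inv_inv] at h1
  rw [mul_left_inj, ← inv_mul_eq_iff_eq_mul, h1]
  group

/-- With the second form of the label from `inv_mul_abv_mul`, both sides of the equation defining
the degree reduce to `|a|⁻¹ y⁻¹ |a|`. So `S` preserves degrees. -/
lemma dDeg_antipode (y x : X) {a : X} (h : R.dDeg (y, x) = a) :
    R.dDeg (y⁻¹ * R.abv a * (R.mp a : X)⁻¹, R.mp a * x⁻¹ * R.abv a) = a := by
  refine R.dDeg_eq_of_circ ?_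
  rw [circ, gp_inv_eq_abv]
  conv_rhs => rw [R.inv_mul_abv_mul y x h]
  have h1 := congrArg (fun t => t⁻¹) (R.eq_circ_abv h)
  simp only [mul_inv_rev, inv_inv] at h1
  group

/-- Under conjugation by `t` both `|a|` and `⟨a⟩` (see `mp_conj`) are multiplied by `(a ▷ t)⁻¹` on
the left and by `t` on the right. This common rule makes the formulas for `S` and `Δ` equivariant.
-/
lemma abv_conj (a t : X) : (R.abv (t⁻¹ * a * t) : X) = (R.tri a t)⁻¹ * R.abv a * t := by
  rw [mul_assoc _ (R.abv a : X), eq_inv_mul_iff_mul_eq, tri_mul_abv]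

lemma mp_conj (a t : X) : (R.mp (t⁻¹ * a * t) : X) = (R.tri a t)⁻¹ * R.mp a * t := by
  rw [tri]; group

lemma dAct_antipode (y x t : X) {a : X} (h : R.dDeg (y, x) = a) :
    R.dAct t (y⁻¹ * R.abv a * (R.mp a : X)⁻¹, R.mp a * x⁻¹ * R.abv a) =
      (((R.tri a t)⁻¹ * y * R.tri a t)⁻¹ * R.abv (t⁻¹ * a * t) * (R.mp (t⁻¹ * a * t) : X)⁻¹,
        R.mp (t⁻¹ * a * t) * ((R.tri a t)⁻¹ * x * t)⁻¹ * R.abv (t⁻¹ * a * t)) := by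
  rw [dAct_mk, R.dDeg_antipode y x h]
  rw [abv_conj, mp_conj]
  ext <;> dsimp only <;> group

end DegreeIdentities

/-! ### The product, identity, counit and antipode of `D`. -/

section Structure

variable {X : Type u} [Group X] [Fintype X] (R : CosetReps X) (k : Type u) [Field k]

variable {R k} in
/-- A morphism from `D` is a linear map compatible with degrees and actions on the basis. -/
noncomputable def homOfBasis {W : DCat R k} (f : (D R k).carrier →ₗ[k] W.carrier)
    (hpr : ∀ y x, W.str.pr (R.dDeg (y, x)) (f (δ R k y x)) = f (δ R k y x))
    (hact : ∀ t y x, W.str.act t (f (δ R k y x)) =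
      f (δ R k (R.dAct t (y, x)).1 (R.dAct t (y, x)).2)) : D R k ⟶ W :=
  DCat.homOfAct f
    (fun w => (basisD R k).ext fun h => DCat.pr_eq_of_homog f (pr_δ h.1 h.2) (hpr h.1 h.2) w)
    (fun t => (basisD R k).ext fun h => by
      refine (hact t h.1 h.2).trans ?_
      rw [← act_δ]
      rfl)

variable {R k} in
lemma ext_δ {U : Type u} [AddCommGroup U] [Module k U] {f g : (D R k).carrier →ₗ[k] U}
    (h : ∀ y x, f (δ R k y x) = g (δ R k y x)) : f = g :=
  (basisD R k).ext fun p => h p.1 p.2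

variable {R k} in
lemma ext_δ_tmul {U : Type u} [AddCommGroup U] [Module k U]
    {f g : (D R k).carrier ⊗[k] (D R k).carrier →ₗ[k] U}
    (h : ∀ y x w z, f (δ R k y x ⊗ₜ δ R k w z) = g (δ R k y x ⊗ₜ δ R k w z)) : f = g :=
  TensorProduct.ext (ext_δ fun y x => ext_δ fun w z => h y x w z)

/-- The linear map `D → U` with prescribed values on the basis. -/
noncomputable def linD {U : Type u} [AddCommGroup U] [Module k U] (F : X → X → U) :
    (D R k).carrier →ₗ[k] U := (basisD R k).constr k fun h => F h.1 h.2

variable {R k} in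
@[simp] lemma linD_δ {U : Type u} [AddCommGroup U] [Module k U] (F : X → X → U) (y x : X) :
    linD R k F (δ R k y x) = F y x := by
  rw [linD, δ, Module.Basis.constr_basis]

variable {R k} in
lemma pr_δ_of_eq {y x a : X} (h : R.dDeg (y, x) = a) :
    (D R k).str.pr a (δ R k y x) = δ R k y x := h ▸ pr_δ y x

/-- The identity of `D`. -/
noncomputable def oneD : (D R k).carrier := ∑ y : X, δ R k y 1

lemma pr_oneD : (D R k).str.pr 1 (oneD R k) = oneD R k := by
  rw [oneD, map_sum]
  exact Finset.sum_congr rfl fun y _ => pr_δ_of_eq (R.dDeg_one_right y)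

/-- Since `δ_y ⊗ e` has degree `e` and `e ▷ t = t`, the action only replaces `y` by `t⁻¹ y t`, which
permutes the summands. -/
lemma act_oneD (t : X) : (D R k).str.act t (oneD R k) = oneD R k := by
  rw [oneD, map_sum]
  refine Fintype.sum_equiv (MulAut.conj t⁻¹).toEquiv _ _ fun y => ?_
  rw [act_δ, dAct_mk, dDeg_one_right, tri_one_left]
  simp

/-- The identity of `D`, as a morphism. -/
noncomputable def oneHom : 𝟙_ (DCat R k) ⟶ D R k :=
  DCat.homOfAct (V := 𝟙_ (DCat R k)) (W := D R k) (LinearMap.toSpanSingleton k _ (oneD R k))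
    (fun v => by
      refine LinearMap.ext_ring ?_
      refine DCat.pr_eq_of_homog (V := ⟨_, Str.unit R k⟩) (W := D R k) _
        (Str.unit_pr_one 1) ?_ v
      rw [LinearMap.toSpanSingleton_apply, one_smul, pr_oneD])
    (fun t => by
      refine LinearMap.ext_ring ?_
      have h2 : (Str.unit R k).act t 1 = 1 := by rw [Str.unit_act]; rfl
      have key : (D R k).str.act t (LinearMap.toSpanSingleton k _ (oneD R k) 1) =
        LinearMap.toSpanSingleton k _ (oneD R k) ((Str.unit R k).act t 1) := by
        rw [h2, LinearMap.toSpanSingleton_apply, one_smul, act_oneD]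
      exact key)

lemma lin_oneHom : DCat.lin (oneHom R k) = LinearMap.toSpanSingleton k _ (oneD R k) := rfl

lemma lin_oneHom_one : DCat.lin (oneHom R k) (1 : k) = oneD R k := by
  rw [lin_oneHom]; exact one_smul k _

/-- The antipode of `D`, as a linear map. -/
noncomputable def antipodeLin : (D R k).carrier →ₗ[k] (D R k).carrier :=
  linD R k fun y x => δ R k (y⁻¹ * R.abv (R.dDeg (y, x)) * (R.ang (R.dDeg (y, x)) : X)⁻¹)
    (R.ang (R.dDeg (y, x)) * x⁻¹ * R.abv (R.dDeg (y, x)))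

lemma antipodeLin_δ (y x : X) : antipodeLin R k (δ R k y x) =
    δ R k (y⁻¹ * R.abv (R.dDeg (y, x)) * (R.ang (R.dDeg (y, x)) : X)⁻¹)
      (R.ang (R.dDeg (y, x)) * x⁻¹ * R.abv (R.dDeg (y, x))) := by
  rw [antipodeLin, linD_δ]

/-- The antipode of `D`. -/
noncomputable def antipodeHom : D R k ⟶ D R k :=
  homOfBasis (antipodeLin R k)
    (fun y x => by
      rw [antipodeLin_δ]
      exact pr_δ_of_eq (R.dDeg_antipode y x rfl))
    (fun t y x => by
      rw [antipodeLin_δ, antipodeLin_δ, act_δ]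
      have h := R.dAct_antipode y x t rfl
      have h' : R.dDeg ((R.dAct t (y, x)).1, (R.dAct t (y, x)).2) = t⁻¹ * R.dDeg (y, x) * t :=
        R.dDeg_dAct t (y, x)
      rw [h']
      exact congrArg (fun p : X × X => δ R k p.1 p.2) h)

variable [DecidableEq X]

/-- The product on `D`, as a linear map. -/
noncomputable def mulLin : (D R k).carrier ⊗[k] (D R k).carrier →ₗ[k] (D R k).carrier :=
  TensorProduct.lift (linD R k fun y x => linD R k fun w z =>
    if w = x⁻¹ * y * x then
      δ R k ((R.ttau (R.dDeg (y, x)) (R.dDeg (w, z)) : X)⁻¹ * y *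
          (R.ttau (R.dDeg (y, x)) (R.dDeg (w, z)) : X))
        ((R.ttau (R.dDeg (y, x)) (R.dDeg (w, z)) : X)⁻¹ * x * z)
    else 0)

variable {R k} in
lemma mulLin_tmul (y x w z : X) : mulLin R k (δ R k y x ⊗ₜ δ R k w z) =
    if w = x⁻¹ * y * x then
      δ R k ((R.ttau (R.dDeg (y, x)) (R.dDeg (w, z)) : X)⁻¹ * y *
          (R.ttau (R.dDeg (y, x)) (R.dDeg (w, z)) : X))
        ((R.ttau (R.dDeg (y, x)) (R.dDeg (w, z)) : X)⁻¹ * x * z)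
    else 0 := by
  rw [mulLin, TensorProduct.lift.tmul, linD_δ, linD_δ]

/-- The product on `D`. -/
noncomputable def mulHom : D R k ⊗ D R k ⟶ D R k :=
  DCat.homOfAct (V := D R k ⊗ D R k) (W := D R k) (mulLin R k)
    (fun v => by
      refine ext_δ_tmul fun y x w z => ?_
      refine DCat.pr_eq_of_homog (V := ⟨_, Str.tensor (D R k).str (D R k).str⟩) (W := D R k) _
        (Str.pr_tensor_tmul (pr_δ y x) (pr_δ w z)) ?_ v
      rw [mulLin_tmul]
      split_ifs with h
      · subst h
        exact pr_δ_of_eq (R.dDeg_mul y x z rfl rfl)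
      · rw [map_zero])
    (fun t => by
      refine ext_δ_tmul fun y x w z => ?_
      have key : (D R k).str.act t (mulLin R k (δ R k y x ⊗ₜ δ R k w z)) =
          mulLin R k ((Str.tensor (D R k).str (D R k).str).act t (δ R k y x ⊗ₜ δ R k w z)) := by
        rw [Str.act_tensor_tmul _ _ (pr_δ w z), act_δ, act_δ, mulLin_tmul, mulLin_tmul,
          R.dDeg_dAct, R.dDeg_dAct]
        -- The action conjugates both sides of the matching condition by the same element `‖δ_w ⊗ z‖
        -- ▷ t`, so matched and unmatched pairs stay such.
        by_cases h : w = x⁻¹ * y * x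
        · rw [if_pos h, if_pos, act_δ]
          · rw [dAct_mk, dAct_mk, dAct_mk, R.dDeg_mul y x z rfl (by rw [h]), tri_circ]
            congr 1 <;> dsimp only <;> group
          · rw [dAct_mk, dAct_mk, h]; dsimp only; group
        · rw [if_neg h, if_neg, map_zero]
          rw [dAct_mk, dAct_mk]; dsimp only
          intro h'
          apply h
          generalize R.tri (R.dDeg (w, z)) t = q at h'
          generalize R.tri (R.dDeg (y, x)) q = r at h'
          have := congrArg (fun s => q * s * q⁻¹) h'
          rw [show q * (q⁻¹ * w * q) * q⁻¹ = w by group] at this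
          rw [this]; group
      exact key)

@[simp] lemma lin_mulHom : DCat.lin (mulHom R k) = mulLin R k := rfl

/-- The counit of `D`, as a linear map. -/
noncomputable def counitLin : (D R k).carrier →ₗ[k] k :=
  linD R k fun y _ => if y = 1 then (1 : k) else 0

lemma counitLin_δ (y x : X) : counitLin R k (δ R k y x) = if y = 1 then (1 : k) else 0 := by
  rw [counitLin, linD_δ]

/-- The counit of `D`. -/
noncomputable def counitHom : D R k ⟶ 𝟙_ (DCat R k) :=
  homOfBasis (W := 𝟙_ (DCat R k)) (counitLin R k)
    (fun y x => by
      rw [counitLin_δ]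
      split_ifs with h
      · rw [h, dDeg_one_left]; exact Str.unit_pr_one 1
      · exact map_zero _)
    (fun t y x => by
      rw [counitLin_δ, counitLin_δ, dAct_mk]
      refine (LinearMap.congr_fun (Str.unit_act t) _).trans ?_
      rw [LinearMap.id_apply]
      congr 1
      generalize R.tri (R.dDeg (y, x)) t = q
      rw [eq_iff_iff, mul_eq_one_iff_eq_inv, inv_mul_eq_iff_eq_mul, mul_inv_cancel])

/-- `(h h') h'' = (h ◁ τ(‖h'‖, ‖h''‖)) (h' h'')`. -/
lemma mulLin_assoc : mulLin R k ∘ₗ TensorProduct.map (mulLin R k) LinearMap.id =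
    mulLin R k ∘ₗ TensorProduct.map LinearMap.id (mulLin R k) ∘ₗ
      Str.assocLin (D R k).str (D R k).str (D R k).str := by
  refine TensorProduct.ext (ext_δ_tmul fun y x w z => ext_δ fun v u => ?_)
  change mulLin R k (mulLin R k (δ R k y x ⊗ₜ δ R k w z) ⊗ₜ δ R k v u) =
    mulLin R k (TensorProduct.map LinearMap.id (mulLin R k)
      (Str.assocLin (D R k).str (D R k).str (D R k).str
        ((δ R k y x ⊗ₜ δ R k w z) ⊗ₜ δ R k v u)))
  rw [Str.assocLin_tmul _ (pr_δ w z) (pr_δ v u), TensorProduct.map_tmul, LinearMap.id_apply,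
    act_δ, mulLin_tmul, mulLin_tmul]
  -- Both sides vanish unless `w = x⁻¹ y x` and `v = z⁻¹ w z`.
  by_cases h1 : w = x⁻¹ * y * x
  · rw [if_pos h1, mulLin_tmul]
    have hd := R.dDeg_mul y x z rfl (b := R.dDeg (w, z)) (by rw [h1])
    by_cases h2 : v = z⁻¹ * w * z
    · rw [if_pos h2, mulLin_tmul, if_pos, if_pos, hd,
        R.dDeg_mul w z u rfl (b := R.dDeg (v, u)) (by rw [h2]), R.dDeg_dAct, dAct_mk]
      · dsimp only
        -- The two bracketings twist by `τ(a,b) τ(a∘b,c)` and by `(a ▷ τ(b,c)) τ(a ◁ τ(b,c), b∘c)`,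
        -- where `a`, `b`, `c` are the degrees of the factors; the cocycle identity says that these
        -- agree.
        have hc := R.ttau_cocycle (R.dDeg (y, x)) (R.dDeg (w, z)) (R.dDeg (v, u))
        rw [← eq_inv_mul_iff_mul_eq] at hc
        rw [hc]
        congr 1 <;> group
      · rw [dAct_mk, h1]; dsimp only; group
      · rw [h2, h1]; group
    · rw [if_neg h2, tmul_zero, map_zero, if_neg]
      intro h'; apply h2; rw [h', h1]; group
  · rw [if_neg h1, zero_tmul, map_zero]
    split_ifs with h2
    · rw [mulLin_tmul, if_neg]
      rw [dAct_mk]; dsimp only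
      generalize (R.ttau (R.dDeg (w, z)) (R.dDeg (v, u)) : X) = t
      generalize R.tri (R.dDeg (y, x)) t = q
      intro h'
      apply h1
      have := congrArg (fun s => t * s * t⁻¹) h'
      rw [show t * (t⁻¹ * w * t) * t⁻¹ = w by group] at this
      rw [this]; group
    · rw [tmul_zero, map_zero]

/-- The factors `δ_y ⊗ e` have degree `e`, so no twist occurs, and the matching condition selects
the single summand `y = w`. -/
lemma mulLin_oneD_left (h : (D R k).carrier) : mulLin R k (oneD R k ⊗ₜ h) = h := by
  suffices mulLin R k ∘ₗ TensorProduct.mk k _ _ (oneD R k) = LinearMap.id from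
    LinearMap.congr_fun this h
  refine ext_δ fun w z => ?_
  rw [LinearMap.comp_apply, TensorProduct.mk_apply, oneD, TensorProduct.sum_tmul, map_sum]
  simp only [mulLin_tmul, dDeg_one_right, ttau_one_left]
  simp

lemma mulLin_oneD_right (h : (D R k).carrier) : mulLin R k (h ⊗ₜ oneD R k) = h := by
  suffices mulLin R k ∘ₗ (TensorProduct.mk k _ _).flip (oneD R k) = LinearMap.id from
    LinearMap.congr_fun this h
  refine ext_δ fun w z => ?_
  rw [LinearMap.comp_apply, LinearMap.flip_apply, TensorProduct.mk_apply, oneD,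
    TensorProduct.tmul_sum, map_sum]
  simp only [mulLin_tmul, dDeg_one_right, ttau_one_right]
  simp

/-- The algebra `D`. -/
noncomputable abbrev monObjD : MonObj (D R k) where
  one := oneHom R k
  mul := mulHom R k
  one_mul := DCat.lin_injective (by
    refine TensorProduct.ext (LinearMap.ext_ring ?_)
    ext1 h
    change mulLin R k ((LinearMap.toSpanSingleton k _ (oneD R k) 1) ⊗ₜ h) =
      TensorProduct.lid k _ ((1 : k) ⊗ₜ h)
    rw [LinearMap.toSpanSingleton_apply, one_smul, mulLin_oneD_left, TensorProduct.lid_tmul,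
      one_smul])
  mul_one := DCat.lin_injective (by
    refine TensorProduct.ext (LinearMap.ext fun h => LinearMap.ext_ring ?_)
    change mulLin R k (h ⊗ₜ (LinearMap.toSpanSingleton k _ (oneD R k) 1)) =
      TensorProduct.rid k _ (h ⊗ₜ (1 : k))
    rw [LinearMap.toSpanSingleton_apply, one_smul, mulLin_oneD_right, TensorProduct.rid_tmul,
      one_smul])
  mul_assoc := DCat.lin_injective (mulLin_assoc R k)

end Structure

/-! ### Identities between the indices occurring in the coproduct and the antipode. -/

section ComulIdentities

variable {X : Type u} [Group X] (R : CosetReps X)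

lemma coe_eq_abv_inv_mul_mp (b : X) : (R.abv b : X)⁻¹ * R.mp b = b := R.abv_ang b

lemma mp_eq_abv_mul (b : X) : (R.mp b : X) = R.abv b * b := by
  rw [eq_comm, ← eq_inv_mul_iff_mul_eq, coe_eq_abv_inv_mul_mp]

/-- The formula for `‖h₍₁₎‖` is the solution of `‖h₍₁₎‖ ∘ ‖h₍₂₎‖ = ‖h‖`, as is required for `Δ` to
preserve degrees. -/
lemma circ_comulDeg (h : X × X) (z : X) :
    R.circ (comulDeg₁ R h z) (comulDeg₂ R h z) = R.dDeg h := by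
  rw [circ, comulDeg₁, gp_inv_eq_abv, ang]; group

/-- The index of the first factor of the summand `z` of `Δ(δ_y ⊗ x)`. -/
noncomputable def comulIdx₁ (h : X × X) (z : X) : X × X :=
  let c : X := R.ttau (comulDeg₁ R h z) (comulDeg₂ R h z)
  (c * (z⁻¹ * h.1) * c⁻¹, c * h.2 * (R.mp (comulDeg₂ R h z) : X)⁻¹)

/-- The index of the second factor of the summand `z` of `Δ(δ_y ⊗ x)`. -/
noncomputable def comulIdx₂ (h : X × X) (z : X) : X × X :=
  let c : X := R.abv (comulDeg₂ R h z) * (R.abv (R.dDeg h) : X)⁻¹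
  (c * z * c⁻¹, c * h.2)

/-- Follows from `τ(b,c) |b∘c| = |b| |c|`. It identifies the coefficient in the explicit first
factor of `Δ` as an associator twist. -/
lemma ttau_comulDeg (h : X × X) (z : X) :
    (R.ttau (comulDeg₁ R h z) (comulDeg₂ R h z) : X) =
      R.abv (comulDeg₁ R h z) * R.abv (comulDeg₂ R h z) * (R.abv (R.dDeg h) : X)⁻¹ := by
  rw [eq_mul_inv_iff_mul_eq, ← ttau_mul_abv, circ_comulDeg]

lemma comulLeft_eq [Fintype X] (k : Type u) [Field k] (h : X × X) (z : X) :
    comulLeft R k h z = basisD R k (R.comulIdx₁ h z) := by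
  rw [comulLeft, comulIdx₁, ttau_comulDeg]; rfl

lemma comulRight_eq [Fintype X] (k : Type u) [Field k] (h : X × X) (z : X) :
    comulRight R k h z = basisD R k (R.comulIdx₂ h z) := rfl

/-- `|a|⁻¹ y |a| a = x⁻¹ y x` for `a = ‖δ_y ⊗ x‖`. -/
lemma abv_inv_mul_mul_dDeg (h : X × X) :
    (R.abv (R.dDeg h) : X)⁻¹ * h.1 * R.abv (R.dDeg h) * R.dDeg h = h.2⁻¹ * h.1 * h.2 := by
  rw [← circ_eq_abv, circ_dDeg]

/-- For the label `c z c⁻¹` with `c = |h₍₂₎| |h|⁻¹`, the defining equation of the degree reads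
`|h|⁻¹ z |h| ‖h₍₂₎‖ = x⁻¹ z x`, which is solved by `comulDeg₂`. -/
lemma dDeg_comulIdx₂ (h : X × X) (z : X) : R.dDeg (R.comulIdx₂ h z) = comulDeg₂ R h z := by
  refine R.dDeg_eq_of_circ ?_
  rw [circ_eq_abv]
  generalize hb : (R.abv (comulDeg₂ R h z) : X) = b
  rw [comulDeg₂]
  group

lemma dDeg_comulIdx₁ (h : X × X) (z : X) : R.dDeg (R.comulIdx₁ h z) = comulDeg₁ R h z := by
  refine R.dDeg_eq_of_circ ?_
  rw [circ_eq_abv, ttau_comulDeg]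
  -- Expressing `‖h‖` through `|h|`, `x` and `y` removes the only remaining relation, so that the
  -- goal becomes an identity in a free group.
  have h1 : (R.dDeg h) = (R.abv (R.dDeg h) : X)⁻¹ * h.1⁻¹ * (R.abv (R.dDeg h) : X) *
      (h.2⁻¹ * h.1 * h.2) := by
    rw [← R.abv_inv_mul_mul_dDeg h]; group
  have h2 : (R.abv (comulDeg₂ R h z) : X) = R.mp (comulDeg₂ R h z) * (comulDeg₂ R h z)⁻¹ :=
    R.coe_abv _
  generalize hb : (R.abv (comulDeg₁ R h z) : X) = b
  rw [comulDeg₁, h2, ang]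
  generalize (R.mp (comulDeg₂ R h z) : X) = m
  rw [comulDeg₂]
  generalize (R.abv (R.dDeg h) : X) = α at h1 ⊢
  rw [h1]
  group

/-- The label `y` is conjugated by `‖h‖ ▷ t` under the action of `t`, so its factorisations `z w =
y` must be conjugated in the same way. -/
lemma comulDeg₂_dAct (h : X × X) (z t : X) :
    comulDeg₂ R (R.dAct t h) ((R.tri (R.dDeg h) t)⁻¹ * z * R.tri (R.dDeg h) t) =
      t⁻¹ * comulDeg₂ R h z * t := by
  rw [comulDeg₂, comulDeg₂, dDeg_dAct, abv_conj, dAct]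
  group

lemma comulDeg₁_dAct (h : X × X) (z t : X) :
    comulDeg₁ R (R.dAct t h) ((R.tri (R.dDeg h) t)⁻¹ * z * R.tri (R.dDeg h) t) =
      (R.tri (comulDeg₂ R h z) t)⁻¹ * comulDeg₁ R h z * R.tri (comulDeg₂ R h z) t := by
  rw [comulDeg₁, comulDeg₁, comulDeg₂_dAct, dDeg_dAct, abv_conj, ang, mp_conj, ang]
  group

lemma comulIdx₂_dAct (h : X × X) (z t : X) :
    R.comulIdx₂ (R.dAct t h) ((R.tri (R.dDeg h) t)⁻¹ * z * R.tri (R.dDeg h) t) =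
      R.dAct t (R.comulIdx₂ h z) := by
  rw [dAct.eq_def R t (R.comulIdx₂ h z), dDeg_comulIdx₂]
  simp only [comulIdx₂, comulDeg₂_dAct, dDeg_dAct, abv_conj]
  rw [dAct]
  ext <;> dsimp only <;> group

/-- In a tensor product `t` acts on the first factor through `‖h₍₂₎‖ ▷ t`. The twist `τ(‖h₍₁₎‖,
‖h₍₂₎‖)` is carried along by `tri_circ`. -/
lemma comulIdx₁_dAct (h : X × X) (z t : X) :
    R.comulIdx₁ (R.dAct t h) ((R.tri (R.dDeg h) t)⁻¹ * z * R.tri (R.dDeg h) t) =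
      R.dAct (R.tri (comulDeg₂ R h z) t) (R.comulIdx₁ h z) := by
  rw [dAct.eq_def R _ (R.comulIdx₁ h z), dDeg_comulIdx₁]
  have h1 := R.tri_circ (comulDeg₁ R h z) (comulDeg₂ R h z) t
  rw [circ_comulDeg, mul_assoc, eq_inv_mul_iff_mul_eq, ← inv_mul_eq_iff_eq_mul] at h1
  simp only [comulIdx₁, comulDeg₂_dAct, comulDeg₁_dAct, mp_conj]
  rw [← h1, dAct]
  ext <;> dsimp only <;> group

/-- This lemma and the four after it compare two routes to the factorisation `y = z v (v⁻¹ z⁻¹ y)`: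
splitting at `z v` and then splitting the second factor at `z`, or splitting at `z` and then
splitting the first factor at `v`. The conjugations in the arguments account for the conjugated
labels in `comulIdx₁` and `comulIdx₂`. -/
lemma comulDeg₂_comulIdx₂ (h : X × X) (z v : X) :
    comulDeg₂ R (R.comulIdx₂ h (z * v))
      (R.abv (comulDeg₂ R h (z * v)) * (R.abv (R.dDeg h) : X)⁻¹ * z *
        (R.abv (comulDeg₂ R h (z * v)) * (R.abv (R.dDeg h) : X)⁻¹)⁻¹) = comulDeg₂ R h z := by
  rw [comulDeg₂, dDeg_comulIdx₂, comulIdx₂]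
  dsimp only
  generalize (R.abv (comulDeg₂ R h (z * v)) : X) = b
  rw [comulDeg₂]
  group

lemma comulDeg₁_comulIdx₂ (h : X × X) (z v : X) :
    comulDeg₁ R (R.comulIdx₂ h (z * v))
      (R.abv (comulDeg₂ R h (z * v)) * (R.abv (R.dDeg h) : X)⁻¹ * z *
        (R.abv (comulDeg₂ R h (z * v)) * (R.abv (R.dDeg h) : X)⁻¹)⁻¹) =
    comulDeg₂ R (R.comulIdx₁ h z)
      (R.ttau (comulDeg₁ R h z) (comulDeg₂ R h z) * v *
        (R.ttau (comulDeg₁ R h z) (comulDeg₂ R h z) : X)⁻¹) := by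
  rw [comulDeg₁, comulDeg₂_comulIdx₂, dDeg_comulIdx₂, comulDeg₂.eq_def R (R.comulIdx₁ h z),
    dDeg_comulIdx₁, comulIdx₁, ttau_comulDeg]
  dsimp only
  have h2 : (R.abv (comulDeg₂ R h z) : X) = R.mp (comulDeg₂ R h z) * (comulDeg₂ R h z)⁻¹ :=
    R.coe_abv _
  generalize hb : (R.abv (comulDeg₁ R h z) : X) = b
  rw [h2, ang]
  generalize (R.mp (comulDeg₂ R h z) : X) = m
  rw [comulDeg₂, comulDeg₂]
  group

lemma comulIdx₂_comulIdx₂ (h : X × X) (z v : X) :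
    R.comulIdx₂ (R.comulIdx₂ h (z * v))
      (R.abv (comulDeg₂ R h (z * v)) * (R.abv (R.dDeg h) : X)⁻¹ * z *
        (R.abv (comulDeg₂ R h (z * v)) * (R.abv (R.dDeg h) : X)⁻¹)⁻¹) = R.comulIdx₂ h z := by
  rw [comulIdx₂.eq_def R (R.comulIdx₂ h (z * v)), comulDeg₂_comulIdx₂, dDeg_comulIdx₂, comulIdx₂,
    comulIdx₂]
  ext <;> dsimp only <;> group

lemma comulIdx₁_comulIdx₂ (h : X × X) (z v : X) :
    R.comulIdx₁ (R.comulIdx₂ h (z * v))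
      (R.abv (comulDeg₂ R h (z * v)) * (R.abv (R.dDeg h) : X)⁻¹ * z *
        (R.abv (comulDeg₂ R h (z * v)) * (R.abv (R.dDeg h) : X)⁻¹)⁻¹) =
    R.comulIdx₂ (R.comulIdx₁ h z)
      (R.ttau (comulDeg₁ R h z) (comulDeg₂ R h z) * v *
        (R.ttau (comulDeg₁ R h z) (comulDeg₂ R h z) : X)⁻¹) := by
  rw [comulIdx₁, ttau_comulDeg, comulDeg₂_comulIdx₂, comulDeg₁_comulIdx₂, dDeg_comulIdx₂,
    comulIdx₂.eq_def R (R.comulIdx₁ h z), dDeg_comulIdx₁]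
  dsimp only
  generalize R.abv (comulDeg₂ R (R.comulIdx₁ h z) _) = b
  rw [comulIdx₂, comulIdx₁, ttau_comulDeg]
  ext <;> dsimp only <;> group

/-- The outermost action is the associator moving the leftmost of three factors. Its twist combines
with the two twists from the iterated coproduct by the cocycle identity. -/
lemma dAct_comulIdx₁_comulIdx₁ (h : X × X) (z v : X) :
    R.dAct (R.ttau (comulDeg₂ R (R.comulIdx₁ h z)
        (R.ttau (comulDeg₁ R h z) (comulDeg₂ R h z) * v *
          (R.ttau (comulDeg₁ R h z) (comulDeg₂ R h z) : X)⁻¹)) (comulDeg₂ R h z))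
      (R.comulIdx₁ (R.comulIdx₁ h z) (R.ttau (comulDeg₁ R h z) (comulDeg₂ R h z) * v *
        (R.ttau (comulDeg₁ R h z) (comulDeg₂ R h z) : X)⁻¹)) = R.comulIdx₁ h (z * v) := by
  have h12 := R.comulDeg₁_comulIdx₂ h z v
  have h22 := R.comulDeg₂_comulIdx₂ h z v
  have hcirc := R.circ_comulDeg (R.comulIdx₂ h (z * v))
    (R.abv (comulDeg₂ R h (z * v)) * (R.abv (R.dDeg h) : X)⁻¹ * z *
        (R.abv (comulDeg₂ R h (z * v)) * (R.abv (R.dDeg h) : X)⁻¹)⁻¹)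
  rw [h12, h22, dDeg_comulIdx₂] at hcirc
  have hd := R.dDeg_comulIdx₁ h z
  have hcirc' := R.circ_comulDeg (R.comulIdx₁ h z)
    (R.ttau (comulDeg₁ R h z) (comulDeg₂ R h z) * v *
        (R.ttau (comulDeg₁ R h z) (comulDeg₂ R h z) : X)⁻¹)
  rw [hd] at hcirc'
  clear h12 h22 hd
  rw [dAct, dDeg_comulIdx₁, comulIdx₁.eq_def R (R.comulIdx₁ h z)]
  set b12 := comulDeg₂ R (R.comulIdx₁ h z) (R.ttau (comulDeg₁ R h z) (comulDeg₂ R h z) * v *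
        (R.ttau (comulDeg₁ R h z) (comulDeg₂ R h z) : X)⁻¹)
  set b11 := comulDeg₁ R (R.comulIdx₁ h z) (R.ttau (comulDeg₁ R h z) (comulDeg₂ R h z) * v *
        (R.ttau (comulDeg₁ R h z) (comulDeg₂ R h z) : X)⁻¹)
  have hc := R.ttau_cocycle b11 b12 (comulDeg₂ R h z)
  rw [hcirc, hcirc'] at hc
  -- Both triple splittings have total degree `‖h‖`; after reassociating `∘`, the common right
  -- factor is cancelled.
  have hb : comulDeg₁ R h (z * v) =
      (R.ttau b12 (comulDeg₂ R h z) : X)⁻¹ * b11 * R.ttau b12 (comulDeg₂ R h z) := by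
    have h1 := R.circ_comulDeg h (z * v)
    rw [← R.circ_comulDeg h z, ← hcirc', circ_assoc, hcirc, circ, circ] at h1
    exact mul_left_cancel (mul_right_cancel h1)
  have hτ : (R.ttau b12 (comulDeg₂ R h z) : X) =
      R.mp b12 * R.mp (comulDeg₂ R h z) * (R.mp (comulDeg₂ R h (z * v)) : X)⁻¹ := by
    rw [← hcirc, mp_circ, ttau, coe_tau]
  rw [← hb, ← mul_inv_eq_iff_eq_mul] at hc
  rw [← hc, comulIdx₁, comulIdx₁]
  dsimp only
  rw [hτ]
  ext <;> dsimp only <;> group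

/-- Prepares the counit axioms: the counit on the first factor leaves only the summand `z = y`,
whose second factor is `h` itself. On the other side only `z = 1` survives. -/
lemma comulDeg₂_self (h : X × X) : comulDeg₂ R h h.1 = R.dDeg h := by
  have h1 := R.abv_inv_mul_mul_dDeg h
  rw [← eq_inv_mul_iff_mul_eq] at h1
  rw [comulDeg₂]
  conv_rhs => rw [h1]
  group

lemma comulIdx₂_self (h : X × X) : R.comulIdx₂ h h.1 = h := by
  rw [comulIdx₂, comulDeg₂_self, mul_inv_cancel]
  simp

lemma comulIdx₁_fst_eq_one_iff (h : X × X) (z : X) : (R.comulIdx₁ h z).1 = 1 ↔ z = h.1 := by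
  rw [comulIdx₁]
  simp only [mul_inv_eq_one, mul_eq_left, inv_mul_eq_one]

lemma comulIdx₂_fst_eq_one_iff (h : X × X) (z : X) : (R.comulIdx₂ h z).1 = 1 ↔ z = 1 := by
  rw [comulIdx₂]
  simp only [mul_inv_eq_one, mul_eq_left]

lemma comulDeg₂_one (h : X × X) : comulDeg₂ R h 1 = 1 := by
  rw [comulDeg₂]; group

lemma comulIdx₁_one (h : X × X) : R.comulIdx₁ h 1 = h := by
  rw [comulIdx₁, comulDeg₂_one, ttau_one_right]
  simp

lemma comulDeg₂_one_right (y z : X) : comulDeg₂ R (y, 1) z = 1 := by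
  rw [comulDeg₂, dDeg_one_right]; simp [abv]

lemma comulIdx₂_one_right (y z : X) : R.comulIdx₂ (y, 1) z = (z, 1) := by
  rw [comulIdx₂, comulDeg₂_one_right, dDeg_one_right]
  simp [abv]

lemma comulIdx₁_one_right (y z : X) : R.comulIdx₁ (y, 1) z = (z⁻¹ * y, 1) := by
  rw [comulIdx₁, comulDeg₂_one_right, ttau_one_right]
  simp

/-- The index of `S(δ_y ⊗ x)`. -/
noncomputable def antipodeIdx (h : X × X) : X × X :=
  (h.1⁻¹ * R.abv (R.dDeg h) * (R.mp (R.dDeg h) : X)⁻¹,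
    R.mp (R.dDeg h) * h.2⁻¹ * R.abv (R.dDeg h))

lemma dDeg_antipodeIdx (h : X × X) : R.dDeg (R.antipodeIdx h) = R.dDeg h :=
  R.dDeg_antipode h.1 h.2 rfl

lemma antipodeIdx_eq (h : X × X) : R.antipodeIdx h =
    (R.mp (R.dDeg h) * (h.2⁻¹ * h.1⁻¹ * h.2) * (R.mp (R.dDeg h) : X)⁻¹,
      R.mp (R.dDeg h) * h.2⁻¹ * R.abv (R.dDeg h)) := by
  rw [antipodeIdx]
  exact congrArg (·, _) (R.inv_mul_abv_mul h.1 h.2 rfl)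

/-- The index of the product of two basis elements of `D`, if it does not vanish. -/
noncomputable def mulIdx (h h' : X × X) : X × X :=
  ((R.ttau (R.dDeg h) (R.dDeg h') : X)⁻¹ * h.1 * R.ttau (R.dDeg h) (R.dDeg h'),
    (R.ttau (R.dDeg h) (R.dDeg h') : X)⁻¹ * h.2 * h'.2)

/-- Up to conjugation the two sides are `x⁻¹ z⁻¹ x` and `x⁻¹ z⁻¹ y x`. Hence `h₍₁₎ S(h₍₂₎)` has a
nonzero summand only for `y = e`, which is the source of `ε` in the antipode axiom. -/
lemma comul_antipode_matched_iff (h : X × X) (z : X) :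
    (R.antipodeIdx (R.comulIdx₂ h z)).1 =
      (R.comulIdx₁ h z).2⁻¹ * (R.comulIdx₁ h z).1 * (R.comulIdx₁ h z).2 ↔ h.1 = 1 := by
  rw [antipodeIdx_eq, dDeg_comulIdx₂, comulIdx₁, comulIdx₂]
  dsimp only
  generalize (R.mp (comulDeg₂ R h z) : X) = m
  generalize (R.ttau _ _ : X) = c
  generalize (R.abv (comulDeg₂ R h z) * (R.abv (R.dDeg h) : X)⁻¹ : X) = d
  constructor
  · intro h'
    have h1 : m * h.2⁻¹ * z⁻¹ * h.2 * m⁻¹ = m * h.2⁻¹ * z⁻¹ * (h.1 * (h.2 * m⁻¹)) := by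
      convert h' using 1 <;> group
    rw [mul_assoc, mul_right_inj, eq_comm, mul_eq_right] at h1
    exact h1
  · intro h'
    rw [h']; group

/-- For `y = e` the degree of `h` is trivial, and the twist of the product cancels the one in the
coproduct. As `z` varies, the results are the summands of the identity of `D`. -/
lemma mulIdx_comul_antipode (h : X × X) (z : X) (hy : h.1 = 1) :
    R.mulIdx (R.comulIdx₁ h z) (R.antipodeIdx (R.comulIdx₂ h z)) = (z⁻¹, 1) := by
  have ha : R.dDeg h = 1 := by
    rw [← Prod.mk.eta (p := h), hy, dDeg_one_left]
  rw [mulIdx, dDeg_antipodeIdx, dDeg_comulIdx₂, dDeg_comulIdx₁, antipodeIdx_eq, dDeg_comulIdx₂,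
    comulIdx₁, comulIdx₂]
  dsimp only
  rw [hy, ha]
  have h1 : (R.abv 1 : X) = 1 := by simp [abv]
  rw [h1]
  ext <;> dsimp only <;> group

lemma antipode_comul_matched_iff (h : X × X) (z : X) :
    (R.comulIdx₂ h z).1 = (R.antipodeIdx (R.comulIdx₁ h z)).2⁻¹ *
      (R.antipodeIdx (R.comulIdx₁ h z)).1 * (R.antipodeIdx (R.comulIdx₁ h z)).2 ↔ h.1 = 1 := by
  rw [antipodeIdx_eq, dDeg_comulIdx₁, comulIdx₁, comulIdx₂, ttau_comulDeg]
  dsimp only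
  generalize (R.mp (comulDeg₂ R h z) : X) = m
  generalize (R.mp (comulDeg₁ R h z) : X) = n
  generalize (R.abv (comulDeg₁ R h z) : X) = b
  generalize (R.abv (comulDeg₂ R h z) : X) = c
  generalize (R.abv (R.dDeg h) : X) = d
  constructor
  · intro h'
    have h1 : c * d⁻¹ * z * d * c⁻¹ = c * d⁻¹ * (h.1⁻¹ * (z * d * c⁻¹)) := by
      convert h' using 1 <;> group
    rw [mul_assoc, mul_assoc, mul_right_inj, mul_assoc, eq_comm, mul_eq_right, inv_eq_one] at h1
    exact h1
  · intro h'
    rw [h']; group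

lemma mulIdx_antipode_comul (h : X × X) (z : X) (hy : h.1 = 1) :
    R.mulIdx (R.antipodeIdx (R.comulIdx₁ h z)) (R.comulIdx₂ h z) = (h.2⁻¹ * z * h.2, 1) := by
  have ha : R.dDeg h = 1 := by
    rw [← Prod.mk.eta (p := h), hy, dDeg_one_left]
  have h1 : (R.abv 1 : X) = 1 := by simp [abv]
  -- Here `‖h₍₁₎‖ ∘ ‖h₍₂₎‖ = e`, so `⟨h₍₁₎⟩ ⟨h₍₂₎⟩` has trivial `M`-part and equals its `τ`.
  have h2 : (R.mp (comulDeg₁ R h z) : X) = R.ttau (comulDeg₁ R h z) (comulDeg₂ R h z) *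
      (R.mp (comulDeg₂ R h z) : X)⁻¹ := by
    have h3 := R.circ_comulDeg h z
    rw [ttau, coe_tau, ← mp_circ, h3, ha]
    simp
  rw [mulIdx, dDeg_antipodeIdx, dDeg_comulIdx₂, dDeg_comulIdx₁, antipodeIdx_eq, dDeg_comulIdx₁,
    comulIdx₁, comulIdx₂]
  dsimp only
  rw [h2, ttau_comulDeg, hy, ha, h1]
  ext <;> dsimp only <;> group

end ComulIdentities

/-! ### The coproduct as a morphism; coalgebra and antipode axioms on the basis. -/

section Comul

variable {X : Type u} [Group X] [Fintype X] (R : CosetReps X) (k : Type u) [Field k]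

variable {R k} in
lemma pr_basisD (h : X × X) : (D R k).str.pr (R.dDeg h) (basisD R k h) = basisD R k h :=
  pr_δ h.1 h.2

variable {R k} in
lemma act_basisD (t : X) (h : X × X) :
    (D R k).str.act t (basisD R k h) = basisD R k (R.dAct t h) := act_δ h.1 h.2 t

/-- The coproduct of `D`, as a linear map. -/
noncomputable def comulLin : (D R k).carrier →ₗ[k] (D R k).carrier ⊗[k] (D R k).carrier :=
  (basisD R k).constr k fun h =>
    ∑ z, basisD R k (R.comulIdx₁ h z) ⊗ₜ basisD R k (R.comulIdx₂ h z)

variable {R k} in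
lemma comulLin_basisD (h : X × X) : comulLin R k (basisD R k h) =
    ∑ z, basisD R k (R.comulIdx₁ h z) ⊗ₜ basisD R k (R.comulIdx₂ h z) := by
  rw [comulLin, Module.Basis.constr_basis]

variable {R k} in
lemma pr_comulIdx₁ (h : X × X) (z : X) :
    (D R k).str.pr (comulDeg₁ R h z) (basisD R k (R.comulIdx₁ h z)) =
      basisD R k (R.comulIdx₁ h z) := by
  rw [← dDeg_comulIdx₁, pr_basisD]

variable {R k} in
lemma pr_comulIdx₂ (h : X × X) (z : X) :
    (D R k).str.pr (comulDeg₂ R h z) (basisD R k (R.comulIdx₂ h z)) =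
      basisD R k (R.comulIdx₂ h z) := by
  rw [← dDeg_comulIdx₂, pr_basisD]

lemma pr_comulLin (h : X × X) :
    (Str.tensor (D R k).str (D R k).str).pr (R.dDeg h) (comulLin R k (basisD R k h)) =
      comulLin R k (basisD R k h) := by
  rw [comulLin_basisD, map_sum]
  refine Finset.sum_congr rfl fun z _ => ?_
  rw [← R.circ_comulDeg h z]
  exact Str.pr_tensor_tmul (pr_comulIdx₁ h z) (pr_comulIdx₂ h z)

lemma act_comulLin (t : X) (h : X × X) :
    (Str.tensor (D R k).str (D R k).str).act t (comulLin R k (basisD R k h)) =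
      comulLin R k (basisD R k (R.dAct t h)) := by
  rw [comulLin_basisD, comulLin_basisD, map_sum]
  -- The factorisations of the old and the new label correspond under conjugation by `‖h‖ ▷ t`.
  refine Fintype.sum_equiv (MulAut.conj (R.tri (R.dDeg h) t)⁻¹).toEquiv _ _ fun z => ?_
  rw [Str.act_tensor_tmul _ _ (pr_comulIdx₂ h z), act_basisD, act_basisD, ← comulIdx₂_dAct,
    ← comulIdx₁_dAct]
  simp

/-- The coproduct of `D`. -/
noncomputable def comulHom : D R k ⟶ D R k ⊗ D R k :=
  homOfBasis (W := D R k ⊗ D R k) (comulLin R k)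
    (fun y x => pr_comulLin R k (y, x))
    (fun t y x => act_comulLin R k t (y, x))

/-- Both sides are sums over triple factorisations of the label. Conjugating the inner summation
variable brings each into the form to which the index identities apply. -/
lemma comulLin_coassoc :
    TensorProduct.map LinearMap.id (comulLin R k) ∘ₗ comulLin R k =
      Str.assocLin (D R k).str (D R k).str (D R k).str ∘ₗ
        TensorProduct.map (comulLin R k) LinearMap.id ∘ₗ comulLin R k := by
  refine (basisD R k).ext fun h => ?_
  simp only [LinearMap.comp_apply, comulLin_basisD, map_sum, TensorProduct.map_tmul,
    LinearMap.id_apply, TensorProduct.sum_tmul, TensorProduct.tmul_sum]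
  have key : ∀ z v, Str.assocLin (D R k).str (D R k).str (D R k).str
      ((basisD R k (R.comulIdx₁ (R.comulIdx₁ h z) v) ⊗ₜ
        basisD R k (R.comulIdx₂ (R.comulIdx₁ h z) v)) ⊗ₜ basisD R k (R.comulIdx₂ h z)) =
      basisD R k (R.dAct (R.ttau (comulDeg₂ R (R.comulIdx₁ h z) v) (comulDeg₂ R h z))
        (R.comulIdx₁ (R.comulIdx₁ h z) v)) ⊗ₜ
        (basisD R k (R.comulIdx₂ (R.comulIdx₁ h z) v) ⊗ₜ basisD R k (R.comulIdx₂ h z)) := by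
    intro z v
    rw [Str.assocLin_tmul _ (pr_comulIdx₂ _ v) (pr_comulIdx₂ h z), act_basisD]
  simp only [key]
  have e1 : ∀ z, (∑ v, basisD R k (R.dAct (R.ttau (comulDeg₂ R (R.comulIdx₁ h z) v)
      (comulDeg₂ R h z)) (R.comulIdx₁ (R.comulIdx₁ h z) v)) ⊗ₜ[k]
        (basisD R k (R.comulIdx₂ (R.comulIdx₁ h z) v) ⊗ₜ[k] basisD R k (R.comulIdx₂ h z))) =
      ∑ v, (basisD R k (R.comulIdx₁ h (z * v))) ⊗ₜ[k]
        (basisD R k (R.comulIdx₂ (R.comulIdx₁ h z)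
          (R.ttau (comulDeg₁ R h z) (comulDeg₂ R h z) * v *
        (R.ttau (comulDeg₁ R h z) (comulDeg₂ R h z) : X)⁻¹)) ⊗ₜ[k]
          basisD R k (R.comulIdx₂ h z)) := by
    intro z
    refine (Fintype.sum_equiv
      (MulAut.conj (R.ttau (comulDeg₁ R h z) (comulDeg₂ R h z) : X)).toEquiv _ _ fun v => ?_).symm
    rw [← dAct_comulIdx₁_comulIdx₁]
    rfl
  have e2 : ∀ Z, (∑ v, basisD R k (R.comulIdx₁ h Z) ⊗ₜ[k]
      (basisD R k (R.comulIdx₁ (R.comulIdx₂ h Z) v) ⊗ₜ[k]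
        basisD R k (R.comulIdx₂ (R.comulIdx₂ h Z) v))) =
      ∑ z, basisD R k (R.comulIdx₁ h Z) ⊗ₜ[k]
      (basisD R k (R.comulIdx₁ (R.comulIdx₂ h Z)
        (R.abv (comulDeg₂ R h Z) * (R.abv (R.dDeg h) : X)⁻¹ * z *
        (R.abv (comulDeg₂ R h Z) * (R.abv (R.dDeg h) : X)⁻¹)⁻¹)) ⊗ₜ[k]
        basisD R k (R.comulIdx₂ (R.comulIdx₂ h Z)
        (R.abv (comulDeg₂ R h Z) * (R.abv (R.dDeg h) : X)⁻¹ * z *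
        (R.abv (comulDeg₂ R h Z) * (R.abv (R.dDeg h) : X)⁻¹)⁻¹))) := by
    intro Z
    refine (Fintype.sum_equiv
      (MulAut.conj (R.abv (comulDeg₂ R h Z) * (R.abv (R.dDeg h) : X)⁻¹)).toEquiv _ _
        fun v => ?_).symm
    rfl
  -- After exchanging the sums on one side, the remaining substitution is `Z = z v`, with `Z` the
  -- outer splitting point of that side.
  rw [Finset.sum_congr rfl fun z _ => e1 z, Finset.sum_congr rfl fun z _ => e2 z,
    Finset.sum_comm]
  refine Finset.sum_congr rfl fun z _ => ?_
  refine (Fintype.sum_equiv (Equiv.mulLeft z) _ _ fun v => ?_).symm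
  rw [Equiv.coe_mulLeft, comulIdx₂_comulIdx₂, comulIdx₁_comulIdx₂]

/-- All degrees are trivial here, so `Δ(δ_y ⊗ e)` is the untwisted sum of `(δ_{z⁻¹ y} ⊗ e) ⊗ (δ_z ⊗
e)`; summing over `y` makes the two labels independent. -/
lemma comulLin_oneD : comulLin R k (oneD R k) = oneD R k ⊗ₜ oneD R k := by
  have h1 : oneD R k = ∑ y, basisD R k (y, 1) := rfl
  rw [h1, map_sum, TensorProduct.sum_tmul]
  simp only [comulLin_basisD, comulIdx₁_one_right, comulIdx₂_one_right, TensorProduct.tmul_sum]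
  rw [Finset.sum_comm]
  conv_rhs => rw [Finset.sum_comm]
  exact Finset.sum_congr rfl fun z _ =>
    Fintype.sum_equiv (Equiv.mulLeft z⁻¹) _ _ fun y => rfl

variable {R k} in
lemma antipodeLin_basisD (h : X × X) :
    antipodeLin R k (basisD R k h) = basisD R k (R.antipodeIdx h) := antipodeLin_δ R k h.1 h.2

variable [DecidableEq X]

variable {R k} in
lemma counitLin_basisD (h : X × X) :
    counitLin R k (basisD R k h) = if h.1 = 1 then (1 : k) else 0 := counitLin_δ R k h.1 h.2

lemma counit_comulLin (h : (D R k).carrier) :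
    TensorProduct.lid k _ (TensorProduct.map (counitLin R k) LinearMap.id (comulLin R k h)) =
      h := by
  suffices (TensorProduct.lid k _).toLinearMap ∘ₗ
      TensorProduct.map (counitLin R k) LinearMap.id ∘ₗ comulLin R k = LinearMap.id from
    LinearMap.congr_fun this h
  refine (basisD R k).ext fun h => ?_
  simp only [LinearMap.comp_apply, comulLin_basisD, map_sum, TensorProduct.map_tmul,
    LinearMap.id_apply, counitLin_basisD, LinearEquiv.coe_coe, TensorProduct.lid_tmul]
  rw [Finset.sum_eq_single h.1]
  · rw [if_pos ((R.comulIdx₁_fst_eq_one_iff h _).2 rfl), one_smul, comulIdx₂_self]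
  · intro z _ hz
    rw [if_neg (mt (R.comulIdx₁_fst_eq_one_iff h z).1 hz), zero_smul]
  · simp

lemma comul_counitLin (h : (D R k).carrier) :
    TensorProduct.rid k _ (TensorProduct.map LinearMap.id (counitLin R k) (comulLin R k h)) =
      h := by
  suffices (TensorProduct.rid k _).toLinearMap ∘ₗ
      TensorProduct.map LinearMap.id (counitLin R k) ∘ₗ comulLin R k = LinearMap.id from
    LinearMap.congr_fun this h
  refine (basisD R k).ext fun h => ?_
  simp only [LinearMap.comp_apply, comulLin_basisD, map_sum, TensorProduct.map_tmul,
    LinearMap.id_apply, counitLin_basisD, LinearEquiv.coe_coe, TensorProduct.rid_tmul]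
  rw [Finset.sum_eq_single 1]
  · rw [if_pos ((R.comulIdx₂_fst_eq_one_iff h _).2 rfl), one_smul, comulIdx₁_one]
  · intro z _ hz
    rw [if_neg (mt (R.comulIdx₂_fst_eq_one_iff h z).1 hz), zero_smul]
  · simp

lemma counitLin_oneD : counitLin R k (oneD R k) = 1 := by
  rw [oneD, map_sum]
  simp [counitLin_δ]

/-- The product has a label conjugate to `y`, so `ε` sees it only for `y = e`; the matching
condition `w = x⁻¹ y x` then reads `w = e`. -/
lemma counitLin_mulLin (h h' : (D R k).carrier) :
    counitLin R k (mulLin R k (h ⊗ₜ h')) = counitLin R k h * counitLin R k h' := by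
  suffices counitLin R k ∘ₗ mulLin R k =
      LinearMap.mul' k k ∘ₗ TensorProduct.map (counitLin R k) (counitLin R k) from
    LinearMap.congr_fun this (h ⊗ₜ h')
  refine ext_δ_tmul fun y x w z => ?_
  simp only [LinearMap.comp_apply, TensorProduct.map_tmul, LinearMap.mul'_apply, counitLin_δ,
    mulLin_tmul, apply_ite (counitLin R k), map_zero]
  by_cases hy : y = 1
  · subst hy
    simp
  · rw [if_neg hy, zero_mul]
    refine (if_congr Iff.rfl (if_neg fun h' => hy ?_) rfl).trans (ite_self _)
    rwa [mul_assoc, inv_mul_eq_iff_eq_mul, mul_one, mul_eq_right] at h'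

variable {R k} in
lemma mulLin_basisD (h h' : X × X) : mulLin R k (basisD R k h ⊗ₜ basisD R k h') =
    if h'.1 = h.2⁻¹ * h.1 * h.2 then basisD R k (R.mulIdx h h') else 0 :=
  mulLin_tmul h.1 h.2 h'.1 h'.2

/-- For `y ≠ e` no summand is matched. For `y = e` the summand `z` contributes `δ_{z⁻¹} ⊗ e`, and
inversion reindexes the sum. -/
lemma antipode_right_lin (h : (D R k).carrier) :
    mulLin R k (TensorProduct.map LinearMap.id (antipodeLin R k) (comulLin R k h)) =
      counitLin R k h • oneD R k := by
  suffices mulLin R k ∘ₗ TensorProduct.map LinearMap.id (antipodeLin R k) ∘ₗ comulLin R k =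
      (counitLin R k).smulRight (oneD R k) from LinearMap.congr_fun this h
  refine (basisD R k).ext fun h => ?_
  simp only [LinearMap.comp_apply, comulLin_basisD, map_sum, TensorProduct.map_tmul,
    LinearMap.id_apply, antipodeLin_basisD, mulLin_basisD, comul_antipode_matched_iff,
    LinearMap.smulRight_apply, counitLin_basisD]
  split_ifs with hy
  · rw [one_smul]
    refine Fintype.sum_equiv (Equiv.inv X) _ _ fun z => ?_
    rw [R.mulIdx_comul_antipode h z hy]
    rfl
  · rw [zero_smul, Finset.sum_const_zero]

lemma antipode_left_lin (h : (D R k).carrier) :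
    mulLin R k (TensorProduct.map (antipodeLin R k) LinearMap.id (comulLin R k h)) =
      counitLin R k h • oneD R k := by
  suffices mulLin R k ∘ₗ TensorProduct.map (antipodeLin R k) LinearMap.id ∘ₗ comulLin R k =
      (counitLin R k).smulRight (oneD R k) from LinearMap.congr_fun this h
  refine (basisD R k).ext fun h => ?_
  simp only [LinearMap.comp_apply, comulLin_basisD, map_sum, TensorProduct.map_tmul,
    LinearMap.id_apply, antipodeLin_basisD, mulLin_basisD, antipode_comul_matched_iff,
    LinearMap.smulRight_apply, counitLin_basisD]
  split_ifs with hy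
  · rw [one_smul]
    refine Fintype.sum_equiv (MulAut.conj h.2⁻¹).toEquiv _ _ fun z => ?_
    rw [R.mulIdx_antipode_comul h z hy]
    simp [δ]
  · rw [zero_smul, Finset.sum_const_zero]

end Comul

/-! ### Degrees in the middle interchange and in the action of a pair of basis elements. -/

section TensorMu

variable {X : Type u} [Group X] (R : CosetReps X)

/-- The element acting on the second factor in the middle interchange
`(V ⊗ W) ⊗ (U ⊗ Z) ⟶ (V ⊗ U) ⊗ (W ⊗ Z)`, in terms of the degrees. -/
noncomputable def muC (b₁ b₂ : X) : X := (R.ttau b₁ b₂ : X)⁻¹ * R.abv b₁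

/-- The element acting on the third factor in the middle interchange. -/
noncomputable def muB (q b₁ b₂ : X) : X :=
  (R.mp ((R.muC b₁ b₂)⁻¹ * q * R.muC b₁ b₂) : X)⁻¹ *
    R.ttau ((R.muC b₁ b₂)⁻¹ * q * R.muC b₁ b₂) b₂

/-- The element acting on the first factor in the middle interchange. -/
noncomputable def muA (q b₁ b₂ : X) : X :=
  R.ttau q (R.circ b₁ b₂) * (R.ttau ((R.muB q b₁ b₂)⁻¹ * b₁ * R.muB q b₁ b₂)
    (R.circ ((R.muC b₁ b₂)⁻¹ * q * R.muC b₁ b₂) b₂) : X)⁻¹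

lemma muB_eq (q b₁ b₂ : X) : R.muB q b₁ b₂ =
    R.mp b₂ * (R.mp (R.circ ((R.muC b₁ b₂)⁻¹ * q * R.muC b₁ b₂) b₂) : X)⁻¹ := by
  rw [muB, mp_circ, ttau, coe_tau]; group

/-- Reassociating and braiding preserve the total degree: the identity is `circ_assoc`, `circ_braid`
and `circ_assoc` again, applied to the three factors moved by the interchange. -/
lemma circ_muB (q b₁ b₂ : X) :
    R.circ ((R.muB q b₁ b₂)⁻¹ * b₁ * R.muB q b₁ b₂)
      (R.circ ((R.muC b₁ b₂)⁻¹ * q * R.muC b₁ b₂) b₂) = R.circ q (R.circ b₁ b₂) := by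
  have h1 := R.circ_assoc (R.ttau b₁ b₂ * q * (R.ttau b₁ b₂ : X)⁻¹) b₁ b₂
  rw [show (R.ttau b₁ b₂ : X)⁻¹ * (R.ttau b₁ b₂ * q * (R.ttau b₁ b₂ : X)⁻¹) * R.ttau b₁ b₂ = q by
    group, ← R.circ_braid (R.ttau b₁ b₂ * q * (R.ttau b₁ b₂ : X)⁻¹) b₁, circ_assoc] at h1
  rw [← h1]
  have h2 : (R.abv b₁ : X)⁻¹ * (R.ttau b₁ b₂ * q * (R.ttau b₁ b₂ : X)⁻¹) * R.abv b₁ =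
      (R.muC b₁ b₂)⁻¹ * q * R.muC b₁ b₂ := by rw [muC]; group
  rw [h2, muB]
  congr 1
  group

/-- By `circ_muB` the two factors `τ` in `muA` involve the same `M`-part, which cancels. In this
form the last factor `b₁ ▷ B` cancels against the one produced when `B` acts on a basis element of
`D` of degree `b₁`. -/
lemma muA_eq (q b₁ b₂ : X) : R.muA q b₁ b₂ =
    R.mp q * (R.ttau b₁ b₂ : X)⁻¹ * R.tri b₁ (R.muB q b₁ b₂) := by
  have h := congrArg (fun x => (R.mp x : X)) (R.circ_muB q b₁ b₂)
  simp only [R.mp_circ ((R.muB q b₁ b₂)⁻¹ * b₁ * R.muB q b₁ b₂), R.mp_circ q] at h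
  rw [muA, ttau, ttau, coe_tau, coe_tau, h, tri, ttau, coe_tau, ← R.mp_circ b₁]
  generalize (R.dot (R.mp q) _ : X) = d
  rw [R.muB_eq q b₁ b₂]
  group

lemma circ_eq_mul (p q : X) : R.circ p q = q * ((R.mp q : X)⁻¹ * p * R.mp q) := by
  rw [circ, gp_eq]; group

/-- The condition for `δ_h ⊗ δ_{h'}` to act nontrivially on elements of degrees `p` and `q`. -/
def PairMatched (p q : X) (h h' : X × X) : Prop :=
  h'.1 = (R.muC (R.dDeg h) (R.dDeg h'))⁻¹ * q * R.muC (R.dDeg h) (R.dDeg h') ∧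
    h.1 = R.ttau (R.dDeg h) (R.dDeg h') * ((R.mp q : X)⁻¹ * p * R.mp q) *
      (R.ttau (R.dDeg h) (R.dDeg h') : X)⁻¹

/-- The element by which `δ_h ⊗ δ_{h'}` acts on the second factor. -/
noncomputable def pairRight (h h' : X × X) : X := R.muC (R.dDeg h) (R.dDeg h') * h'.2

/-- The element by which `δ_h ⊗ δ_{h'}` acts on the first factor, for `q` the degree of the
second factor. -/
noncomputable def pairLeft (q : X) (h h' : X × X) : X :=
  R.mp q * (R.ttau (R.dDeg h) (R.dDeg h') : X)⁻¹ * h.2 * R.mp (R.dDeg h') *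
    (R.mp ((R.pairRight h h')⁻¹ * q * R.pairRight h h') : X)⁻¹

/-- Conservation of degree for the action of `D ⊗ D`: input degree composed with the degree of the
pair gives the output degree. Left division then recovers `‖h‖ ∘ ‖h'‖` from `p`, `q` and the acting
elements. -/
lemma PairMatched.circ_eq {p q : X} {h h' : X × X} (H : R.PairMatched p q h h') :
    R.circ (R.circ p q) (R.circ (R.dDeg h) (R.dDeg h')) =
      R.circ ((R.pairLeft q h h')⁻¹ * p * R.pairLeft q h h')
        ((R.pairRight h h')⁻¹ * q * R.pairRight h h') := by
  obtain ⟨h1, h2⟩ := H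
  have hab : (R.abv (R.circ (R.dDeg h) (R.dDeg h')) : X) =
      (R.ttau (R.dDeg h) (R.dDeg h') : X)⁻¹ * R.abv (R.dDeg h) * R.abv (R.dDeg h') := by
    rw [mul_assoc, eq_inv_mul_iff_mul_eq, ttau_mul_abv]
  have hp : p = R.mp q * ((R.ttau (R.dDeg h) (R.dDeg h') : X)⁻¹ * h.1 *
      R.ttau (R.dDeg h) (R.dDeg h')) * (R.mp q : X)⁻¹ := by rw [h2]; group
  have hq : q = R.muC (R.dDeg h) (R.dDeg h') * h'.1 * (R.muC (R.dDeg h) (R.dDeg h'))⁻¹ := by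
    rw [h1]; group
  have e1 := R.abv_inv_mul_mul_dDeg h
  have e2 := R.abv_inv_mul_mul_dDeg h'
  have hx : (R.pairRight h h')⁻¹ * q * R.pairRight h h' = h'.2⁻¹ * h'.1 * h'.2 := by
    conv_lhs => rw [hq]
    rw [pairRight]; group
  have hm := R.mp_eq_abv_mul (R.dDeg h')
  rw [R.circ_eq_mul (_ * p * _), R.circ_eq_mul p q, R.circ_eq_abv (_ * _), hab, pairLeft, hx,
    ← e2]
  rw [R.circ_eq_abv (R.dDeg h)]
  have e1' : h.2⁻¹ * h.1 * h.2 = (R.abv (R.dDeg h) : X)⁻¹ * h.1 * R.abv (R.dDeg h) * R.dDeg h :=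
    e1.symm
  generalize hn : (R.mp ((R.abv (R.dDeg h') : X)⁻¹ * h'.1 * (R.abv (R.dDeg h') : X) *
    R.dDeg h') : X) = n
  have hp' : (R.mp q : X)⁻¹ * p * R.mp q = (R.ttau (R.dDeg h) (R.dDeg h') : X)⁻¹ * h.1 *
      R.ttau (R.dDeg h) (R.dDeg h') := by rw [h2]; group
  have e3 : n⁻¹ * ((R.mp q * (R.ttau (R.dDeg h) (R.dDeg h') : X)⁻¹ * h.2 * R.mp (R.dDeg h') *
      n⁻¹)⁻¹ * p * (R.mp q * (R.ttau (R.dDeg h) (R.dDeg h') : X)⁻¹ * h.2 * R.mp (R.dDeg h') *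
      n⁻¹)) * n = (R.mp (R.dDeg h') : X)⁻¹ * (h.2⁻¹ * h.1 * h.2) * R.mp (R.dDeg h') := by
    conv_lhs => rw [hp]
    group
  rw [e3, e1', hp', hm]
  conv_lhs => rw [hq]
  rw [muC]
  group

/-- The degrees of a matched pair, in terms of the degrees of the arguments and the elements by
which it acts. -/
lemma PairMatched.circ_dDeg {p q : X} {h h' : X × X} (H : R.PairMatched p q h h') :
    R.circ (R.dDeg h) (R.dDeg h') = R.ydiv (R.circ p q)
      (R.circ ((R.pairLeft q h h')⁻¹ * p * R.pairLeft q h h')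
        ((R.pairRight h h')⁻¹ * q * R.pairRight h h')) :=
  R.ydiv_unique _ _ _ (H.circ_eq R)

/-- This is the formula for `‖h₍₂₎‖` in the coproduct, with `z` replaced by `q` and `x` by the
element acting on the second factor. -/
lemma PairMatched.dDeg_right {p q : X} {h h' : X × X} (H : R.PairMatched p q h h') :
    R.dDeg h' = (R.abv (R.circ (R.dDeg h) (R.dDeg h')) : X)⁻¹ * q⁻¹ *
      R.abv (R.circ (R.dDeg h) (R.dDeg h')) *
        ((R.pairRight h h')⁻¹ * q * R.pairRight h h') := by
  obtain ⟨h1, h2⟩ := H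
  have hab : (R.abv (R.circ (R.dDeg h) (R.dDeg h')) : X) =
      R.muC (R.dDeg h) (R.dDeg h') * R.abv (R.dDeg h') := by
    rw [muC, mul_assoc, eq_inv_mul_iff_mul_eq, ttau_mul_abv]
  have hq : q = R.muC (R.dDeg h) (R.dDeg h') * h'.1 * (R.muC (R.dDeg h) (R.dDeg h'))⁻¹ := by
    rw [h1]; group
  have hx : (R.pairRight h h')⁻¹ * q * R.pairRight h h' = h'.2⁻¹ * h'.1 * h'.2 := by
    conv_lhs => rw [hq]
    rw [pairRight]; group
  rw [hx, ← R.abv_inv_mul_mul_dDeg h', hab]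
  conv_rhs => rw [hq]
  group

lemma dDeg_left_eq (b₁ b₂ : X) :
    b₁ = R.abv b₂ * R.circ b₁ b₂ * (R.mp b₂ : X)⁻¹ := by
  rw [circ, gp_inv_eq_abv]; group

/-- A matched pair is determined by the degrees of the arguments and the elements by which it
acts. -/
lemma PairMatched.unique {p q : X} {h h' j j' : X × X} (H : R.PairMatched p q h h')
    (J : R.PairMatched p q j j') (hl : R.pairLeft q h h' = R.pairLeft q j j')
    (hr : R.pairRight h h' = R.pairRight j j') : h = j ∧ h' = j' := by
  -- The degrees are recovered in the order `‖h‖ ∘ ‖h'‖`, `‖h'‖`, `‖h‖`; once they agree, labels and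
  -- group elements follow by cancellation.
  have h1 : R.circ (R.dDeg h) (R.dDeg h') = R.circ (R.dDeg j) (R.dDeg j') := by
    rw [H.circ_dDeg, J.circ_dDeg, hl, hr]
  have h2 : R.dDeg h' = R.dDeg j' := by rw [H.dDeg_right, J.dDeg_right, h1, hr]
  have h3 : R.dDeg h = R.dDeg j := by
    rw [R.dDeg_left_eq (R.dDeg h) (R.dDeg h'), R.dDeg_left_eq (R.dDeg j) (R.dDeg j'), h1, h2]
  have h4 := hr
  rw [pairRight, pairRight, h2, h3, mul_right_inj] at h4
  have h5 := hl
  rw [pairLeft, pairLeft, hr, h2, h3, mul_left_inj, mul_left_inj, mul_right_inj] at h5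
  exact ⟨Prod.ext (by rw [H.2, J.2, h2, h3]) h5, Prod.ext (by rw [H.1, J.1, h2, h3]) h4⟩

end TensorMu

/-! ### The action of `D ⊗ D` on a tensor product of objects. -/

section PairAction

variable {X : Type u} [Group X] [Fintype X] {R : CosetReps X} {k : Type u} [Field k]

open DCat

lemma lin_tensorμ_tmul {V W U Z : DCat R k} {q b₁ b₂ : X} {ξ : V.carrier} {η : W.carrier}
    {υ : U.carrier} {ζ : Z.carrier} (hq : W.str.pr q η = η)
    (hυ : U.str.pr b₁ υ = υ) (hζ : Z.str.pr b₂ ζ = ζ) :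
    lin (tensorμ V W U Z) ((ξ ⊗ₜ[k] η) ⊗ₜ[k] (υ ⊗ₜ[k] ζ)) =
      (V.str.act (R.muA q b₁ b₂) ξ ⊗ₜ[k] U.str.act (R.muB q b₁ b₂) υ) ⊗ₜ[k]
        (W.str.act (R.muC b₁ b₂) η ⊗ₜ[k] ζ) := by
  simp only [tensorμ, lin_comp, lin_whiskerLeft, lin_whiskerRight, lin_associator,
    lin_associator_inv, lin_braiding, LinearMap.comp_apply]
  have hq' : W.str.pr ((R.ttau b₁ b₂ : X)⁻¹⁻¹ * q * (R.ttau b₁ b₂ : X)⁻¹)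
      (W.str.act (R.ttau b₁ b₂ : X)⁻¹ η) = W.str.act (R.ttau b₁ b₂ : X)⁻¹ η := W.str.act_deg _ hq
  have e : (R.abv b₁ : X)⁻¹ * ((R.ttau b₁ b₂ : X)⁻¹⁻¹ * q * (R.ttau b₁ b₂ : X)⁻¹) * R.abv b₁ =
      (R.muC b₁ b₂)⁻¹ * q * R.muC b₁ b₂ := by rw [muC]; group
  have hq'' : W.str.pr ((R.muC b₁ b₂)⁻¹ * q * R.muC b₁ b₂) (W.str.act (R.muC b₁ b₂) η) =
    W.str.act (R.muC b₁ b₂) η := W.str.act_deg _ hq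
  have hυ' : U.str.pr ((R.muB q b₁ b₂)⁻¹ * b₁ * R.muB q b₁ b₂) (U.str.act (R.muB q b₁ b₂) υ) =
    U.str.act (R.muB q b₁ b₂) υ := U.str.act_deg _ hυ
  rw [tensorObj_str, tensorObj_str,
    Str.assocLin_tmul _ hq (Str.pr_tensor_tmul hυ hζ), TensorProduct.map_tmul,
    Str.assocInvLin_tmul _ hυ hζ, TensorProduct.map_tmul, TensorProduct.map_tmul,
    TensorProduct.map_tmul,
    Str.braidLin_tmul hq' hυ, e, ← Str.act_mul, ← muC]
  simp only [LinearMap.id_apply]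
  rw [Str.assocLin_tmul _ hq'' hζ, ← Str.act_mul, ← muB,
    Str.assocInvLin_tmul _ hυ' (Str.pr_tensor_tmul hq'' hζ), ← Str.act_mul, ← muA]

/-- The action of `D ⊗ D` on `V ⊗ W`. -/
noncomputable def pairAct (V W : DCat R k) : (V ⊗ W) ⊗ (D R k ⊗ D R k) ⟶ V ⊗ W :=
  tensorμ V W (D R k) (D R k) ≫ (canAct V ⊗ₘ canAct W)

lemma canAct_basisD {V : Type u} [AddCommGroup V] [Module k V] (σ : Str R k V) (ξ : V)
    (h : X × X) : σ.canAct ξ (basisD R k h) = σ.act h.2 (σ.pr h.1 ξ) := σ.canAct_δ ξ h.1 h.2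

open scoped Classical in
-- On the second factor `C` moves the degree to `C⁻¹ q C`, which must be the label of `h'`. On the
-- first factor the label of `h`, conjugated by `b₁ ▷ B`, must be `A⁻¹ p A`, and `muA_eq` removes
-- `b₁ ▷ B` from both sides.
lemma pairAct_tmul {V W : DCat R k} {p q : X} {ξ : V.carrier} {η : W.carrier}
    (hp : V.str.pr p ξ = ξ) (hq : W.str.pr q η = η) (h h' : X × X) :
    lin (pairAct V W) ((ξ ⊗ₜ[k] η) ⊗ₜ[k] (basisD R k h ⊗ₜ[k] basisD R k h')) =
      if R.PairMatched p q h h' then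
        V.str.act (R.pairLeft q h h') ξ ⊗ₜ[k] W.str.act (R.pairRight h h') η
      else 0 := by
  rw [pairAct, lin_comp, LinearMap.comp_apply, lin_tensorμ_tmul hq (pr_basisD h) (pr_basisD h'),
    lin_tensorHom, TensorProduct.map_tmul, lin_canAct, lin_canAct, TensorProduct.lift.tmul,
    TensorProduct.lift.tmul, act_basisD, canAct_basisD, canAct_basisD]
  set C := R.muC (R.dDeg h) (R.dDeg h') with hC
  set B := R.muB q (R.dDeg h) (R.dDeg h') with hB
  by_cases h1 : h'.1 = C⁻¹ * q * C
  · have hA := R.muA_eq q (R.dDeg h) (R.dDeg h')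
    rw [← hB] at hA
    rw [h1, W.str.act_deg _ hq, ← Str.act_mul, dAct]
    dsimp only
    set A := R.muA q (R.dDeg h) (R.dDeg h')
    by_cases h2 : h.1 = R.ttau (R.dDeg h) (R.dDeg h') * ((R.mp q : X)⁻¹ * p * R.mp q) *
      (R.ttau (R.dDeg h) (R.dDeg h') : X)⁻¹
    · rw [if_pos ⟨h1, h2⟩]
      have e : (R.tri (R.dDeg h) B)⁻¹ * h.1 * R.tri (R.dDeg h) B = A⁻¹ * p * A := by
        rw [hA]; conv_lhs => rw [h2]
        group
      rw [e, V.str.act_deg _ hp, ← Str.act_mul]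
      -- The closed form of `B` contains the `M`-part of `C⁻¹ q C ∘ ‖h'‖`, and this product is the
      -- output degree of the second factor because `C⁻¹ q C` is the label of `h'`.
      have e2 : A * ((R.tri (R.dDeg h) B)⁻¹ * h.2 * B) = R.pairLeft q h h' := by
        have h3 := R.circ_dDeg h'
        rw [pairLeft, hA, hB, R.muB_eq, ← hC, ← h1, h3, pairRight, ← hC, h1]
        have : h'.2⁻¹ * (C⁻¹ * q * C) * h'.2 = (C * h'.2)⁻¹ * q * (C * h'.2) := by group
        rw [this]
        group
      rw [e2]
      rfl
    · rw [if_neg (fun H => h2 H.2), V.str.pr_of_ne (V.str.act_deg _ hp), map_zero, zero_tmul]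
      intro h3
      apply h2
      rw [hA] at h3
      have h4 : h.1 = R.tri (R.dDeg h) B * ((R.tri (R.dDeg h) B)⁻¹ * h.1 * R.tri (R.dDeg h) B) *
        (R.tri (R.dDeg h) B)⁻¹ := by group
      rw [h4, h3]
      group
  · rw [if_neg (fun H => h1 H.1), W.str.pr_of_ne (W.str.act_deg _ hq) h1, map_zero, tmul_zero]

end PairAction

/-! ### The regular object, on which `D` acts faithfully. -/

section RegularMaps

variable {X : Type u} (k : Type u) [Field k]

/-- The projections of `k ^ (X × X)` onto the functions supported on `{w} × X`. -/
noncomputable def regPr (w : X) : (X × X → k) →ₗ[k] (X × X → k) :=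
  open scoped Classical in
  LinearMap.pi fun i => if i.1 = w then LinearMap.proj i else 0

lemma regPr_apply [DecidableEq X] (w : X) (f : X × X → k) (i : X × X) :
    regPr k w f i = if i.1 = w then f i else 0 := by
  rw [regPr, LinearMap.pi_apply]
  split_ifs <;> rfl

variable [Group X]

/-- The right action of `X` on functions on `X × X` with `(a, g) ◁ x = (x⁻¹ a x, g x)` on the
indicator functions `(a, g)`. -/
def regAct (x : X) : (X × X → k) →ₗ[k] (X × X → k) :=
  LinearMap.funLeft k k fun i => (x * i.1 * x⁻¹, i.2 * x⁻¹)

lemma regAct_apply (x : X) (f : X × X → k) (i : X × X) :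
    regAct k x f i = f (x * i.1 * x⁻¹, i.2 * x⁻¹) := rfl

end RegularMaps

section Regular

variable {X : Type u} [Group X] [Fintype X] (R : CosetReps X) (k : Type u) [Field k]

/-- The structure of an object of `𝒟` on the functions on `X × X`, with `‖(a, g)‖ = a` and
`(a, g) ◁ x = (x⁻¹ a x, g x)` on the indicator functions `(a, g)`. -/
noncomputable def regStr : Str R k (X × X → k) :=
  Str.ofAct R (regPr k)
    (fun y ξ => by
      classical
      ext i; rw [regPr_apply, regPr_apply]; split_ifs <;> rfl)
    (fun y z ξ hyz => by
      classical
      ext i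
      rw [regPr_apply, regPr_apply]
      split_ifs with h1 h2
      · exact absurd (h1.symm.trans h2) hyz
      · rfl
      · rfl)
    (fun ξ => by
      classical
      ext i
      rw [Finset.sum_apply]
      simp only [regPr_apply]
      simp)
    (regAct k)
    (fun ξ => by ext i; simp [regAct_apply])
    (fun x z ξ => by ext i; simp [regAct_apply, mul_assoc])
    (fun x y ξ h => by
      classical
      ext i
      have h' := congrFun h (x * i.1 * x⁻¹, i.2 * x⁻¹)
      rw [regPr_apply] at h' ⊢
      rw [regAct_apply, ← h']
      dsimp only
      have : i.1 = x⁻¹ * y * x ↔ x * i.1 * x⁻¹ = y := by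
        constructor
        · intro h; rw [h]; group
        · rintro rfl; group
      by_cases hi : x * i.1 * x⁻¹ = y
      · rw [if_pos (this.2 hi)]
      · rw [if_neg (fun h => hi (this.1 h)), if_neg hi])

/-- The object `regStr` of `𝒟`. -/
noncomputable def reg : DCat R k := ⟨X × X → k, R.regStr k⟩

variable [DecidableEq X]

variable {R k} in
/-- The basis elements of `reg`. -/
noncomputable def regSingle (a g : X) : (reg R k).carrier :=
  (Pi.single (a, g) 1 : X × X → k)

variable {R k} in
/-- The coordinates on `reg`. -/
noncomputable def regCoord (a g : X) : (reg R k).carrier →ₗ[k] k :=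
  LinearMap.proj (R := k) (φ := fun _ : X × X => k) (a, g)

lemma regCoord_regSingle (a g b g' : X) : regCoord (R := R) (k := k) a g (regSingle b g') =
    if a = b ∧ g = g' then 1 else 0 := by
  change (Pi.single (b, g') 1 : X × X → k) (a, g) = _
  rw [Pi.single_apply]
  exact if_congr Prod.mk_inj rfl rfl

lemma pr_regSingle (a g : X) : (reg R k).str.pr a (regSingle a g) = regSingle a g := by
  funext i
  refine (regPr_apply k a (Pi.single (a, g) 1) i).trans ?_
  split_ifs with h
  · rfl
  · exact (Pi.single_eq_of_ne (M := fun _ : X × X => k) (fun e : i = (a, g) => h (congrArg Prod.fst e)) 1).symm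

lemma act_regSingle (a g x : X) : (reg R k).str.act x (regSingle a g) =
    regSingle (x⁻¹ * a * x) (g * x) := by
  have h : (R.regStr k).act = regAct k := Str.act_ofAct _ _ _ _ _ _ _ _
  refine (LinearMap.congr_fun (congrFun h x) _).trans ?_
  funext i
  change (Pi.single (a, g) 1 : X × X → k) (x * i.1 * x⁻¹, i.2 * x⁻¹) =
    (Pi.single (x⁻¹ * a * x, g * x) 1 : X × X → k) i
  rw [Pi.single_apply, Pi.single_apply]
  refine if_congr ?_ rfl rfl
  rw [Prod.ext_iff, Prod.ext_iff]
  dsimp only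
  constructor
  · rintro ⟨h1, h2⟩; rw [← h1, ← h2]; constructor <;> group
  · rintro ⟨h1, h2⟩; rw [h1, h2]; constructor <;> group

end Regular

/-! ### Faithfulness of the actions of `D` and `D ⊗ D`. -/

section Faithful

open DCat

variable {X : Type u} [Group X] [Fintype X] {R : CosetReps X} {k : Type u} [Field k]

/-- The canonical action of `D` on `reg` is faithful. -/
lemma eq_of_canAct_reg {t t' : (D R k).carrier}
    (H : ∀ ξ, (reg R k).str.canAct ξ t = (reg R k).str.canAct ξ t') : t = t' := by
  classical
  refine (basisD R k).ext_elem fun h₀ => ?_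
  -- The basis vector `(y, e)` sent by `δ_y ⊗ x` to `(x⁻¹ y x, x)` is killed by every other label,
  -- and the second entry of the image distinguishes the elements `x`.
  have key : (basisD R k).coord h₀ = regCoord (h₀.2⁻¹ * h₀.1 * h₀.2) h₀.2 ∘ₗ
      (reg R k).str.canAct (regSingle h₀.1 1) := by
    refine (basisD R k).ext fun h => ?_
    rw [Module.Basis.coord_apply, Module.Basis.repr_self, Finsupp.single_apply,
      LinearMap.comp_apply, canAct_basisD]
    by_cases h1 : h.1 = h₀.1
    · rw [h1, pr_regSingle, act_regSingle, one_mul, regCoord_regSingle]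
      refine if_congr ?_ rfl rfl
      constructor
      · rintro rfl; exact ⟨rfl, rfl⟩
      · rintro ⟨_, h2⟩; exact Prod.ext h1 h2.symm
    · rw [(reg R k).str.pr_of_ne (pr_regSingle R k _ _) h1, map_zero, map_zero, if_neg]
      rintro rfl; exact h1 rfl
  exact (LinearMap.congr_fun key t).trans
    ((congrArg (regCoord _ _) (H _)).trans (LinearMap.congr_fun key t').symm)

/-- The action of `D ⊗ D` on `reg ⊗ reg` is faithful. -/
lemma eq_of_pairAct_reg {t t' : (D R k).carrier ⊗[k] (D R k).carrier}
    (H : ∀ ξ η : (reg R k).carrier, lin (pairAct (reg R k) (reg R k)) ((ξ ⊗ₜ[k] η) ⊗ₜ[k] t) =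
      lin (pairAct (reg R k) (reg R k)) ((ξ ⊗ₜ[k] η) ⊗ₜ[k] t')) : t = t' := by
  classical
  refine ((basisD R k).tensorProduct (basisD R k)).ext_elem fun ⟨j, j'⟩ => ?_
  -- The degrees `p` and `q` are obtained by solving the two equations in `PairMatched` for the
  -- given pair `j`, `j'`.
  obtain ⟨q, hq⟩ : ∃ q, q = R.muC (R.dDeg j) (R.dDeg j') * j'.1 *
    (R.muC (R.dDeg j) (R.dDeg j'))⁻¹ := ⟨_, rfl⟩
  obtain ⟨p, hp⟩ : ∃ p, p = R.mp q * ((R.ttau (R.dDeg j) (R.dDeg j') : X)⁻¹ * j.1 *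
    R.ttau (R.dDeg j) (R.dDeg j')) * (R.mp q : X)⁻¹ := ⟨_, rfl⟩
  have J : R.PairMatched p q j j' := ⟨by rw [hq]; group, by rw [hp]; group⟩
  -- The coordinate at the image of `(p, e) ⊗ (q, e)` under `j`, `j'`. By `PairMatched.unique` no
  -- other pair reaches it.
  let φ : (reg R k).carrier ⊗[k] (reg R k).carrier →ₗ[k] k :=
    LinearMap.mul' k k ∘ₗ TensorProduct.map
      (regCoord ((R.pairLeft q j j')⁻¹ * p * R.pairLeft q j j') (R.pairLeft q j j'))
      (regCoord ((R.pairRight j j')⁻¹ * q * R.pairRight j j') (R.pairRight j j'))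
  have hφ : ∀ a g b g', φ (regSingle a g ⊗ₜ regSingle b g') =
      if ((R.pairLeft q j j')⁻¹ * p * R.pairLeft q j j' = a ∧ R.pairLeft q j j' = g) ∧
        ((R.pairRight j j')⁻¹ * q * R.pairRight j j' = b ∧ R.pairRight j j' = g') then 1
      else 0 := by
    intro a g b g'
    rw [LinearMap.comp_apply, TensorProduct.map_tmul, LinearMap.mul'_apply, regCoord_regSingle,
      regCoord_regSingle, ite_zero_mul_ite_zero, one_mul]
  have key : ((basisD R k).tensorProduct (basisD R k)).coord (j, j') =
      (φ ∘ₗ lin (pairAct (reg R k) (reg R k))) ∘ₗ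
        TensorProduct.mk k _ _ ((regSingle p 1 : (reg R k).carrier) ⊗ₜ[k] regSingle q 1) := by
    refine ((basisD R k).tensorProduct (basisD R k)).ext fun ⟨h, h'⟩ => ?_
    rw [Module.Basis.coord_apply, Module.Basis.repr_self, Finsupp.single_apply,
      Module.Basis.tensorProduct_apply]
    refine Eq.trans ?_ (congrArg φ
      (pairAct_tmul (pr_regSingle R k _ _) (pr_regSingle R k _ _) h h')).symm
    by_cases hm : R.PairMatched p q h h'
    · rw [if_pos hm, act_regSingle, act_regSingle, hφ, one_mul, one_mul]
      refine if_congr ?_ rfl rfl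
      rw [Prod.mk.injEq]
      constructor
      · rintro ⟨rfl, rfl⟩; exact ⟨⟨rfl, rfl⟩, rfl, rfl⟩
      · rintro ⟨⟨-, hl⟩, -, hr⟩
        exact PairMatched.unique R hm J hl.symm hr.symm
    · rw [if_neg hm, map_zero, if_neg]
      rw [Prod.mk.injEq]
      rintro ⟨rfl, rfl⟩
      exact hm J
  exact (LinearMap.congr_fun key t).trans
    ((congrArg φ (H _ _)).trans (LinearMap.congr_fun key t').symm)

lemma hom_eq_of_canAct {Z : DCat R k} {f g : Z ⟶ D R k}
    (H : reg R k ◁ f ≫ canAct (reg R k) = reg R k ◁ g ≫ canAct (reg R k)) : f = g := by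
  refine lin_injective (LinearMap.ext fun ζ => eq_of_canAct_reg fun ξ => ?_)
  exact LinearMap.congr_fun (congrArg lin H) (ξ ⊗ₜ[k] ζ)

/-- Reduces equalities of morphisms into `D ⊗ D` to equalities of actions; it serves both the
uniqueness of `Δ` and its multiplicativity. -/
lemma hom_eq_of_pairAct {Z : DCat R k} {f g : Z ⟶ D R k ⊗ D R k}
    (H : (reg R k ⊗ reg R k) ◁ f ≫ pairAct (reg R k) (reg R k) =
      (reg R k ⊗ reg R k) ◁ g ≫ pairAct (reg R k) (reg R k)) : f = g := by
  refine lin_injective (LinearMap.ext fun ζ => eq_of_pairAct_reg fun ξ η => ?_)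
  exact LinearMap.congr_fun (congrArg lin H) ((ξ ⊗ₜ[k] η) ⊗ₜ[k] ζ)

end Faithful

/-! ### The diagrams satisfied by product, identity, counit and coproduct; multiplicativity of `Δ`.
-/

section Diagrams

open DCat

variable {X : Type u} [Group X] [Fintype X] (R : CosetReps X) (k : Type u) [Field k]

/-- The associator acts on `ξ` by `τ` of the two degrees, and the factors `τ⁻¹` in the product undo
it, leaving the plain composite by `x z`. -/
lemma isProduct_mulHom [DecidableEq X] : IsProduct R k (mulHom R k) := by
  intro V
  refine lin_injective (TensorProduct.ext (ext_D fun p ξ y x hp => ext_δ fun w z => ?_))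
  change V.str.canAct (V.str.canAct ξ (δ R k y x)) (δ R k w z) =
    TensorProduct.lift V.str.canAct (TensorProduct.map LinearMap.id (mulLin R k)
      (Str.assocLin V.str (D R k).str (D R k).str ((ξ ⊗ₜ δ R k y x) ⊗ₜ δ R k w z)))
  rw [Str.assocLin_tmul _ (pr_δ y x) (pr_δ w z), TensorProduct.map_tmul, mulLin_tmul,
    TensorProduct.lift.tmul, Str.canAct_δ, Str.canAct_δ, LinearMap.id_apply]
  generalize (R.ttau (R.dDeg (y, x)) (R.dDeg (w, z)) : X) = τ
  by_cases hy : y = p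
  · subst hy
    rw [hp]
    split_ifs with hw
    · rw [hw, V.str.act_deg _ hp, Str.canAct_δ, V.str.act_deg _ hp, ← Str.act_mul, ← Str.act_mul]
      congr 2
      group
    · rw [V.str.pr_of_ne (V.str.act_deg _ hp) hw, map_zero, map_zero]
  · rw [V.str.pr_of_ne hp hy, map_zero, map_zero, map_zero]
    split_ifs
    · rw [Str.canAct_δ, V.str.pr_of_ne (V.str.act_deg _ hp), map_zero]
      intro h
      exact hy (mul_left_cancel (mul_right_cancel h))
    · rw [map_zero]

lemma canAct_sum_δ {V : Type u} [AddCommGroup V] [Module k V] (σ : Str R k V) (ξ : V) (x : X) :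
    σ.canAct ξ (∑ y, δ R k y x) = σ.act x ξ := by
  rw [map_sum]
  simp only [Str.canAct_δ]
  rw [← map_sum, σ.sum_pr]

lemma canAct_oneD {V : Type u} [AddCommGroup V] [Module k V] (σ : Str R k V) (ξ : V) :
    σ.canAct ξ (oneD R k) = ξ := by
  rw [oneD, canAct_sum_δ, Str.act_one]

lemma isIdentity_oneHom : IsIdentity R k (oneHom R k) := by
  intro V
  refine lin_injective (TensorProduct.ext (LinearMap.ext fun ξ => LinearMap.ext_ring ?_))
  change V.str.canAct ξ (lin (oneHom R k) (1 : k)) = TensorProduct.rid k _ (ξ ⊗ₜ (1 : k))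
  rw [lin_oneHom_one, canAct_oneD, TensorProduct.rid_tmul, one_smul]

/-- The unit object lies in degree `e` with trivial action, so only the label `e` survives and `x`
has no effect. -/
lemma isCounit_counitHom [DecidableEq X] : IsCounit R k (counitHom R k) := by
  refine lin_injective (TensorProduct.ext (LinearMap.ext_ring (ext_δ fun y x => ?_)))
  change (Str.unit R k).canAct 1 (δ R k y x) =
    counitLin R k (TensorProduct.lid k _ ((1 : k) ⊗ₜ δ R k y x))
  rw [TensorProduct.lid_tmul, one_smul, counitLin_δ, Str.canAct_δ, Str.unit_act, LinearMap.id_apply]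
  split_ifs with h
  · rw [h, Str.unit_pr_one]
  · rw [pr_unit y h, LinearMap.zero_apply]

/-- On elements of degrees `p` and `q` only the summand `z = q` of `Δ(δ_y ⊗ x)` can act, and it does
so exactly when `y = p ∘ q`. It acts by `x` on the second factor and by `q ▷ x` on the first, as in
the tensor product. -/
lemma canAct_tensor_comul (V W : DCat R k) :
    canAct (V ⊗ W) = (V ⊗ W) ◁ comulHom R k ≫ pairAct V W := by
  classical
  refine lin_injective (TensorProduct.ext
    (Str.ext_tmul V.str W.str fun p q ξ η hp hq => (basisD R k).ext fun h => ?_))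
  change (Str.tensor V.str W.str).canAct (ξ ⊗ₜ η) (basisD R k h) =
    lin (pairAct V W) ((ξ ⊗ₜ[k] η) ⊗ₜ[k] comulLin R k (basisD R k h))
  rw [canAct_basisD, comulLin_basisD, TensorProduct.tmul_sum, map_sum]
  have hC : ∀ z, R.muC (comulDeg₁ R h z) (comulDeg₂ R h z) =
      (R.abv (comulDeg₂ R h z) * (R.abv (R.dDeg h) : X)⁻¹ : X)⁻¹ := by
    intro z
    rw [muC, ttau_comulDeg]; group
  have hm : ∀ z, R.PairMatched p q (R.comulIdx₁ h z) (R.comulIdx₂ h z) ↔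
      z = q ∧ h.1 = R.circ p q := by
    intro z
    rw [PairMatched, dDeg_comulIdx₁, dDeg_comulIdx₂, hC, comulIdx₁, comulIdx₂, circ_eq_mul,
      inv_inv]
    dsimp only
    rw [mul_left_inj, mul_right_inj, mul_left_inj, mul_right_inj, inv_mul_eq_iff_eq_mul]
    exact and_congr_right fun hz => by rw [hz]
  simp only [pairAct_tmul hp hq, hm]
  by_cases hy : h.1 = R.circ p q
  · rw [Finset.sum_eq_single q]
    · rw [if_pos ⟨rfl, hy⟩, hy, Str.pr_tensor_tmul hp hq, Str.act_tensor_tmul _ _ hq]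
      have e1 : R.pairRight (R.comulIdx₁ h q) (R.comulIdx₂ h q) = h.2 := by
        rw [pairRight, dDeg_comulIdx₁, dDeg_comulIdx₂, hC, comulIdx₂]
        group
      rw [pairLeft, e1, dDeg_comulIdx₁, dDeg_comulIdx₂, comulIdx₁, tri]
      congr 3
      group
    · intro z _ hz
      rw [if_neg (fun h' => hz h'.1)]
    · simp
  · rw [(Str.tensor V.str W.str).pr_of_ne (Str.pr_tensor_tmul hp hq) hy, map_zero,
      Finset.sum_eq_zero]
    intro z _
    rw [if_neg (fun h' => hy h'.2)]

lemma isCoproduct_iff (d : D R k ⟶ D R k ⊗ D R k) :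
    IsCoproduct R k d ↔ ∀ V W : DCat R k, canAct (V ⊗ W) = (V ⊗ W) ◁ d ≫ pairAct V W := by
  simp only [IsCoproduct, pairAct, tensorμ, Category.assoc]

/-- Acting on `V ⊗ V` through `Δ` after `μ` is acting by `D` twice. Each of these actions is an
action of `D ⊗ D` through `Δ`, and `D ⊗ D` acts twice by its braided product. Faithfulness for `V =
reg` gives the equality. -/
lemma mulHom_comulHom [DecidableEq X] : mulHom R k ≫ comulHom R k =
    (comulHom R k ⊗ₘ comulHom R k) ≫ tensorμ (D R k) (D R k) (D R k) (D R k) ≫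
      (mulHom R k ⊗ₘ mulHom R k) := by
  refine hom_eq_of_pairAct ?_
  generalize reg R k = V
  rw [whiskerLeft_comp, Category.assoc, ← canAct_tensor_comul]
  have hP := isProduct_mulHom R k
  have h1 := hP (V ⊗ V)
  rw [← Iso.inv_comp_eq] at h1
  rw [← h1, Iso.inv_comp_eq]
  -- The action of `D ⊗ D` is associative for the braided tensor product algebra: this is naturality
  -- and associativity of the middle interchange, together with the product diagram on each factor.
  have h2 : pairAct V V ▷ (D R k ⊗ D R k) ≫ pairAct V V =
      (α_ _ _ _).hom ≫ (V ⊗ V) ◁ tensorμ (D R k) (D R k) (D R k) (D R k) ≫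
        (V ⊗ V) ◁ (mulHom R k ⊗ₘ mulHom R k) ≫ pairAct V V := by
    simp only [pairAct, comp_whiskerRight, Category.assoc, tensorμ_natural_left_assoc,
      tensorμ_natural_right_assoc, tensorHom_comp_tensorHom, hP V]
    simp only [← tensorHom_comp_tensorHom]
    rw [tensor_associativity_assoc]
  -- Two coproducts applied one after the other pass the associator as `Δ ⊗ Δ`.
  have h3 : ((V ⊗ V) ◁ comulHom R k) ▷ D R k ≫ ((V ⊗ V) ⊗ (D R k ⊗ D R k)) ◁ comulHom R k ≫
      (α_ _ _ _).hom = (α_ _ _ _).hom ≫ (V ⊗ V) ◁ (comulHom R k ⊗ₘ comulHom R k) := by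
    rw [MonoidalCategory.tensorHom_def]
    simp
  rw [canAct_tensor_comul, comp_whiskerRight, Category.assoc, ← whisker_exchange_assoc, h2,
    reassoc_of% h3]
  simp only [whiskerLeft_comp, Category.assoc]

end Diagrams

/-! ### Group identities behind the antipode diagram. -/

section AntipodeIdentities

variable {X : Type u} [Group X] (R : CosetReps X)

/-- The label of `S(δ_h)` is the degree on which the antipode composite is nontrivial. -/
lemma antipode_match (h : X × X) (π : X) :
    (R.dAct (R.abv π : X)⁻¹ h).1 = (R.dAct (R.abv π : X)⁻¹ h).2 * R.yL π *
        ((R.dAct (R.abv π : X)⁻¹ h).2)⁻¹ ↔ π = h.2⁻¹ * h.1⁻¹ * h.2 := by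
  rw [dAct, yL_eq]
  dsimp only
  generalize R.tri (R.dDeg h) (R.abv π : X)⁻¹ = s
  have e : (R.abv π : X)⁻¹ * R.mp π = π := R.abv_ang π
  have e1 : s⁻¹ * h.2 * (R.abv π : X)⁻¹ * (R.mp π * π⁻¹ * (R.mp π : X)⁻¹) *
      (s⁻¹ * h.2 * (R.abv π : X)⁻¹)⁻¹ = s⁻¹ * (h.2 * π⁻¹ * h.2⁻¹) * s := by
    have : s⁻¹ * h.2 * (R.abv π : X)⁻¹ * (R.mp π * π⁻¹ * (R.mp π : X)⁻¹) *
      (s⁻¹ * h.2 * (R.abv π : X)⁻¹)⁻¹ = s⁻¹ * (h.2 * (((R.abv π : X)⁻¹ * R.mp π) * π⁻¹ *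
        ((R.abv π : X)⁻¹ * R.mp π)⁻¹) * h.2⁻¹) * s := by group
    rw [this, e]; group
  rw [e1, mul_left_inj, mul_right_inj]
  constructor
  · intro h1; rw [h1]; group
  · rintro rfl; group

/-- The element of `X` by which the antipode composite acts. -/
lemma antipode_elt (h : X × X) {π t d v b : X} (hπ : π = h.2⁻¹ * h.1⁻¹ * h.2)
    (hd : d = R.dDeg (R.dAct (R.abv π : X)⁻¹ h)) (ht : t = R.ttau d π)
    (hv : v = t⁻¹ * (R.dAct (R.abv π : X)⁻¹ h).2) (hb : b = R.circ d π) :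
    R.mp (R.dDeg h) * R.dualArg π v * R.coevArg (R.yR (v * R.yL π * v⁻¹)) *
      R.ttau (v * R.yL π * v⁻¹) b = R.mp (R.dDeg h) * h.2⁻¹ * R.abv (R.dDeg h) := by
  have hm := (R.antipode_match h π).2 hπ
  -- The matching condition gives `(y' ∘ d) ∘ π = πᴸ ∘ π = e` for the label `y'` of `h ◁ |π|⁻¹`;
  -- reassociating turns the left side into the required product, so the last `τ` has trivial
  -- `M`-part.
  have hu : R.circ (v * R.yL π * v⁻¹) b = 1 := by
    have h1 := R.circ_assoc (R.dAct (R.abv π : X)⁻¹ h).1 d π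
    have h2 := R.circ_dDeg (R.dAct (R.abv π : X)⁻¹ h)
    rw [← hd] at h2
    have h3 : ((R.dAct (R.abv π : X)⁻¹ h).2)⁻¹ * (R.dAct (R.abv π : X)⁻¹ h).1 *
        (R.dAct (R.abv π : X)⁻¹ h).2 = R.yL π := by rw [hm]; group
    rw [h2, h3, circ_yL, ← ht, ← hb] at h1
    rw [h1, hv, hm]
    congr 1
    group
  have hu' : (R.dot (R.mp (v * R.yL π * v⁻¹)) (R.mp b) : X) = 1 := by
    rw [← mp_circ, hu, mp_one, coe_e]
  have hd' : (R.mp d : X) = (R.tri (R.dDeg h) (R.abv π : X)⁻¹)⁻¹ * R.mp (R.dDeg h) *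
      (R.abv π : X)⁻¹ := by
    rw [hd, dDeg_dAct, mp_conj]
  have htb : t * R.mp b = R.mp d * R.mp π := by
    rw [ht, hb, mp_circ, ttau, tau_mul_dot]
  have e : (R.abv π : X)⁻¹ * R.mp π = π := R.abv_ang π
  have ea := R.eq_circ_abv (y := h.1) (x := h.2) rfl
  rw [dualArg_eq, coevArg_eq, mp_yR, yL_yR]
  rw [ttau, coe_tau, hu']
  -- The right inverse inside `dualArg` cancels against the one in `coevArg`. Then `t ⟨b⟩ = ⟨d⟩ ⟨π⟩`
  -- and `|π|⁻¹ ⟨π⟩ = π` leave a word in `π`, `x` and the parts of `‖h‖`.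
  calc _ = R.mp (R.dDeg h) * (R.mp π : X)⁻¹ * ((R.dAct (R.abv π : X)⁻¹ h).2)⁻¹ * (t * R.mp b) := by
        rw [hv]; group
    _ = R.mp (R.dDeg h) * ((R.abv π : X)⁻¹ * R.mp π)⁻¹ * h.2⁻¹ * R.mp (R.dDeg h) *
        ((R.abv π : X)⁻¹ * R.mp π) := by
        rw [htb, hd', dAct]; group
    _ = R.mp (R.dDeg h) * h.2⁻¹ * R.abv (R.dDeg h) := by
        rw [e, hπ]
        have : h.1 * (R.mp (R.dDeg h) : X) = R.abv (R.dDeg h) * (h.2⁻¹ * h.1 * h.2) := by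
          rw [← ea]; group
        calc _ = R.mp (R.dDeg h) * h.2⁻¹ * (h.1 * R.mp (R.dDeg h)) * (h.2⁻¹ * h.1⁻¹ * h.2) := by
              group
          _ = _ := by rw [this]; group

end AntipodeIdentities

/-! ### The antipode diagram for `S`. -/

section Antipode

open DCat

variable {X : Type u} [Group X] [Fintype X] {R : CosetReps X} {k : Type u} [Field k]

/-- The pairing of the dual object with the object. -/
def dualEval (V : DCat R k) : V.dual.carrier →ₗ[k] V.carrier →ₗ[k] k :=
  (LinearMap.id : Module.Dual k V.carrier →ₗ[k] Module.Dual k V.carrier)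

lemma dualEval_act (V : DCat R k) (x : X) (α : V.dual.carrier) (η : V.carrier) :
    dualEval V (V.dual.str.act x α) η = dualEval V α (V.str.dualActT x η) := by
  change (V.str.dual.act x α) η = _
  rw [Str.dual_act]
  rfl

lemma dualEval_pr (V : DCat R k) (x : X) (α : V.dual.carrier) (η : V.carrier) :
    dualEval V (V.dual.str.pr x α) η = dualEval V α (V.str.pr (R.yR x) η) := rfl

lemma contract_coevaluation (V : DCat R k) (ζ : V.carrier) :
    TensorProduct.rid k V.carrier (TensorProduct.map LinearMap.id ((dualEval V).flip ζ)
      (coevaluation k V.carrier 1)) = ζ := by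
  rw [coevaluation_apply_one]
  erw [map_sum, map_sum]
  exact (Module.Basis.ofVectorSpace k V.carrier).sum_repr ζ

/-- The composite defining the antipode, after the coevaluation. -/
noncomputable def antipodeTail (V : DCat R k) : (V ⊗ V.dual) ⊗ (D R k ⊗ V) ⟶ V :=
  (α_ V V.dual (D R k ⊗ V)).hom ≫ V ◁ (α_ V.dual (D R k) V).inv ≫
    V ◁ (canAct V.dual ▷ V) ≫ V ◁ ev V ≫ (ρ_ V).hom

/-- The functional is moved by an inverse associator and then by `h`. Transposing puts these
operations on `η` in reverse order, while `v` only receives the twist of the outer associator. -/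
lemma antipodeTail_tmul {V : DCat R k} {y c d : X} {v η : V.carrier}
    {α : V.dual.carrier} {h : X × X} (hα : V.dual.str.pr y α = α)
    (hd : R.dDeg h = d) (hη : V.str.pr c η = η) :
    lin (antipodeTail V) ((v ⊗ₜ[k] α) ⊗ₜ[k] (basisD R k h ⊗ₜ[k] η)) =
      dualEval V α
        (V.str.dualActT (R.ttau d c : X)⁻¹ (V.str.pr (R.yR h.1) (V.str.dualActT h.2 η))) •
      V.str.act (R.ttau y (R.circ d c)) v := by
  have hh : (D R k).str.pr d (basisD R k h) = basisD R k h := hd ▸ pr_basisD h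
  simp only [antipodeTail, lin_comp, lin_whiskerLeft, lin_whiskerRight, lin_associator,
    lin_associator_inv, LinearMap.comp_apply]
  rw [tensorObj_str, Str.assocLin_tmul _ hα (Str.pr_tensor_tmul hh hη), TensorProduct.map_tmul,
    Str.assocInvLin_tmul _ hh hη, TensorProduct.map_tmul, TensorProduct.map_tmul,
    TensorProduct.map_tmul, lin_canAct, TensorProduct.lift.tmul, canAct_basisD]
  simp only [LinearMap.id_apply]
  rw [← dualEval_act, ← dualEval_pr, ← dualEval_act]
  rfl

lemma antipodeTail_coev {V : DCat R k} {c d : X} {η ζ : V.carrier} {h : X × X}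
    (hd : R.dDeg h = d) (hη : V.str.pr c η = η)
    (hζ : ζ = V.str.dualActT (R.ttau d c : X)⁻¹ (V.str.pr (R.yR h.1) (V.str.dualActT h.2 η))) :
    lin (antipodeTail V) (lin (coev V) (1 : k) ⊗ₜ[k] (basisD R k h ⊗ₜ[k] η)) =
      ∑ y, V.str.act (R.coevArg y * R.ttau (R.yL y) (R.circ d c)) (V.str.pr y ζ) := by
  let L : V.carrier ⊗[k] Module.Dual k V.carrier →ₗ[k] V.carrier := lin (antipodeTail V) ∘ₗ
    (TensorProduct.mk k (V ⊗ V.dual).carrier (D R k ⊗ V).carrier).flip (basisD R k h ⊗ₜ[k] η)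
  change L (V.coevLin 1) = _
  rw [coevLin_one, map_sum]
  refine Finset.sum_congr rfl fun y _ => ?_
  -- The component of degree `y` of the coevaluation pairs `ζ` only through its part of degree `y`.
  -- The projection is written on both tensor factors so that the vector and the functional are
  -- homogeneous.
  have key : L ∘ₗ
      TensorProduct.map (V.str.act (R.coevArg y)) LinearMap.id ∘ₗ
        TensorProduct.map (V.str.pr y) (V.str.pr y).dualMap =
      V.str.act (R.coevArg y * R.ttau (R.yL y) (R.circ d c)) ∘ₗ V.str.pr y ∘ₗ V.str.pr y ∘ₗ
        (TensorProduct.rid k V.carrier).toLinearMap ∘ₗ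
          TensorProduct.map LinearMap.id ((dualEval V).flip (V.str.pr y ζ)) := by
    refine TensorProduct.ext' fun v α => ?_
    have hα : V.dual.str.pr (R.yL y) ((V.str.pr y).dualMap α : Module.Dual k V.carrier) =
        ((V.str.pr y).dualMap α : Module.Dual k V.carrier) := by
      change V.str.dual.pr (R.yL y) ((V.str.pr y).dualMap α) = (V.str.pr y).dualMap α
      rw [Str.dual_pr, yR_yL]
      ext ζ
      simp [V.str.pr_self]
    refine (antipodeTail_tmul hα hd hη).trans ?_
    rw [← hζ, ← Str.act_mul]
    change _ = V.str.act _ (V.str.pr y (V.str.pr y (dualEval V α (V.str.pr y ζ) • v)))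
    rw [map_smul, map_smul, map_smul, V.str.pr_self]
    rfl
  refine (LinearMap.congr_fun key _).trans ((congrArg (fun v => V.str.act _ (V.str.pr y
    (V.str.pr y v))) (contract_coevaluation V (V.str.pr y ζ))).trans ?_)
  rw [V.str.pr_self, V.str.pr_self]

lemma isAntipode_antipodeHom : IsAntipode R k (antipodeHom R k) := by
  intro V
  change _ = (λ_ (V ⊗ D R k)).inv ≫ (coev V ⊗ₘ (β_ (D R k) V).inv) ≫ antipodeTail V
  refine lin_injective (TensorProduct.ext (V.str.ext_homog fun p η hp =>
    (basisD R k).ext fun h => ?_))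
  change V.str.canAct η (antipodeLin R k (basisD R k h)) =
    lin (antipodeTail V) (lin (coev V) (1 : k) ⊗ₜ[k]
      Str.braidInvLin (D R k).str V.str (η ⊗ₜ[k] basisD R k h))
  -- The inverse braiding moves `η` to degree `π = ⟨a⟩⁻¹ p ⟨a⟩` and replaces `h` by `h ◁ |π|⁻¹`,
  -- with `a = ‖h‖`.
  rw [Str.braidInvLin_tmul (pr_basisD h) hp, act_basisD]
  set a := R.dDeg h with ha
  set π := (R.mp a : X)⁻¹ * p * R.mp a with hπ
  have hη : V.str.pr π (V.str.act (R.mp a) η) = V.str.act (R.mp a) η := V.str.act_deg _ hp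
  rw [antipodeTail_coev rfl hη rfl, antipodeLin_basisD, canAct_basisD]
  set h' := R.dAct (R.abv π : X)⁻¹ h with hh'
  have hp' : p = R.mp a * π * (R.mp a : X)⁻¹ := by rw [hπ]; group
  have hS : (R.antipodeIdx h).1 = R.mp a * (h.2⁻¹ * h.1⁻¹ * h.2) * (R.mp a : X)⁻¹ :=
    R.inv_mul_abv_mul h.1 h.2 rfl
  have hd := V.str.dualActT_deg h'.2 hη
  -- This is when the projection made by `h'` on the dual does not kill the term. By
  -- `antipode_match` it says that `p` is the label of `S(h)`, so both sides vanish otherwise.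
  by_cases hm : h'.1 = h'.2 * R.yL π * h'.2⁻¹
  · have hπ' := (R.antipode_match h π).1 hm
    rw [hm, hd]
    set t : X := (R.ttau (R.dDeg h') π : X)⁻¹ with ht
    have e : V.str.dualActT t (V.str.dualActT h'.2 (V.str.act (R.mp a) η)) =
        V.str.act (R.mp a * R.dualArg π (t * h'.2)) η := by
      rw [Str.dualActT_homog _ _ hd, Str.dualActT_homog _ _ hη, ← Str.act_mul, ← Str.act_mul,
        R.dualArg_mul, mul_assoc]
    have hd' := V.str.dualActT_deg t hd
    rw [yL_yR] at hd'
    refine Eq.trans ?_ (V.str.sum_homog (fun y => V.str.act (R.coevArg y *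
      R.ttau (R.yL y) (R.circ (R.dDeg h') π))) hd').symm
    have e2 : t * (h'.2 * R.yL π * h'.2⁻¹) * t⁻¹ = t * h'.2 * R.yL π * (t * h'.2)⁻¹ := by group
    rw [e, ← Str.act_mul, hS, ← hπ', ← hp', hp, e2, yL_yR, ← mul_assoc]
    rw [R.antipode_elt h hπ' rfl rfl rfl rfl]
    rfl
  · rw [V.str.pr_of_ne hd, map_zero]
    · simp only [map_zero, Finset.sum_const_zero]
      rw [V.str.pr_of_ne hp, map_zero]
      rw [hS, hp', Ne, mul_left_inj, mul_right_inj]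
      exact fun hπ' => hm ((R.antipode_match h π).2 hπ'.symm)
    · intro h1
      apply hm
      rw [← R.yL_yR h'.1, h1, yL_yR]

end Antipode

open DCat

/-! ### Assembly of the Hopf monoid. -/

section HopfMonoid

variable {X : Type u} [Group X] [Fintype X] [DecidableEq X] (R : CosetReps X) (k : Type u)
  [Field k]

/-- The coalgebra `D`. -/
noncomputable abbrev comonObjD : ComonObj (D R k) where
  counit := counitHom R k
  comul := comulHom R k
  -- The axiom has an inverse unitor on the right; composing with the unitor reduces it to a linear
  -- identity `D → D`.
  counit_comul := (Iso.comp_hom_eq_id _).1 (by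
    rw [Category.assoc]
    exact lin_injective (LinearMap.ext (counit_comulLin R k)))
  comul_counit := (Iso.comp_hom_eq_id _).1 (by
    rw [Category.assoc]
    exact lin_injective (LinearMap.ext (comul_counitLin R k)))
  comul_assoc := lin_injective (comulLin_coassoc R k)

/-- The bialgebra `D`. -/
noncomputable abbrev bimonObjD : BimonObj (D R k) where
  __ := monObjD R k
  __ := comonObjD R k
  mul_comul := mulHom_comulHom R k
  one_comul := lin_injective (LinearMap.ext_ring (by
    change comulLin R k (lin (oneHom R k) (1 : k)) =
      lin (oneHom R k) (1 : k) ⊗ₜ[k] lin (oneHom R k) (1 : k)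
    rw [lin_oneHom_one, comulLin_oneD]))
  mul_counit := lin_injective (TensorProduct.ext' (counitLin_mulLin R k))
  one_counit := lin_injective (LinearMap.ext_ring (by
    change counitLin R k (lin (oneHom R k) (1 : k)) = 1
    rw [lin_oneHom_one, counitLin_oneD]))

/-- The Hopf algebra `D`. -/
noncomputable abbrev hopfObjD : HopfObj (D R k) where
  __ := bimonObjD R k
  antipode := antipodeHom R k
  antipode_left := lin_injective (LinearMap.ext fun h => (antipode_left_lin R k h).trans
    (LinearMap.toSpanSingleton_apply k _ (oneD R k) (counitLin R k h)).symm)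
  antipode_right := lin_injective (LinearMap.ext fun h => (antipode_right_lin R k h).trans
    (LinearMap.toSpanSingleton_apply k _ (oneD R k) (counitLin R k h)).symm)

end HopfMonoid

/-! ### Uniqueness of the structure morphisms. -/

section Uniqueness

variable {X : Type u} [Group X] [Fintype X] {R : CosetReps X} {k : Type u} [Field k]

/-- Cancelling the associator in the diagram for `reg` shows that `m` and the explicit product
induce the same action there, and that action is faithful. -/
lemma isProduct_iff [DecidableEq X] (m : D R k ⊗ D R k ⟶ D R k) : IsProduct R k m ↔ m = mulHom R k := by
  refine ⟨fun h => hom_eq_of_canAct ?_, fun h => h ▸ isProduct_mulHom R k⟩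
  have := (h (reg R k)).symm.trans (isProduct_mulHom R k (reg R k))
  exact (cancel_epi _).1 this

lemma isIdentity_iff (i : 𝟙_ (DCat R k) ⟶ D R k) : IsIdentity R k i ↔ i = oneHom R k :=
  ⟨fun h => hom_eq_of_canAct ((h _).trans (isIdentity_oneHom R k _).symm),
    fun h => h ▸ isIdentity_oneHom R k⟩

lemma isCounit_iff [DecidableEq X] (c : D R k ⟶ 𝟙_ (DCat R k)) : IsCounit R k c ↔ c = counitHom R k :=
  ⟨fun h => (cancel_epi _).1 (h.symm.trans (isCounit_counitHom R k)),
    fun h => h ▸ isCounit_counitHom R k⟩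

lemma isCoproduct_iff_eq (d : D R k ⟶ D R k ⊗ D R k) :
    IsCoproduct R k d ↔ d = comulHom R k := by
  rw [isCoproduct_iff]
  refine ⟨fun h => hom_eq_of_pairAct ((h _ _).symm.trans (canAct_tensor_comul R k _ _)), ?_⟩
  rintro rfl
  exact canAct_tensor_comul R k

lemma isAntipode_iff (s : D R k ⟶ D R k) : IsAntipode R k s ↔ s = antipodeHom R k :=
  ⟨fun h => hom_eq_of_canAct ((h _).trans (isAntipode_antipodeHom _).symm),
    fun h => h ▸ isAntipode_antipodeHom⟩

end Uniqueness

/-! ### Representations of `D` and objects of `𝒟`. -/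

section Representations

variable {X : Type u} [Group X] [Fintype X] {R : CosetReps X} {k : Type u} [Field k]

lemma canAct_δ_one {V : Type u} [AddCommGroup V] [Module k V] (σ : Str R k V) (ξ : V) (y : X) :
    σ.canAct ξ (δ R k y 1) = σ.pr y ξ := by
  rw [Str.canAct_δ, Str.act_one]

/-- The elements `δ_y ⊗ e` act as the homogeneous projections and `∑ δ_y ⊗ x` as `x`, and these data
determine an object structure. -/
lemma canAct_injective {V : Type u} [AddCommGroup V] [Module k V] {σ τ : Str R k V}
    (h : σ.canAct = τ.canAct) : σ = τ :=
  Str.ext_act (fun y ξ => by rw [← canAct_δ_one, h, canAct_δ_one])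
    (fun x ξ => by rw [← canAct_sum_δ, h, canAct_sum_δ])

lemma commute_canAct_iff (V W : DCat R k) (f : V.carrier →ₗ[k] W.carrier) :
    (∀ ξ h, f (V.str.canAct ξ h) = W.str.canAct (f ξ) h) ↔ ∃ φ : V ⟶ W, lin φ = f := by
  constructor
  · intro h
    refine ⟨homOfAct f (fun y => ?_) (fun x => ?_), rfl⟩
    · ext ξ
      have := h ξ (δ R k y 1)
      rw [canAct_δ_one, canAct_δ_one] at this
      first | exact this | exact this.symm
    · ext ξ
      have := h ξ (∑ y, δ R k y x)
      rw [canAct_sum_δ, canAct_sum_δ] at this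
      first | exact this | exact this.symm
  · rintro ⟨φ, rfl⟩ ξ h
    suffices lin φ ∘ₗ V.str.canAct ξ = W.str.canAct (lin φ ξ) from LinearMap.congr_fun this h
    refine ext_δ fun y x => ?_
    rw [LinearMap.comp_apply, Str.canAct_δ, Str.canAct_δ, lin_pr, lin_act]

variable [DecidableEq X] {V : Type u} [AddCommGroup V] [Module k V]

/-- The canonical action of `D` on an object of `𝒟` is a representation. -/
lemma isRep_canAct [Module.Finite k V] (σ : Str R k V) :
    IsRep (R := R) (mulHom R k) (oneHom R k) σ.canAct where
  one ξ := by rw [lin_oneHom_one, canAct_oneD]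
  act_mul x z ξ := by rw [canAct_sum_δ, canAct_sum_δ, canAct_sum_δ, Str.act_mul]
  mul a b h h' ξ ha hb := by
    have := LinearMap.congr_fun (congrArg lin (isProduct_mulHom R k ⟨V, σ⟩))
      ((ξ ⊗ₜ[k] h) ⊗ₜ[k] h')
    refine (Eq.trans this ?_)
    change TensorProduct.lift σ.canAct (TensorProduct.map LinearMap.id (mulLin R k)
      (Str.assocLin σ (D R k).str (D R k).str ((ξ ⊗ₜ h) ⊗ₜ h'))) = _
    rw [Str.assocLin_tmul _ ha hb, canAct_sum_δ]
    rfl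

variable {r : V →ₗ[k] (D R k).carrier →ₗ[k] V}

lemma DCat.IsRep.sum_δ_one (H : IsRep (R := R) (mulHom R k) (oneHom R k) r)
    (ξ : V) : r ξ (∑ y, δ R k y 1) = ξ := by
  have := H.one ξ
  rwa [lin_oneHom_one] at this

/-- A factor of degree `e` makes `τ` trivial, so the representation law becomes ordinary
multiplicativity. This makes the operators of `δ_y ⊗ e` orthogonal idempotents. -/
lemma DCat.IsRep.δ_one_δ (H : IsRep (R := R) (mulHom R k) (oneHom R k) r)
    (ξ : V) (y w x : X) :
    r (r ξ (δ R k y 1)) (δ R k w x) = if w = y then r ξ (δ R k y x) else 0 := by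
  rw [H.mul 1 _ _ _ ξ (pr_δ_of_eq (R.dDeg_one_right y)) (pr_δ w x), ttau_one_left,
    Subgroup.coe_one, H.sum_δ_one, lin_mulHom, mulLin_tmul]
  simp only [dDeg_one_right, ttau_one_left, Subgroup.coe_one, inv_one, one_mul, mul_one]
  split_ifs
  · rfl
  · exact map_zero _

lemma DCat.IsRep.δ_δ_one (H : IsRep (R := R) (mulHom R k) (oneHom R k) r)
    (ξ : V) (y w x : X) :
    r (r ξ (δ R k y x)) (δ R k w 1) = if w = x⁻¹ * y * x then r ξ (δ R k y x) else 0 := by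
  rw [H.mul _ 1 _ _ ξ (pr_δ y x) (pr_δ_of_eq (R.dDeg_one_right w)), ttau_one_right,
    Subgroup.coe_one, H.sum_δ_one, lin_mulHom, mulLin_tmul]
  simp only [dDeg_one_right, ttau_one_right, Subgroup.coe_one, inv_one, one_mul, mul_one]
  split_ifs
  · rfl
  · exact map_zero _

/-- Factors the operator of `δ_y ⊗ x` into a projection followed by the action of `x`, so the
representation agrees with the canonical action of the structure built from it. -/
lemma DCat.IsRep.δ_one_sum_δ (H : IsRep (R := R) (mulHom R k) (oneHom R k) r)
    (ξ : V) (y x : X) :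
    r (r ξ (δ R k y 1)) (∑ w, δ R k w x) = r ξ (δ R k y x) := by
  rw [map_sum]
  simp only [H.δ_one_δ]
  simp

/-- The object structure defined by a representation of `D`. -/
noncomputable def DCat.IsRep.str (H : IsRep (R := R) (mulHom R k) (oneHom R k) r) :
    Str R k V :=
  Str.ofAct R (fun y => r.flip (δ R k y 1))
    (fun y ξ => by
      simp only [LinearMap.flip_apply]
      rw [H.δ_one_δ, if_pos rfl])
    (fun y z ξ hyz => by
      simp only [LinearMap.flip_apply]
      rw [H.δ_one_δ, if_neg hyz])
    (fun ξ => by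
      simp only [LinearMap.flip_apply]
      rw [← map_sum, H.sum_δ_one])
    (fun x => r.flip (∑ y, δ R k y x))
    (fun ξ => H.sum_δ_one ξ)
    (fun x z ξ => H.act_mul x z ξ)
    (fun x y ξ h => by
      -- A vector of degree `y` moved by `x` lies in the image of `δ_y ⊗ x`, on which `δ_{x⁻¹ y x} ⊗
      -- e` acts as the identity.
      rw [← h]
      simp only [LinearMap.flip_apply]
      rw [H.δ_one_sum_δ, H.δ_δ_one, if_pos rfl])

lemma DCat.IsRep.canAct_str (H : IsRep (R := R) (mulHom R k) (oneHom R k) r) :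
    H.str.canAct = r := by
  refine LinearMap.ext fun ξ => ext_δ fun y x => ?_
  have h1 : H.str.act x = r.flip (∑ y, δ R k y x) :=
    congrFun (Str.act_ofAct _ _ _ _ (fun x => r.flip (∑ y, δ R k y x)) _ _ _) x
  rw [Str.canAct_δ, h1]
  exact H.δ_one_sum_δ ξ y x

lemma isRep_iff [Module.Finite k V] (r : V →ₗ[k] (D R k).carrier →ₗ[k] V) :
    IsRep (R := R) (mulHom R k) (oneHom R k) r ↔ ∃! σ : Str R k V, σ.canAct = r := by
  constructor
  · intro H
    exact ⟨H.str, H.canAct_str, fun σ h => canAct_injective (h.trans H.canAct_str.symm)⟩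
  · rintro ⟨σ, rfl, -⟩
    exact isRep_canAct σ

end Representations

end CosetReps

/-! ### The theorem. -/

open CosetReps DCat in
theorem mainTheorem10 {X k : Type u} [Group X] [Fintype X] [DecidableEq X] [Field k]
    (R : CosetReps X) :
    ∃ _ : HopfObj (D R k),
      -- the explicit product, identity, counit, coproduct and antipode
      (∀ y x w z : X, lin (MonObj.mul (X := D R k)) (δ R k y x ⊗ₜ[k] δ R k w z) =
        if w = x⁻¹ * y * x then
          δ R k ((R.ttau (R.dDeg (y, x)) (R.dDeg (w, z)) : X)⁻¹ * y *
              (R.ttau (R.dDeg (y, x)) (R.dDeg (w, z)) : X))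
            ((R.ttau (R.dDeg (y, x)) (R.dDeg (w, z)) : X)⁻¹ * x * z)
        else 0) ∧
      lin (MonObj.one (X := D R k)) (1 : k) = ∑ y : X, δ R k y 1 ∧
      (∀ y x : X, lin (ComonObj.counit (X := D R k)) (δ R k y x) =
        if y = 1 then (1 : k) else 0) ∧
      (∀ y x : X, lin (ComonObj.comul (X := D R k)) (δ R k y x) =
        ∑ z : X, comulLeft R k (y, x) z ⊗ₜ[k] comulRight R k (y, x) z) ∧
      (∀ y x : X, lin (HopfObj.antipode (X := D R k)) (δ R k y x) =
        δ R k (y⁻¹ * R.abv (R.dDeg (y, x)) * (R.ang (R.dDeg (y, x)) : X)⁻¹)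
          (R.ang (R.dDeg (y, x)) * x⁻¹ * R.abv (R.dDeg (y, x)))) ∧
      -- they are the morphisms defined by the diagrams
      (∀ m, IsProduct R k m ↔ m = MonObj.mul) ∧
      (∀ i, IsIdentity R k i ↔ i = MonObj.one) ∧
      (∀ c, IsCounit R k c ↔ c = ComonObj.counit) ∧
      (∀ d, IsCoproduct R k d ↔ d = ComonObj.comul) ∧
      (∀ s, IsAntipode R k s ↔ s = HopfObj.antipode) ∧
      -- the two antipode axioms
      (ComonObj.comul ≫ D R k ◁ HopfObj.antipode ≫ MonObj.mul : D R k ⟶ D R k) =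
        ComonObj.counit ≫ MonObj.one ∧
      (ComonObj.comul ≫ HopfObj.antipode ▷ D R k ≫ MonObj.mul : D R k ⟶ D R k) =
        ComonObj.counit ≫ MonObj.one ∧
      -- the representations of `D` are the objects of `𝒟`, with the same morphisms
      (∀ (V : Type u) [AddCommGroup V] [Module k V] [Module.Finite k V]
        (r : V →ₗ[k] (D R k).carrier →ₗ[k] V),
        IsRep (R := R) MonObj.mul MonObj.one r ↔ ∃! σ : Str R k V, σ.canAct = r) ∧
      (∀ (V W : DCat R k) (f : V.carrier →ₗ[k] W.carrier),
        (∀ ξ h, f (V.str.canAct ξ h) = W.str.canAct (f ξ) h) ↔ ∃ φ : V ⟶ W, lin φ = f) := by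
  refine ⟨hopfObjD R k, fun y x w z => mulLin_tmul y x w z, lin_oneHom_one R k,
    fun y x => counitLin_δ R k y x, fun y x => (comulLin_basisD (y, x)).trans
      (Finset.sum_congr rfl fun z _ => by rw [comulLeft_eq, comulRight_eq]),
    fun y x => antipodeLin_δ R k y x, isProduct_iff, isIdentity_iff, isCounit_iff,
    isCoproduct_iff_eq, isAntipode_iff, (hopfObjD R k).antipode_right,
    (hopfObjD R k).antipode_left, fun V _ _ _ r => isRep_iff r, commute_canAct_iff⟩
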